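/- Let $J\ge 3$ and $K\ge 2$ be fixed integers and let $\theta_1<1$ be a constant. For $N$ with $K\mid NJ$, let $\mathrm{LDPC}(N,x^J,x^K)$ be the uniform distribution on the bipartite Tanner graphs without parallel edges on $N$ labelled variable nodes, each of degree $J$, and $M=NJ/K$ labelled check nodes, each of degree $K$; equivalently, on the binary $M\times N$ parity-check matrices with column weight $J$ and row weight $K$. For a binary-input memoryless channel, let $\overline P_e$ be the average bit error rate (BER) of the ensemble after $l$ iterations of belief-propagation (BP) decoding with the flooding schedule. Here the average is over the graph, over a uniformly chosen transmitted codeword and over the $N$ bits. The initial messages are zero, the channel messages are the log-likelihood ratios $\ln\frac{p(y_i|0)}{p(y_i|1)}$, the message of a variable node to a check node is its channel message plus the sum of the messages of its other check nodes, the message of a check node is $2\tanh^{-1}\prod\tanh(\cdot/2)$ over its other variable nodes, and a bit is decided by the sign of its channel message plus the sum of all its incoming messages. If that output message vanishes, the bit is undecided. On the BEC an undecided bit counts as an error; on the other two channels it counts as an error with a weight $\tau\in[1/2,1]$, and the bounds hold for each such $\tau$ (in particular for $\tau=1$, an error, and $\tau=1/2$, a fair coin). Put $Q(x)=\int_x^\infty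 \frac1{\sqrt{2\pi}}e^{-t^2/2}\,dt$ and $$w^{UB}_{2l}=\begin{cases}\dfrac{J(J-1)^l-2}{J-2}, & l\le \theta_1\log_{(J-1)^5(K-1)^3}N^2,\\[2mm] N, & l>\log_{(J-1)(K-1)}\!\left(\left(1-\tfrac{K}{J(K-1)}\right)N\right),\\[2mm] \dfrac{J(K-1)^{l+1}(J-1)^l-K}{(J-1)(K-1)-1}, & \text{otherwise,}\end{cases}$$ where the cases are read in this order. Then there is an $N_0$, depending only on $J,K,\theta_1$, such that for all $N\ge N_0$ with $K\mid NJ$ and all $l\ge 0$: (1) for the binary-input AWGN channel (inputs $\pm1$) with noise variance $\sigma^2>0$, $$\overline P_e\ \ge\ Q\!\left(\sqrt{w^{UB}_{2l}/\sigma^2}\right)\ \ge\ \frac{e^{1/(\pi+2)}}{4}\sqrt{\frac{\pi+2}{\pi}}\;2^{-\frac{1}{\sigma^2\ln 2}w^{UB}_{2l}};$$ (2) for the BSC with crossover probability $q\in[0,1/2]$, $\overline P_e\ge q^{(w^{UB}_{2l}+1)/2}$; (3) for the BEC with erasure probability $\epsilon\in[0,1]$, $\overline P_e\ge \epsilon^{\,w^{UB}_{2l}}$;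 (4) if $l\le \theta_1\log_{(J-1)^5(K-1)^3}N^2$, then $\overline P_e\ge h\,2^{-a2^{bl}}$ with $b=\log_2(J-1)$ and $h,a>0$ given by $h=\frac{e^{1/(\pi+2)}}{4}\sqrt{\frac{\pi+2}{\pi}}\,e^{\frac{2}{\sigma^2(J-2)}}$, $a=\frac{1}{\sigma^2\ln2}\frac{J}{J-2}$ for the binary-input AWGN channel with $\sigma^2>0$; $h=q^{\frac{J-4}{2(J-2)}}$, $a=|\log_2q|\frac{J}{2(J-2)}$ for the BSC with $0<q\le 1/2$; $h=\epsilon^{-\frac{2}{J-2}}$, $a=|\log_2\epsilon|\frac{J}{J-2}$ for the BEC with $0<\epsilon<1$. -/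

import Mathlib

open scoped ENNReal

namespace LDPC

noncomputable section

/-! ### Parity-check matrices, Tanner graphs and the regular ensemble

The Tanner graph of `H : Matrix (Fin M) (Fin N) (ZMod 2)` has an edge between the variable node `v`
and the check node `c` if and only if `H c v = 1`. Bipartite graphs without parallel edges on
labelled nodes correspond bijectively to such matrices. -/

/-- The check nodes adjacent to the variable node `v`. -/
def checksOf {M N : ℕ} (H : Matrix (Fin M) (Fin N) (ZMod 2)) (v : Fin N) : Finset (Fin M) :=
  Finset.univ.filter fun c => H c v = 1

/-- The variable nodes adjacent to the check node `c`. -/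
def varsOf {M N : ℕ} (H : Matrix (Fin M) (Fin N) (ZMod 2)) (c : Fin M) : Finset (Fin N) :=
  Finset.univ.filter fun v => H c v = 1

/-- The codewords `s`, that is, the solutions of `H s = 0`. -/
def code {M N : ℕ} (H : Matrix (Fin M) (Fin N) (ZMod 2)) : Finset (Fin N → ZMod 2) :=
  Finset.univ.filter fun s => H.mulVec s = 0

/-- The `(J, K)`-regular Tanner graphs (without parallel edges) with `N` variable nodes of degree `J`
and `M` check nodes of degree `K`. The ensemble `LDPC(N, x^J, x^K)` is the uniform distribution on
this set, where `M * K = N * J`. -/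
def regularEnsemble (N M J K : ℕ) : Finset (Matrix (Fin M) (Fin N) (ZMod 2)) :=
  Finset.univ.filter fun H =>
    (∀ v, (checksOf H v).card = J) ∧ (∀ c, (varsOf H c).card = K)

/-! ### Binary-input memoryless channels -/

/-- A binary-input channel with output space `Y`: a reference measure on `Y` and, for each input
bit `x`, the density `density x y = p(y | x)` of the output. -/
structure Channel (Y : Type) [MeasurableSpace Y] where
  ref : MeasureTheory.Measure Y
  density : ZMod 2 → Y → ℝ≥0∞

/-- The law of the output of the channel when the bit `x` is sent. -/
def Channel.law {Y : Type} [MeasurableSpace Y] (W : Channel Y) (x : ZMod 2) :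
    MeasureTheory.Measure Y :=
  W.ref.withDensity (W.density x)

/-- The law of the received vector when the word `s` is sent (memoryless transmission). -/
def Channel.wordLaw {Y : Type} [MeasurableSpace Y] (W : Channel Y) {N : ℕ} (s : Fin N → ZMod 2) :
    MeasureTheory.Measure (Fin N → Y) :=
  MeasureTheory.Measure.pi fun i => W.law (s i)

/-- The log-likelihood ratio `ln (p(y | 0) / p(y | 1))`, with values in `[-∞, ∞]`. -/
def Channel.llr {Y : Type} [MeasurableSpace Y] (W : Channel Y) (y : Y) : EReal :=
  ENNReal.log (W.density 0 y / W.density 1 y)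

/-- The binary-input AWGN channel with noise variance `σ ^ 2`: the bit `x` is sent as `(-1) ^ x`. -/
def biAWGN (σ : ℝ) : Channel ℝ where
  ref := MeasureTheory.volume
  density x := ProbabilityTheory.gaussianPDF (if x = 0 then 1 else -1) (Real.toNNReal (σ ^ 2))

/-- The binary symmetric channel with crossover probability `q`. -/
def bsc (q : ℝ) : Channel (ZMod 2) where
  ref := MeasureTheory.Measure.count
  density x y := if y = x then ENNReal.ofReal (1 - q) else ENNReal.ofReal q

/-- The binary erasure channel with erasure probability `ε`; the output `Sum.inr ()` is the
erasure. -/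
def bec (ε : ℝ) : Channel (ZMod 2 ⊕ Unit) where
  ref := MeasureTheory.Measure.count
  density x
    | Sum.inl b => if b = x then ENNReal.ofReal (1 - ε) else 0
    | Sum.inr _ => ENNReal.ofReal ε

/-! ### Belief propagation (flooding schedule)

Messages live in `[-∞, ∞]`, since the log-likelihood ratios of the erasure channel are `0` or `±∞`.
(Sums with both `∞` and `-∞` do not arise from words received over the channel.) -/

/-- `tanh (x / 2)` on `[-∞, ∞]`. -/
def tanhHalf (x : EReal) : ℝ :=
  if x = ⊤ then 1 else if x = ⊥ then -1 else Real.tanh (x.toReal / 2)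

/-- `2 artanh t`, with values in `[-∞, ∞]`. -/
def twoArtanh (t : ℝ) : EReal :=
  if 1 ≤ t then ⊤ else if t ≤ -1 then ⊥ else ((2 * Real.artanh t : ℝ) : EReal)

/-- The variable-to-check update: the message from `v` to `c`, computed from the incoming
check-to-variable messages `msg` of the previous iteration. -/
def varToCheck {M N : ℕ} (H : Matrix (Fin M) (Fin N) (ZMod 2)) (llr : Fin N → EReal)
    (msg : Fin M → Fin N → EReal) (v : Fin N) (c : Fin M) : EReal :=
  llr v + ∑ α ∈ (checksOf H v).erase c, msg α v

/-- The check-to-variable messages after `l` iterations. -/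
def checkToVar {M N : ℕ} (H : Matrix (Fin M) (Fin N) (ZMod 2)) (llr : Fin N → EReal) :
    ℕ → Fin M → Fin N → EReal
  | 0, _, _ => 0
  | l + 1, c, v =>
      twoArtanh (∏ β ∈ (varsOf H c).erase v,
        tanhHalf (varToCheck H llr (checkToVar H llr l) β c))

/-- The output message of the variable node `v` after `l` iterations. -/
def bpOutput {M N : ℕ} (H : Matrix (Fin M) (Fin N) (ZMod 2)) (llr : Fin N → EReal) (l : ℕ)
    (v : Fin N) : EReal :=
  llr v + ∑ α ∈ checksOf H v, checkToVar H llr l α v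

/-- The output message `B` decides for the wrong bit when `x` was sent (`B > 0` means `0`,
`B < 0` means `1`). -/
def WrongDecision (x : ZMod 2) (B : EReal) : Prop :=
  if x = 0 then B < 0 else 0 < B

/-! ### Bit error rates

A vanishing output message leaves the bit undecided; it counts as an error with weight `τ`. So
`τ = 1` says that an undecided bit is an error, and `τ = 1 / 2` that it is decided by a fair coin. -/

/-- The error probability of the variable node `v` after `l` iterations when `s` is sent. -/
def bitError {Y : Type} [MeasurableSpace Y] (W : Channel Y) (τ : ℝ) (l : ℕ) {M N : ℕ}
    (H : Matrix (Fin M) (Fin N) (ZMod 2)) (s : Fin N → ZMod 2) (v : Fin N) : ℝ :=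
  (W.wordLaw s).real {y | WrongDecision (s v) (bpOutput H (fun i => W.llr (y i)) l v)} +
    τ * (W.wordLaw s).real {y | bpOutput H (fun i => W.llr (y i)) l v = 0}

/-- The bit error rate of the code of `H`: the average over a uniformly distributed codeword and
over the `N` variable nodes. -/
def ber {Y : Type} [MeasurableSpace Y] (W : Channel Y) (τ : ℝ) (l : ℕ) {M N : ℕ}
    (H : Matrix (Fin M) (Fin N) (ZMod 2)) : ℝ :=
  (∑ s ∈ code H, (∑ v, bitError W τ l H s v) / N) / (code H).card

/-- The average bit error rate of the ensemble `LDPC(N, x^J, x^K)` with `M` check nodes. -/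
def averageBER {Y : Type} [MeasurableSpace Y] (W : Channel Y) (τ : ℝ)
    (l N M J K : ℕ) : ℝ :=
  (∑ H ∈ regularEnsemble N M J K, ber W τ l H) / (regularEnsemble N M J K).card

/-! ### The quantities in the bounds -/

/-- The complementary distribution function of the standard normal law. -/
def gaussQ (x : ℝ) : ℝ :=
  ∫ t in Set.Ioi x, (1 / Real.sqrt (2 * Real.pi)) * Real.exp (-t ^ 2 / 2)

/-- The constant `e^{1/(π+2)} / 4 * √((π+2)/π)`. -/
def chernoffConst : ℝ :=
  Real.exp (1 / (Real.pi + 2)) / 4 * Real.sqrt ((Real.pi + 2) / Real.pi)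

/-- The low-iteration threshold `θ log_{(J-1)^5 (K-1)^3} N^2`. -/
def lowThreshold (θ : ℝ) (N J K : ℕ) : ℝ :=
  θ * Real.logb (((J : ℝ) - 1) ^ 5 * ((K : ℝ) - 1) ^ 3) ((N : ℝ) ^ 2)

/-- The high-iteration threshold `log_{(J-1)(K-1)} ((1 - K / (J (K-1))) N)`. -/
def highThreshold (N J K : ℕ) : ℝ :=
  Real.logb (((J : ℝ) - 1) * ((K : ℝ) - 1)) ((1 - (K : ℝ) / (J * ((K : ℝ) - 1))) * N)

open Classical in
/-- The piecewise quantity `w^UB_{2l}(N, x^J, x^K)`. -/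
def wUB (θ : ℝ) (l N J K : ℕ) : ℝ :=
  if (l : ℝ) ≤ lowThreshold θ N J K then
    ((J : ℝ) * ((J : ℝ) - 1) ^ l - 2) / ((J : ℝ) - 2)
  else if highThreshold N J K < (l : ℝ) then
    (N : ℝ)
  else
    ((J : ℝ) * ((K : ℝ) - 1) ^ (l + 1) * ((J : ℝ) - 1) ^ l - K) /
      (((J : ℝ) - 1) * ((K : ℝ) - 1) - 1)

/-- `P ≥ h * 2 ^ (-a * 2 ^ (b * l))` with `h, a > 0`. -/
def DoubleExpLowerBound (h a b : ℝ) (l : ℕ) (P : ℝ) : Prop :=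
  0 < h ∧ 0 < a ∧ h * (2 : ℝ) ^ (-a * (2 : ℝ) ^ (b * (l : ℝ))) ≤ P

end

end LDPC

/-!
# Lower bounds for the bit error rate of regular LDPC ensembles under belief propagation

Everything rests on a comparison with the decision between two words. Changing the signs of the
log-likelihood ratios on a set `S ∋ v` of variable nodes that meets every check node near `v` an
even number of times changes the sign of the output message of `v` (`bpOut_sign`). So belief
propagation cannot err less often than the optimal decision between two words that differ on `S`
(`SymLLR.pairError_le`), and the error probability of the latter is `Q(√(|S| / σ²))` for the Gaussian
channel (`awgn_pairError`) and at least `q ^ ((w + 1) / 2)` for the symmetric channel if `|S| ≤ w`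
(`bsc_pairError_ge`). By symmetry, all codewords have the same error probability
(`SymLLR.nodeError_le_bitError`), and the average over the graphs is an average over socket
assignments `g : Fin M × Fin K → Fin N` (`average_eq`).

A candidate for `S` is the set `selSet` of the ends of all walks from `v` that leave each check node
through one selected socket. It has at most `devSize J l ≤ wUB` elements, and it meets the check
nodes evenly if `K = 2` or if no cycle is closed near `v`; such graphs are called `Good`. The
fraction `p` of bad graphs is small by a switching argument (`card_badSockets_mul_le`), but it is
not zero, and the bound has to hold for the average, without any loss. So the bad graphs have to be
compensated, uniformly in the noise:

* On good graphs with `K ≥ 3`, belief propagation has to decide between four words, since `S` can be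
  modified by the pair of nodes reached through two other sockets of one check node. This improves
  the bound by a factor (`SymLLR.gain`), which outweighs `p` for moderate noise
  (`awgn_moderate_sum_ge`). For the symmetric channel, the bound for two words already has a factor
  `√2` to spare (`bsc_pairError_ge_sqrt_two`).
* For weak noise, a polynomially small fraction of graphs in which `v` has a twin, with the same
  check nodes as `v`, already gives more than needed, as `{v, u}` is a codeword of weight two
  (`card_sockets_le_twin`, `SymLLR.twin_sum_ge`).
* For strong noise, the check node update contracts the messages, and the error probability is
  `1 / 2 - O(1 / σ)` for every graph and every number of iterations
  (`nodeError_ge_of_strong_noise`).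

The regimes overlap if they are separated at `σ = X` and `σ = 1 / X` for a small power `X` of `N`
(`Scale`). Beyond the low-iteration regime `wUB` is at least `X ^ 4`, and twins and strong noise
suffice. For the erasure channel, erasures on a set of at most `devSize J l` nodes erase the output
of `v`, in every graph (`exists_stallSet`). The Chernoff-type bound for `Q` is `chernoffConst_le`,
and the double-exponential form is a restatement of the bounds in the low-iteration regime.
-/
namespace LDPC

/-! ### Belief propagation with real log-likelihood ratios -/

/-- The check-to-variable messages of belief propagation for finite log-likelihood ratios, as real
numbers. -/
noncomputable def chkMsg {M N : ℕ} (H : Matrix (Fin M) (Fin N) (ZMod 2)) (L : Fin N → ℝ) :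
    ℕ → Fin M → Fin N → ℝ
  | 0, _, _ => 0
  | l + 1, c, v => 2 * Real.artanh (∏ β ∈ (varsOf H c).erase v,
      Real.tanh ((L β + ∑ α ∈ (checksOf H β).erase c, chkMsg H L l α β) / 2))

/-- The output message of belief propagation for finite log-likelihood ratios, as a real number. -/
noncomputable def bpOut {M N : ℕ} (H : Matrix (Fin M) (Fin N) (ZMod 2)) (L : Fin N → ℝ) (l : ℕ)
    (v : Fin N) : ℝ :=
  L v + ∑ α ∈ checksOf H v, chkMsg H L l α v

lemma abs_tanh_lt_one (x : ℝ) : |Real.tanh x| < 1 := by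
  have := Real.tanh_bijOn.mapsTo (Set.mem_univ x)
  exact abs_lt.2 this

lemma abs_prod_tanh_lt_one {ι : Type*} (s : Finset ι) (hs : s.Nonempty) (f : ι → ℝ) :
    |∏ i ∈ s, Real.tanh (f i)| < 1 := by
  classical
  obtain ⟨a, ha⟩ := hs
  rw [← Finset.mul_prod_erase s _ ha, abs_mul, Finset.abs_prod]
  have h1 : ∏ i ∈ s.erase a, |Real.tanh (f i)| ≤ 1 :=
    Finset.prod_le_one (fun _ _ => abs_nonneg _) fun _ _ => (abs_tanh_lt_one _).le
  calc _ ≤ |Real.tanh (f a)| * 1 := by gcongr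
    _ < 1 := by rw [mul_one]; exact abs_tanh_lt_one _

/-- No condition `|x| < 1` is needed: the square root, the logarithm and the division by zero are
compatible with `x ↦ x⁻¹` also at their junk values. -/
lemma artanh_neg_eq (x : ℝ) : Real.artanh (-x) = -Real.artanh x := by
  rw [Real.artanh, Real.artanh, ← Real.log_inv, ← Real.sqrt_inv, inv_div]
  congr 3
  · ring

lemma coe_finset_sum_ereal {ι : Type*} (s : Finset ι) (f : ι → ℝ) :
    ((∑ i ∈ s, f i : ℝ) : EReal) = ∑ i ∈ s, (f i : EReal) := by
  classical
  induction s using Finset.induction_on with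
  | empty => simp
  | insert a s ha ih => rw [Finset.sum_insert ha, Finset.sum_insert ha, EReal.coe_add, ih]

lemma tanhHalf_coe (x : ℝ) : tanhHalf (x : EReal) = Real.tanh (x / 2) := by
  simp [tanhHalf]

/-- If no check node has degree one, then finite log-likelihood ratios give finite messages. -/
lemma checkToVar_coe {M N : ℕ} (H : Matrix (Fin M) (Fin N) (ZMod 2))
    (hH : ∀ c, 2 ≤ (varsOf H c).card) (L : Fin N → ℝ) (l : ℕ) (c : Fin M) (v : Fin N) :
    checkToVar H (fun i => (L i : EReal)) l c v = (chkMsg H L l c v : EReal) := by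
  induction l generalizing c v with
  | zero => simp [checkToVar, chkMsg]
  | succ l ih =>
    have hne : ((varsOf H c).erase v).Nonempty := by
      rw [← Finset.card_pos]
      have := Finset.pred_card_le_card_erase (s := varsOf H c) (a := v)
      have := hH c
      omega
    have hlt := abs_lt.1 (abs_prod_tanh_lt_one _ hne
      fun β => (L β + ∑ α ∈ (checksOf H β).erase c, chkMsg H L l α β) / 2)
    have : ∀ β, varToCheck H (fun i => (L i : EReal))
        (checkToVar H (fun i => (L i : EReal)) l) β c
        = ((L β + ∑ α ∈ (checksOf H β).erase c, chkMsg H L l α β : ℝ) : EReal) := by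
      intro β
      simp only [varToCheck, ih, EReal.coe_add, coe_finset_sum_ereal]
    simp only [checkToVar, this, tanhHalf_coe, chkMsg]
    rw [twoArtanh, if_neg (not_le.2 hlt.2), if_neg (not_le.2 hlt.1)]

lemma bpOutput_coe {M N : ℕ} (H : Matrix (Fin M) (Fin N) (ZMod 2))
    (hH : ∀ c, 2 ≤ (varsOf H c).card) (L : Fin N → ℝ) (l : ℕ) (v : Fin N) :
    bpOutput H (fun i => (L i : EReal)) l v = (bpOut H L l v : EReal) := by
  simp only [bpOutput, bpOut, checkToVar_coe H hH, EReal.coe_add, coe_finset_sum_ereal]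

/-! ### Socket assignments -/

/-- The Tanner graph of a socket assignment `g`, where the socket `(c, i)` of the check node `c` is
attached to the variable node `g (c, i)`. -/
def matOf {M K N : ℕ} (g : Fin M × Fin K → Fin N) : Matrix (Fin M) (Fin N) (ZMod 2) :=
  fun c v => if ∃ i, g (c, i) = v then 1 else 0

/-- `g` attaches the sockets of each check node to distinct variable nodes, and each variable node
to `J` sockets. So `g` is a `(J, K)`-regular Tanner graph together with an ordering of the
neighbours of each check node. -/
def IsSocket {M K N : ℕ} (J : ℕ) (g : Fin M × Fin K → Fin N) : Prop :=
  (∀ c, Function.Injective fun i => g (c, i)) ∧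
    ∀ v, (Finset.univ.filter fun q => g q = v).card = J

section
variable {M K N J : ℕ} {g : Fin M × Fin K → Fin N}

lemma IsSocket.eq_of_row (hg : IsSocket J g) {p q : Fin M × Fin K} (h1 : p.1 = q.1)
    (h2 : g p = g q) : p = q := by
  obtain ⟨c, i⟩ := p
  obtain ⟨d, j⟩ := q
  obtain rfl : c = d := h1
  rw [hg.1 c h2]

lemma varsOf_matOf (g : Fin M × Fin K → Fin N) (c : Fin M) :
    varsOf (matOf g) c = Finset.univ.image fun i => g (c, i) := by
  ext v; simp [varsOf, matOf]

lemma checksOf_matOf (g : Fin M × Fin K → Fin N) (v : Fin N) :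
    checksOf (matOf g) v = (Finset.univ.filter fun q => g q = v).image Prod.fst := by
  ext c; simp [checksOf, matOf]

lemma prod_varsOf_erase (hg : IsSocket J g) (q : Fin M × Fin K) (F : Fin N → ℝ) :
    ∏ β ∈ (varsOf (matOf g) q.1).erase (g q), F β
      = ∏ i ∈ Finset.univ.erase q.2, F (g (q.1, i)) := by
  rw [varsOf_matOf, show g q = (fun i => g (q.1, i)) q.2 from rfl,
    ← Finset.image_erase (hg.1 q.1), Finset.prod_image fun a _ b _ h => hg.1 q.1 h]

lemma sum_checksOf_erase (hg : IsSocket J g) (q : Fin M × Fin K) (F : Fin M → ℝ) :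
    ∑ α ∈ (checksOf (matOf g) (g q)).erase q.1, F α
      = ∑ p ∈ (Finset.univ.filter fun p => g p = g q).erase q, F p.1 := by
  have hinj : ∀ a ∈ Finset.univ.filter (fun p => g p = g q),
      ∀ b ∈ Finset.univ.filter (fun p => g p = g q), a.1 = b.1 → a = b := by
    intro a ha b hb h
    simp only [Finset.mem_filter, Finset.mem_univ, true_and] at ha hb
    exact hg.eq_of_row h (ha.trans hb.symm)
  rw [← Finset.sum_image (f := F) (g := Prod.fst)
    (s := (Finset.univ.filter fun p => g p = g q).erase q)
    (fun a ha b hb h => hinj a (Finset.mem_of_mem_erase ha) b (Finset.mem_of_mem_erase hb) h)]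
  congr 1
  rw [checksOf_matOf]
  ext c
  simp only [Finset.mem_erase, Finset.mem_image, Finset.mem_filter, Finset.mem_univ, true_and]
  constructor
  · rintro ⟨h, a, ha, rfl⟩
    exact ⟨a, ⟨fun h' => h (h' ▸ rfl), ha⟩, rfl⟩
  · rintro ⟨a, ⟨h, ha⟩, rfl⟩
    exact ⟨fun h' => h (hg.eq_of_row h' ha), a, ha, rfl⟩

lemma sum_checksOf (hg : IsSocket J g) (v : Fin N) (F : Fin M → ℝ) :
    ∑ α ∈ checksOf (matOf g) v, F α = ∑ p ∈ Finset.univ.filter fun p => g p = v, F p.1 := by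
  rw [checksOf_matOf, Finset.sum_image]
  intro a ha b hb h
  simp only [Finset.coe_filter, Finset.mem_univ, true_and, Set.mem_ofPred_eq] at ha hb
  exact hg.eq_of_row h (ha.trans hb.symm)

lemma card_varsOf_matOf (hg : IsSocket J g) (c : Fin M) : (varsOf (matOf g) c).card = K := by
  rw [varsOf_matOf, Finset.card_image_of_injective _ (hg.1 c), Finset.card_univ, Fintype.card_fin]

lemma card_checksOf_matOf (hg : IsSocket J g) (v : Fin N) : (checksOf (matOf g) v).card = J := by
  rw [checksOf_matOf, Finset.card_image_of_injOn, hg.2 v]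
  intro a ha b hb h
  simp only [Finset.coe_filter, Finset.mem_univ, true_and, Set.mem_ofPred_eq] at ha hb
  exact hg.eq_of_row h (ha.trans hb.symm)

/-! ### Walks in the Tanner graph

A walk that starts at the variable node `v` is the list of the sockets (edges) it uses, the last one
first. After an odd number of edges it is at a check node, after an even number at a variable node.
-/

/-- The sockets by which a walk without backtracking continues the walk `w` from `v`. -/
def steps (g : Fin M × Fin K → Fin N) (v : Fin N) : List (Fin M × Fin K) → Finset (Fin M × Fin K)
  | [] => Finset.univ.filter fun q => g q = v
  | p :: w =>
    if Even w.length then Finset.univ.filter fun q => q.1 = p.1 ∧ q ≠ p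
    else Finset.univ.filter fun q => g q = g p ∧ q ≠ p

/-- Each element of the list is among those that `f` allows after the elements that follow it in the
list. -/
def Follows {α : Type*} (f : List α → Finset α) : List α → Prop
  | [] => True
  | q :: w => q ∈ f w ∧ Follows f w

/-- `w` is a walk from `v` without backtracking. -/
abbrev IsWalk (g : Fin M × Fin K → Fin N) (v : Fin N) : List (Fin M × Fin K) → Prop :=
  Follows (steps g v)

/-- The sign change `ε` of the log-likelihood ratios satisfies the check nodes that lie within
`2 * l - 1` steps of `v`. -/
def LocalSign (g : Fin M × Fin K → Fin N) (v : Fin N) (l : ℕ) (ε : Fin N → ℝ) : Prop :=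
  ∀ q w, IsWalk g v (q :: w) → Even w.length → w.length + 2 ≤ 2 * l → ∏ i, ε (g (q.1, i)) = 1

lemma prod_sign_erase {ε : Fin N → ℝ} (hε : ∀ u, ε u = 1 ∨ ε u = -1) (q : Fin M × Fin K)
    (h : ∏ i, ε (g (q.1, i)) = 1) : ∏ i ∈ Finset.univ.erase q.2, ε (g (q.1, i)) = ε (g q) := by
  rw [← Finset.mul_prod_erase _ _ (Finset.mem_univ q.2)] at h
  change ε (g q) * _ = 1 at h
  rcases hε (g q) with h' | h' <;> rw [h'] at h ⊢ <;> linarith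

/-- The message along an edge changes its sign together with the log-likelihood ratio at its end, as
long as the check nodes that it depends on are within reach of `LocalSign`. -/
lemma chkMsg_sign (hg : IsSocket J g) {v : Fin N} {l : ℕ} {ε : Fin N → ℝ}
    (hε : ∀ u, ε u = 1 ∨ ε u = -1) (hloc : LocalSign g v l ε) (L : Fin N → ℝ) (k : ℕ) :
    ∀ q w, IsWalk g v (q :: w) → Even w.length → w.length + 2 * k ≤ 2 * l →
      chkMsg (matOf g) (fun u => ε u * L u) k q.1 (g q)
        = ε (g q) * chkMsg (matOf g) L k q.1 (g q) := by
  induction k with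
  | zero => simp [chkMsg]
  | succ k ih =>
    intro q w hw he hl
    have hrow := prod_sign_erase hε q (hloc q w hw he (by omega))
    simp only [chkMsg]
    rw [prod_varsOf_erase hg, prod_varsOf_erase hg]
    have key : ∀ i ∈ Finset.univ.erase q.2,
        Real.tanh ((ε (g (q.1, i)) * L (g (q.1, i)) +
          ∑ α ∈ (checksOf (matOf g) (g (q.1, i))).erase q.1,
            chkMsg (matOf g) (fun u => ε u * L u) k α (g (q.1, i))) / 2)
        = ε (g (q.1, i)) * Real.tanh ((L (g (q.1, i)) +
          ∑ α ∈ (checksOf (matOf g) (g (q.1, i))).erase q.1,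
            chkMsg (matOf g) L k α (g (q.1, i))) / 2) := by
      intro i hi
      have hs1 := sum_checksOf_erase hg (q.1, i)
        (fun α => chkMsg (matOf g) (fun u => ε u * L u) k α (g (q.1, i)))
      have hs2 := sum_checksOf_erase hg (q.1, i)
        (fun α => chkMsg (matOf g) L k α (g (q.1, i)))
      simp only at hs1 hs2
      rw [hs1, hs2]
      have hsum : ∑ p ∈ (Finset.univ.filter fun p => g p = g (q.1, i)).erase (q.1, i),
          chkMsg (matOf g) (fun u => ε u * L u) k p.1 (g (q.1, i))
          = ε (g (q.1, i)) *
            ∑ p ∈ (Finset.univ.filter fun p => g p = g (q.1, i)).erase (q.1, i),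
              chkMsg (matOf g) L k p.1 (g (q.1, i)) := by
        rw [Finset.mul_sum]
        refine Finset.sum_congr rfl fun p hp => ?_
        simp only [Finset.mem_erase, Finset.mem_filter, Finset.mem_univ, true_and] at hp
        rw [← hp.2]
        refine ih p ((q.1, i) :: q :: w) ⟨?_, ?_, hw⟩ ?_ ?_
        · have : ¬ Even (q :: w).length := by
            simp [Nat.even_add_one, he]
          simp only [steps, this, if_false, Finset.mem_filter, Finset.mem_univ, true_and]
          exact ⟨hp.2, hp.1⟩
        · have : i ≠ q.2 := Finset.ne_of_mem_erase hi
          simp only [steps, he, if_true, Finset.mem_filter, Finset.mem_univ, true_and]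
          exact fun h => this (congrArg Prod.snd h)
        · simpa [Nat.even_add_one] using he
        · simp only [List.length_cons]; omega
      rw [hsum]
      rcases hε (g (q.1, i)) with h | h
      · rw [h]; simp
      · rw [h, neg_one_mul (Real.tanh _), ← Real.tanh_neg]
        congr 1; ring
    rw [Finset.prod_congr rfl key, Finset.prod_mul_distrib, hrow]
    rcases hε (g q) with h | h
    · rw [h]; simp
    · rw [h, neg_one_mul, artanh_neg_eq]; ring

/-- Belief propagation is equivariant under a sign change of the log-likelihood ratios that
satisfies all check nodes of the computation tree. -/
lemma bpOut_sign (hg : IsSocket J g) {v : Fin N} {l : ℕ} {ε : Fin N → ℝ}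
    (hε : ∀ u, ε u = 1 ∨ ε u = -1) (hloc : LocalSign g v l ε) (L : Fin N → ℝ) :
    bpOut (matOf g) (fun u => ε u * L u) l v = ε v * bpOut (matOf g) L l v := by
  rw [bpOut, bpOut, sum_checksOf hg, sum_checksOf hg, mul_add, Finset.mul_sum]
  congr 1
  refine Finset.sum_congr rfl fun p hp => ?_
  simp only [Finset.mem_filter, Finset.mem_univ, true_and] at hp
  have := chkMsg_sign hg hε hloc L l p [] (by simp [Follows, steps, hp]) (by simp) (by simp)
  rwa [hp] at this

end

/-! ### Averaging over the ensemble by averaging over socket assignments -/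

open Classical in
/-- The set of all `(J, K)`-regular socket assignments. -/
noncomputable def sockets (N M J K : ℕ) : Finset (Fin M × Fin K → Fin N) :=
  Finset.univ.filter fun g => IsSocket J g

lemma mem_sockets {N M J K : ℕ} {g : Fin M × Fin K → Fin N} :
    g ∈ sockets N M J K ↔ IsSocket J g := by simp [sockets]

lemma matOf_mem {N M J K : ℕ} {g : Fin M × Fin K → Fin N} (hg : IsSocket J g) :
    matOf g ∈ regularEnsemble N M J K := by
  simp only [regularEnsemble, Finset.mem_filter, Finset.mem_univ, true_and]
  exact ⟨card_checksOf_matOf hg, card_varsOf_matOf hg⟩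

lemma eq_of_varsOf_eq {M N : ℕ} {H H' : Matrix (Fin M) (Fin N) (ZMod 2)}
    (h : ∀ c, varsOf H c = varsOf H' c) : H = H' := by
  have key : ∀ a b : ZMod 2, (a = 1 ↔ b = 1) → a = b := by decide
  ext c v
  have := Finset.ext_iff.1 (h c) v
  simp only [varsOf, Finset.mem_filter, Finset.mem_univ, true_and] at this
  rw [key _ _ this]

/-- The enumerations of a finite set by `Fin K`. -/
def enums {N : ℕ} (K : ℕ) (s : Finset (Fin N)) : Finset (Fin K → Fin N) :=
  Finset.univ.filter fun f => Function.Injective f ∧ Finset.univ.image f = s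

lemma card_enums {N K : ℕ} (s : Finset (Fin N)) (hs : s.card = K) :
    (enums K s).card = K.factorial := by
  have e0 : Fin K ≃ s := (Fintype.equivFinOfCardEq (by simpa using hs)).symm
  have h1 := Fintype.card_equiv e0
  rw [Fintype.card_fin] at h1
  rw [← h1, ← Fintype.card_coe]
  refine Fintype.card_congr ?_
  refine
    { toFun := fun f => Equiv.ofBijective (fun i => (⟨f.1 i, ?_⟩ : s)) ⟨?_, ?_⟩
      invFun := fun e => ⟨fun i => (e i : Fin N), ?_⟩
      left_inv := fun f => rfl
      right_inv := fun e => by ext; rfl }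
  · have := (Finset.mem_filter.1 f.2).2.2
    exact (Finset.ext_iff.1 this _).1 (Finset.mem_image_of_mem _ (Finset.mem_univ i))
  · intro a b hab
    exact (Finset.mem_filter.1 f.2).2.1 (Subtype.ext_iff.1 hab)
  · rintro ⟨x, hx⟩
    rw [← (Finset.mem_filter.1 f.2).2.2] at hx
    obtain ⟨i, -, hi⟩ := Finset.mem_image.1 hx
    exact ⟨i, Subtype.ext hi⟩
  · simp only [enums, Finset.mem_filter, Finset.mem_univ, true_and]
    refine ⟨fun a b hab => e.injective (Subtype.ext hab), ?_⟩
    ext x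
    simp only [Finset.mem_image, Finset.mem_univ, true_and]
    exact ⟨fun ⟨i, hi⟩ => hi ▸ (e i).2, fun hx => ⟨e.symm ⟨x, hx⟩, by simp⟩⟩

/-- Each Tanner graph comes from `K!` orderings at each of its `M` check nodes. -/
lemma card_fiber_matOf {N M J K : ℕ} {H : Matrix (Fin M) (Fin N) (ZMod 2)}
    (hH : H ∈ regularEnsemble N M J K) :
    ((sockets N M J K).filter fun g => matOf g = H).card = K.factorial ^ M := by
  simp only [regularEnsemble, Finset.mem_filter, Finset.mem_univ, true_and] at hH
  have : (Fintype.piFinset fun c => enums K (varsOf H c)).card = K.factorial ^ M := by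
    rw [Fintype.card_piFinset, Finset.prod_congr rfl fun c _ => card_enums _ (hH.2 c)]
    simp
  rw [← this]
  refine Finset.card_bij (fun g _ => fun c i => g (c, i)) ?_ ?_ ?_
  · intro g hg
    simp only [Finset.mem_filter, mem_sockets] at hg
    simp only [Fintype.mem_piFinset, enums, Finset.mem_filter, Finset.mem_univ, true_and]
    intro c
    exact ⟨hg.1.1 c, by rw [← hg.2, varsOf_matOf]⟩
  · intro g _ g' _ h
    ext ⟨c, i⟩
    exact congrArg Fin.val (congrFun (congrFun h c) i)
  · intro f hf
    simp only [Fintype.mem_piFinset, enums, Finset.mem_filter, Finset.mem_univ, true_and] at hf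
    have hm : matOf (fun q : Fin M × Fin K => f q.1 q.2) = H :=
      eq_of_varsOf_eq fun c => by rw [varsOf_matOf]; exact (hf c).2
    refine ⟨fun q => f q.1 q.2, ?_, rfl⟩
    simp only [Finset.mem_filter, mem_sockets]
    refine ⟨⟨fun c => (hf c).1, fun v => ?_⟩, hm⟩
    rw [← hH.1 v, ← hm, checksOf_matOf, Finset.card_image_of_injOn]
    rintro ⟨c, i⟩ ha ⟨d, j⟩ hb h
    obtain rfl : c = d := h
    simp only [Finset.coe_filter, Finset.mem_univ, true_and, Set.mem_ofPred_eq] at ha hb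
    rw [(hf c).1 (ha.trans hb.symm)]

lemma sum_sockets {N M J K : ℕ} (F : Matrix (Fin M) (Fin N) (ZMod 2) → ℝ) :
    ∑ g ∈ sockets N M J K, F (matOf g)
      = (K.factorial : ℝ) ^ M * ∑ H ∈ regularEnsemble N M J K, F H := by
  rw [← Finset.sum_fiberwise_of_maps_to (t := regularEnsemble N M J K) (g := matOf)
    (fun g hg => matOf_mem (mem_sockets.1 hg)), Finset.mul_sum]
  refine Finset.sum_congr rfl fun H hH => ?_
  rw [Finset.sum_congr rfl (g := fun _ => F H), Finset.sum_const, card_fiber_matOf hH,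
    nsmul_eq_mul]
  · push_cast; rfl
  · intro g hg
    rw [(Finset.mem_filter.1 hg).2]

/-- The uniform distribution on the ensemble is the image of the uniform distribution on the socket
assignments, as all fibres have the same size. -/
lemma average_eq {N M J K : ℕ} (F : Matrix (Fin M) (Fin N) (ZMod 2) → ℝ) :
    (∑ H ∈ regularEnsemble N M J K, F H) / (regularEnsemble N M J K).card
      = (∑ g ∈ sockets N M J K, F (matOf g)) / (sockets N M J K).card := by
  have h1 := sum_sockets (N := N) (M := M) (J := J) (K := K) (fun _ => 1)
  simp only [Finset.sum_const, nsmul_eq_mul, mul_one] at h1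
  have hC : (K.factorial : ℝ) ^ M ≠ 0 := by positivity
  rw [sum_sockets, h1, mul_div_mul_left _ _ hC]

/-- Attaching the sockets to the variable nodes in cyclic order gives a regular graph; as `K ≤ N`, it has
no parallel edges. -/
lemma sockets_nonempty {N M J K : ℕ} (hMK : M * K = N * J) (hKN : K ≤ N) :
    (sockets N M J K).Nonempty := by
  let e : Fin M × Fin K ≃ Fin J × Fin N :=
    finProdFinEquiv.trans ((finCongr (hMK.trans (mul_comm N J))).trans finProdFinEquiv.symm)
  have he : ∀ q, ((e q).2 : ℕ) = (q.2 + K * q.1) % N := fun q => rfl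
  refine ⟨fun q => (e q).2, mem_sockets.2 ⟨fun c i j h => ?_, fun v => ?_⟩⟩
  · have h' : ((e (c, i)).2 : ℕ) = (e (c, j)).2 := congrArg Fin.val h
    rw [he, he] at h'
    have : (i : ℕ) ≡ j [MOD N] := Nat.ModEq.add_right_cancel' (K * c) h'
    exact Fin.ext (this.eq_of_lt_of_lt (i.2.trans_le hKN) (j.2.trans_le hKN))
  · have : (Finset.univ.filter fun q => (e q).2 = v).card
        = (Finset.univ.filter fun x : Fin J × Fin N => x.2 = v).card :=
      Finset.card_equiv e (by simp)
    rw [this]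
    have h2 : (Finset.univ.filter fun x : Fin J × Fin N => x.2 = v)
        = Finset.univ ×ˢ {v} := by
      ext ⟨a, b⟩; simp [eq_comm]
    rw [h2]; simp

section
variable {M K N J : ℕ} {g : Fin M × Fin K → Fin N} {v : Fin N}

/-! ### Distances from a variable node -/

/-- The node of the Tanner graph at which a walk from `v` ends. -/
def endNode (g : Fin M × Fin K → Fin N) (v : Fin N) : List (Fin M × Fin K) → Fin N ⊕ Fin M
  | [] => Sum.inl v
  | q :: w => if Even w.length then Sum.inr q.1 else Sum.inl (g q)

/-- The node `x` is the end of some walk of `n` steps from `v`, possibly with backtracking. -/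
def Reach (g : Fin M × Fin K → Fin N) (v : Fin N) : ℕ → Fin N ⊕ Fin M → Prop
  | 0, x => x = Sum.inl v
  | n + 1, x => ∃ q, (x = Sum.inl (g q) ∧ Reach g v n (Sum.inr q.1)) ∨
      (x = Sum.inr q.1 ∧ Reach g v n (Sum.inl (g q)))

/-- The node `x` has distance `n` from `v`. -/
def AtDist (g : Fin M × Fin K → Fin N) (v : Fin N) (n : ℕ) (x : Fin N ⊕ Fin M) : Prop :=
  Reach g v n x ∧ ∀ m < n, ¬ Reach g v m x

/-- The edge `q` joins a node at distance `n` from `v` with a node at distance `n + 1`. -/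
def EdgeAt (g : Fin M × Fin K → Fin N) (v : Fin N) (n : ℕ) (q : Fin M × Fin K) : Prop :=
  (AtDist g v n (Sum.inl (g q)) ∧ AtDist g v (n + 1) (Sum.inr q.1)) ∨
    (AtDist g v n (Sum.inr q.1) ∧ AtDist g v (n + 1) (Sum.inl (g q)))

/-- The `n`-th edge of the walk joins a node at distance `n` with a node at distance `n + 1`. -/
def IsGeo (g : Fin M × Fin K → Fin N) (v : Fin N) : List (Fin M × Fin K) → Prop
  | [] => True
  | q :: w => EdgeAt g v w.length q ∧ IsGeo g v w

lemma reach_parity : ∀ (n : ℕ), (∀ u : Fin N, Reach g v n (Sum.inl u) → Even n) ∧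
    ∀ c : Fin M, Reach g v n (Sum.inr c) → ¬ Even n
  | 0 => ⟨fun _ _ => Even.zero, fun c h => by simp [Reach] at h⟩
  | n + 1 => by
    obtain ⟨h1, h2⟩ := reach_parity n
    constructor
    · rintro u ⟨q, ⟨-, h⟩ | ⟨h, -⟩⟩
      · exact Nat.even_add_one.2 (h2 _ h)
      · simp at h
    · rintro c ⟨q, ⟨h, -⟩ | ⟨-, h⟩⟩
      · simp at h
      · exact fun h' => Nat.even_add_one.1 h' (h1 _ h)

lemma AtDist.unique {n m : ℕ} {x : Fin N ⊕ Fin M} (hn : AtDist g v n x) (hm : AtDist g v m x) :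
    n = m := by
  rcases lt_trichotomy n m with h | h | h
  · exact absurd hn.1 (hm.2 n h)
  · exact h
  · exact absurd hm.1 (hn.2 m h)

lemma exists_atDist {n : ℕ} {x : Fin N ⊕ Fin M} (h : Reach g v n x) :
    ∃ m ≤ n, AtDist g v m x := by
  classical
  have hex : ∃ n, Reach g v n x := ⟨n, h⟩
  exact ⟨Nat.find hex, Nat.find_le h, Nat.find_spec hex, fun m hm => Nat.find_min hex hm⟩

lemma EdgeAt.unique {n m : ℕ} {q : Fin M × Fin K} (hn : EdgeAt g v n q) (hm : EdgeAt g v m q) :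
    n = m := by
  rcases hn with ⟨h1, h2⟩ | ⟨h1, h2⟩ <;> rcases hm with ⟨h3, h4⟩ | ⟨h3, h4⟩
  · exact h1.unique h3
  · have := h1.unique h4; have := h2.unique h3; omega
  · have := h1.unique h4; have := h2.unique h3; omega
  · exact h1.unique h3

/-- The ends of an edge have distances from `v` that differ by one. -/
lemma edgeAt_of_atDist {n m : ℕ} {q : Fin M × Fin K} (hn : AtDist g v n (Sum.inl (g q)))
    (hm : AtDist g v m (Sum.inr q.1)) : (m = n + 1 ∧ EdgeAt g v n q) ∨
      (n = m + 1 ∧ EdgeAt g v m q) := by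
  have h1 : m ≤ n + 1 := by
    by_contra! h
    exact hm.2 (n + 1) h ⟨q, Or.inr ⟨rfl, hn.1⟩⟩
  have h2 : n ≤ m + 1 := by
    by_contra! h
    exact hn.2 (m + 1) h ⟨q, Or.inl ⟨rfl, hm.1⟩⟩
  have h3 : n ≠ m := by
    rintro rfl
    exact (reach_parity n).2 _ hm.1 ((reach_parity n).1 _ hn.1)
  rcases Nat.lt_or_gt_of_ne h3 with h | h
  · obtain rfl : m = n + 1 := by omega
    exact Or.inl ⟨rfl, Or.inl ⟨hn, hm⟩⟩
  · obtain rfl : n = m + 1 := by omega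
    exact Or.inr ⟨rfl, Or.inr ⟨hm, hn⟩⟩

lemma IsGeo.edgeAt {w : List (Fin M × Fin K)} (hw : IsGeo g v w) {p : Fin M × Fin K}
    (hp : p ∈ w) : ∃ n < w.length, EdgeAt g v n p := by
  induction w with
  | nil => simp at hp
  | cons q w ih =>
    rcases List.mem_cons.1 hp with rfl | hp
    · exact ⟨w.length, by simp, hw.1⟩
    · obtain ⟨n, hn, h⟩ := ih hw.2 hp
      exact ⟨n, by simp only [List.length_cons]; omega, h⟩

lemma IsGeo.lt {w : List (Fin M × Fin K)} (hw : IsGeo g v w) {p : Fin M × Fin K}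
    (hp : p ∈ w) {n : ℕ} (hn : EdgeAt g v n p) : n < w.length := by
  obtain ⟨m, hm, h⟩ := hw.edgeAt hp
  rwa [hn.unique h]

lemma IsGeo.eq_head {w : List (Fin M × Fin K)} {p q : Fin M × Fin K} (hw : IsGeo g v (q :: w))
    (hp : p ∈ q :: w) (hn : EdgeAt g v w.length p) : p = q := by
  rcases List.mem_cons.1 hp with h | h
  · exact h
  · exact absurd (hw.2.lt h hn) (lt_irrefl _)

lemma endNode_of_mem_steps {w : List (Fin M × Fin K)} {q : Fin M × Fin K}
    (h : q ∈ steps g v w) : endNode g v w = if Even w.length then Sum.inl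
    (g q) else Sum.inr q.1 := by
  cases w with
  | nil => simpa [steps, endNode, eq_comm] using h
  | cons p w =>
    by_cases he : Even w.length
    · have h' : ¬ Even (p :: w).length := by simpa [Nat.even_add_one] using he
      simp only [steps, he, if_true, Finset.mem_filter] at h
      rw [if_neg h', endNode, if_pos he, h.2.1]
    · have h' : Even (p :: w).length := by simpa [Nat.even_add_one] using he
      simp only [steps, he, if_false, Finset.mem_filter] at h
      rw [if_pos h', endNode, if_neg he, h.2.1]

lemma ne_of_mem_steps {w : List (Fin M × Fin K)} {p q : Fin M × Fin K}
    (h : q ∈ steps g v (p :: w)) : q ≠ p := by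
  rw [steps] at h
  split_ifs at h <;> exact (Finset.mem_filter.1 h).2.2

lemma reach_endNode {w : List (Fin M × Fin K)} (hw : IsWalk g v w) :
    Reach g v w.length (endNode g v w) := by
  induction w with
  | nil => rfl
  | cons q w ih =>
    have h := ih hw.2
    rw [endNode_of_mem_steps hw.1] at h
    by_cases he : Even w.length
    · rw [if_pos he] at h
      rw [endNode, if_pos he]
      exact ⟨q, Or.inr ⟨rfl, h⟩⟩
    · rw [if_neg he] at h
      rw [endNode, if_neg he]
      exact ⟨q, Or.inl ⟨rfl, h⟩⟩

lemma edgeAt_of_steps {w : List (Fin M × Fin K)} {q : Fin M × Fin K}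
    (h : q ∈ steps g v w) (h1 : AtDist g v w.length (endNode g v w))
    (h2 : AtDist g v (w.length + 1) (endNode g v (q :: w))) : EdgeAt g v w.length q := by
  rw [endNode_of_mem_steps h] at h1
  by_cases he : Even w.length
  · rw [if_pos he] at h1
    rw [endNode, if_pos he] at h2
    exact Or.inl ⟨h1, h2⟩
  · rw [if_neg he] at h1
    rw [endNode, if_neg he] at h2
    exact Or.inr ⟨h1, h2⟩

lemma IsGeo.atDist {w : List (Fin M × Fin K)} (h : IsGeo g v w) (hw : IsWalk g v w) :
    AtDist g v w.length (endNode g v w) := by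
  cases w with
  | nil => exact ⟨rfl, by simp⟩
  | cons q w =>
    have hr := reach_endNode hw
    rw [endNode] at hr ⊢
    by_cases he : Even w.length
    · rw [if_pos he] at hr ⊢
      rcases h.1 with h | h
      · exact h.2
      · exact absurd he ((reach_parity _).2 _ h.1.1)
    · rw [if_neg he] at hr ⊢
      rcases h.1 with h | h
      · exact absurd ((reach_parity _).1 _ h.1.1) he
      · exact h.2

/-- Every node is the end of a shortest path, which has no backtracking. -/
lemma exists_geo : ∀ (n : ℕ) (x : Fin N ⊕ Fin M), AtDist g v n x →
    ∃ w, IsWalk g v w ∧ IsGeo g v w ∧ w.length = n ∧ endNode g v w = x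
  | 0, x, h => ⟨[], trivial, trivial, rfl, h.1.symm⟩
  | n + 1, x, h => by
    obtain ⟨q, hq⟩ := h.1
    obtain ⟨y, hy, hEdge, hxy⟩ : ∃ y, AtDist g v n y ∧ EdgeAt g v n q ∧
        ((y = Sum.inr q.1 ∧ x = Sum.inl (g q)) ∨ (y = Sum.inl (g q) ∧ x = Sum.inr q.1)) := by
      rcases hq with ⟨hx, hr⟩ | ⟨hx, hr⟩
      · have hd : AtDist g v n (Sum.inr q.1) :=
          ⟨hr, fun m hm hm' => h.2 (m + 1) (by omega) ⟨q, Or.inl ⟨hx, hm'⟩⟩⟩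
        exact ⟨_, hd, Or.inr ⟨hd, hx ▸ h⟩, Or.inl ⟨rfl, hx⟩⟩
      · have hd : AtDist g v n (Sum.inl (g q)) :=
          ⟨hr, fun m hm hm' => h.2 (m + 1) (by omega) ⟨q, Or.inr ⟨hx, hm'⟩⟩⟩
        exact ⟨_, hd, Or.inl ⟨hd, hx ▸ h⟩, Or.inr ⟨rfl, hx⟩⟩
    obtain ⟨w, hw, hgeo, rfl, hend⟩ := exists_geo n y hy
    have hstep : q ∈ steps g v w := by
      cases w with
      | nil =>
        rw [endNode] at hend
        rcases hxy with ⟨h1, -⟩ | ⟨h1, -⟩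
        · rw [h1] at hend; simp at hend
        · rw [h1] at hend
          simp only [steps, Finset.mem_filter, Finset.mem_univ, true_and]
          exact (Sum.inl_injective hend).symm
      | cons p w =>
        have hne : q ≠ p := by
          rintro rfl
          have := hEdge.unique hgeo.1
          simp at this
        rw [endNode] at hend
        by_cases he : Even w.length
        · rw [if_pos he] at hend
          simp only [steps, he, if_true, Finset.mem_filter, Finset.mem_univ, true_and]
          rcases hxy with ⟨h1, -⟩ | ⟨h1, -⟩
          · rw [h1] at hend
            exact ⟨(Sum.inr_injective hend).symm, hne⟩
          · rw [h1] at hend; simp at hend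
        · rw [if_neg he] at hend
          simp only [steps, he, if_false, Finset.mem_filter, Finset.mem_univ, true_and]
          rcases hxy with ⟨h1, -⟩ | ⟨h1, -⟩
          · rw [h1] at hend; simp at hend
          · rw [h1] at hend
            exact ⟨(Sum.inl_injective hend).symm, hne⟩
    refine ⟨q :: w, ⟨hstep, hw⟩, ⟨hEdge, hgeo⟩, rfl, ?_⟩
    have h1 := endNode_of_mem_steps hstep
    rw [hend] at h1
    rw [endNode]
    by_cases he : Even w.length
    · rw [if_pos he] at h1 ⊢
      rcases hxy with ⟨h2, h3⟩ | ⟨h2, h3⟩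
      · rw [h2] at h1; simp at h1
      · exact h3.symm
    · rw [if_neg he] at h1 ⊢
      rcases hxy with ⟨h2, h3⟩ | ⟨h2, h3⟩
      · exact h3.symm
      · rw [h2] at h1; simp at h1

lemma endNode_inr {w : List (Fin M × Fin K)} {c : Fin M} (h : endNode g v w = Sum.inr c) :
    ∃ q ∈ w, c = q.1 := by
  cases w with
  | nil => simp [endNode] at h
  | cons q w =>
    rw [endNode] at h
    split_ifs at h
    exact ⟨q, by simp, (Sum.inr_injective h).symm⟩

lemma endNode_inl {w : List (Fin M × Fin K)} {u : Fin N} (h : endNode g v w = Sum.inl u) :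
    u = v ∨ ∃ q ∈ w, u = g q := by
  cases w with
  | nil => exact Or.inl (Sum.inl_injective h).symm
  | cons q w =>
    rw [endNode] at h
    split_ifs at h
    exact Or.inr ⟨q, by simp, (Sum.inl_injective h).symm⟩

end

section
variable {M K N J : ℕ} {g : Fin M × Fin K → Fin N} {v : Fin N} {l : ℕ}
  {nx : Fin M × Fin K → Fin M × Fin K}

/-! ### Selected walks and the local codeword that they span -/

/-- The sockets by which a walk continues that leaves each check node through the socket `nx p`
determined by the socket `p` through which it has entered. -/
def selSteps (nx : Fin M × Fin K → Fin M × Fin K) (g : Fin M × Fin K → Fin N) (v : Fin N) :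
    List (Fin M × Fin K) → Finset (Fin M × Fin K)
  | [] => Finset.univ.filter fun q => g q = v
  | p :: w =>
    if Even w.length then {nx p} else Finset.univ.filter fun q => g q = g p ∧ q ≠ p

/-- Walks without backtracking that leave each check node through the selected socket, except that
the last step is arbitrary. -/
def IsSelX (nx : Fin M × Fin K → Fin M × Fin K) (g : Fin M × Fin K → Fin N) (v : Fin N) :
    List (Fin M × Fin K) → Prop
  | [] => True
  | q :: w => q ∈ steps g v w ∧ Follows (selSteps nx g v) w

/-- Every edge that joins two nodes of the walks from `v` with edge set `A` belongs to `A`. -/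
def EdgeClosed (g : Fin M × Fin K → Fin N) (v : Fin N) (A : List (Fin M × Fin K)) : Prop :=
  ∀ p, (∃ q ∈ A, p.1 = q.1) → (g p = v ∨ ∃ q ∈ A, g p = g q) → p ∈ A

/-- No edge closes a cycle with a selected walk and an arbitrary walk from `v`. -/
def Good (nx : Fin M × Fin K → Fin M × Fin K) (g : Fin M × Fin K → Fin N) (v : Fin N) (l : ℕ) :
    Prop :=
  ∀ P R, IsSelX nx g v P → IsWalk g v R → P.length ≤ 2 * l → R.length ≤ 2 * l →
    EdgeClosed g v (P ++ R)

open Classical in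
/-- The variable nodes at which selected walks of at most `2 * l` steps end. -/
noncomputable def selSet (nx : Fin M × Fin K → Fin M × Fin K) (g : Fin M × Fin K → Fin N)
    (v : Fin N) (l : ℕ) : Finset (Fin N) :=
  Finset.univ.filter fun u => ∃ w, Follows (selSteps nx g v) w ∧ Even w.length ∧
    w.length ≤ 2 * l ∧ endNode g v w = Sum.inl u

/-- The sign vector that is `-1` on `S`. -/
def signOf {N : ℕ} (S : Finset (Fin N)) (u : Fin N) : ℝ := if u ∈ S then -1 else 1

lemma signOf_cases {N : ℕ} (S : Finset (Fin N)) (u : Fin N) : signOf S u = 1 ∨ signOf S u = -1 := by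
  unfold signOf; split_ifs <;> simp

/-- `nx` selects, for each socket, another socket of the same check node. -/
structure IsSelection (nx : Fin M × Fin K → Fin M × Fin K) : Prop where
  row : ∀ q, (nx q).1 = q.1
  ne : ∀ q, nx q ≠ q

lemma selSteps_subset (hn : IsSelection nx) (w : List (Fin M × Fin K)) :
    selSteps nx g v w ⊆ steps g v w := by
  cases w with
  | nil => exact subset_rfl
  | cons p w =>
    rw [selSteps, steps]
    split_ifs
    · simp [hn.row, hn.ne]
    · exact subset_rfl

lemma isWalk_of_sel (hn : IsSelection nx) {w : List (Fin M × Fin K)}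
    (hw : Follows (selSteps nx g v) w) :
    IsWalk g v w := by
  induction w with
  | nil => trivial
  | cons q w ih => exact ⟨selSteps_subset hn w hw.1, ih hw.2⟩

lemma isSelX_of_sel (hn : IsSelection nx) {w : List (Fin M × Fin K)}
    (hw : Follows (selSteps nx g v) w) :
    IsSelX nx g v w := by
  cases w with
  | nil => trivial
  | cons q w => exact ⟨selSteps_subset hn w hw.1, hw.2⟩

lemma isWalk_of_selX (hn : IsSelection nx) {w : List (Fin M × Fin K)} (hw : IsSelX nx g v w) :
    IsWalk g v w := by
  cases w with
  | nil => trivial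
  | cons q w => exact ⟨hw.1, isWalk_of_sel hn hw.2⟩

/-- The edge `q` belongs to the walks `w`, `R` as soon as it joins their ends. -/
lemma EdgeClosed.mem_of_ends {w R : List (Fin M × Fin K)} (h : EdgeClosed g v (w ++ R))
    {q : Fin M × Fin K} (hq : (endNode g v w = Sum.inl (g q) ∧ endNode g v R = Sum.inr q.1) ∨
      (endNode g v w = Sum.inr q.1 ∧ endNode g v R = Sum.inl (g q))) : q ∈ w ++ R := by
  rcases hq with ⟨h1, h2⟩ | ⟨h1, h2⟩
  · refine h q ?_ ?_
    · obtain ⟨p, hp, hp'⟩ := endNode_inr h2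
      exact ⟨p, List.mem_append_right _ hp, hp'⟩
    · rcases endNode_inl h1 with h | ⟨p, hp, hp'⟩
      · exact Or.inl h
      · exact Or.inr ⟨p, List.mem_append_left _ hp, hp'⟩
  · refine h q ?_ ?_
    · obtain ⟨p, hp, hp'⟩ := endNode_inr h1
      exact ⟨p, List.mem_append_left _ hp, hp'⟩
    · rcases endNode_inl h2 with h | ⟨p, hp, hp'⟩
      · exact Or.inl h
      · exact Or.inr ⟨p, List.mem_append_right _ hp, hp'⟩

/-- If no cycle is closed near `v`, then selected walks are shortest paths: a shortcut to the end
of such a walk would close a cycle with it. -/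
lemma Good.isGeo (hn : IsSelection nx) (hG : Good nx g v l) :
    ∀ w : List (Fin M × Fin K), IsSelX nx g v w →
    w.length ≤ 2 * l → IsGeo g v w
  | [], _, _ => trivial
  | q :: w, hw, hl => by
    simp only [List.length_cons] at hl
    have hgw : IsGeo g v w := hG.isGeo hn w (isSelX_of_sel hn hw.2) (by omega)
    have hdw := hgw.atDist (isWalk_of_sel hn hw.2)
    have hr : Reach g v (w.length + 1) (endNode g v (q :: w)) :=
      reach_endNode (isWalk_of_selX hn hw)
    obtain ⟨m, hm, hd⟩ := exists_atDist hr
    have hjoin := endNode_of_mem_steps hw.1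
    rcases hm.eq_or_lt with rfl | hlt
    · exact ⟨edgeAt_of_steps hw.1 hdw hd, hgw⟩
    exfalso
    obtain ⟨R, hR, hgR, rfl, hendR⟩ := exists_geo m _ hd
    have hmem : q ∈ w ++ R := by
      refine EdgeClosed.mem_of_ends (hG w R (isSelX_of_sel hn hw.2) hR (by omega) (by omega)) ?_
      rw [hjoin, hendR, endNode]
      by_cases he : Even w.length
      · simp [he]
      · simp [he]
    have hEdge : w.length = R.length + 1 ∧ EdgeAt g v R.length q := by
      rw [hjoin] at hdw
      rw [endNode] at hd
      by_cases he : Even w.length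
      · rw [if_pos he] at hdw hd
        rcases edgeAt_of_atDist hdw hd with h | h
        · omega
        · exact h
      · rw [if_neg he] at hdw hd
        rcases edgeAt_of_atDist hd hdw with h | h
        · exact h
        · omega
    rcases List.mem_append.1 hmem with h | h
    · cases w with
      | nil => simp at h
      | cons p w =>
        simp only [List.length_cons, Nat.add_right_cancel_iff] at hEdge
        exact ne_of_mem_steps hw.1 (hgw.eq_head h (hEdge.1 ▸ hEdge.2))
    · exact absurd (hgR.lt h hEdge.2) (lt_irrefl _)

/-- A check node near `v` meets the selected set in at most two sockets: the one by which a shortest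
path enters it, and the one selected after that. -/
lemma Good.mem_selSet_row (hn : IsSelection nx) (hG : Good nx g v l) {h : Fin M × Fin K}
    {R : List (Fin M × Fin K)}
    (hR : IsWalk g v (h :: R)) (hgR : IsGeo g v (h :: R)) (he : Even R.length)
    (hl : R.length + 2 ≤ 2 * l) {p : Fin M × Fin K} (hp : p.1 = h.1)
    (hpS : g p ∈ selSet nx g v l) : (p = h ∨ p = nx h) ∧ g h ∈ selSet nx g v l := by
  have hdc : AtDist g v (R.length + 1) (Sum.inr h.1) := by
    have := hgR.atDist hR
    rwa [endNode, if_pos he] at this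
  have hends : endNode g v (h :: R) = Sum.inr h.1 := by rw [endNode, if_pos he]
  -- an edge from the check node towards `v`
  have near : ∀ (P : List (Fin M × Fin K)) (s : Fin M × Fin K), Follows (selSteps nx g v) P →
      P.length ≤ 2 * l → endNode g v P = Sum.inl (g s) → s.1 = h.1 →
      R.length + 1 = P.length + 1 → s = h := by
    intro P s hP hPl hend hs hlen
    have hgP := hG.isGeo hn P (isSelX_of_sel hn hP) hPl
    have hdP := hgP.atDist (isWalk_of_sel hn hP)
    rw [hend] at hdP
    have hE : EdgeAt g v P.length s := Or.inl ⟨hdP, by rw [hs, ← hlen]; exact hdc⟩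
    have hmem : s ∈ P ++ h :: R := by
      refine EdgeClosed.mem_of_ends (hG P (h :: R) (isSelX_of_sel hn hP) hR hPl
        (by simp only [List.length_cons]; omega)) (Or.inl ⟨hend, by rw [hends, hs]⟩)
    rcases List.mem_append.1 hmem with h' | h'
    · exact absurd (hgP.lt h' hE) (lt_irrefl _)
    · refine hgR.eq_head h' ?_
      rwa [show R.length = P.length by omega]
  simp only [selSet, Finset.mem_filter, Finset.mem_univ, true_and] at hpS
  obtain ⟨P, hP, hPe, hPl, hend⟩ := hpS
  have hgP := hG.isGeo hn P (isSelX_of_sel hn hP) hPl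
  have hdP := hgP.atDist (isWalk_of_sel hn hP)
  rw [hend] at hdP
  rcases edgeAt_of_atDist hdP (hp ▸ hdc) with ⟨hlen, hE⟩ | ⟨hlen, hE⟩
  · obtain rfl := near P p hP hPl hend hp hlen
    refine ⟨Or.inl rfl, ?_⟩
    simp only [selSet, Finset.mem_filter, Finset.mem_univ, true_and]
    exact ⟨P, hP, hPe, hPl, hend⟩
  · have hmem : p ∈ P ++ h :: R := by
      refine EdgeClosed.mem_of_ends (hG P (h :: R) (isSelX_of_sel hn hP) hR hPl
        (by simp only [List.length_cons]; omega)) (Or.inl ⟨hend, by rw [hends, hp]⟩)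
    rcases List.mem_append.1 hmem with h' | h'
    · -- `p` is the last edge of `P`, so it is the selected socket after the last but one
      cases P with
      | nil => simp at h'
      | cons p0 w =>
        simp only [List.length_cons] at hlen hPl hPe
        obtain rfl : p = p0 := hgP.eq_head h' (by rwa [show w.length = R.length + 1 by omega])
        cases w with
        | nil => simp at hlen
        | cons q0 w =>
          simp only [List.length_cons] at hlen hPl hPe
          have hwe : Even w.length := by rwa [show w.length = R.length by omega]
          have hpq : p = nx q0 := by
            have := hP.1
            rwa [selSteps, if_pos hwe, Finset.mem_singleton] at this
          have hend' : endNode g v w = Sum.inl (g q0) := by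
            rw [endNode_of_mem_steps (selSteps_subset hn w hP.2.1), if_pos hwe]
          obtain rfl := near w q0 hP.2.2 (by omega) hend' (by rw [← hp, hpq, hn.row]) (by omega)
          refine ⟨Or.inr hpq, ?_⟩
          simp only [selSet, Finset.mem_filter, Finset.mem_univ, true_and]
          exact ⟨w, hP.2.2, hwe, by omega, hend'⟩
    · have := hgR.lt h' hE
      simp at this

/-- If the socket by which a check node is entered ends in the selected set, then so does the socket
selected after it. -/
lemma Good.next_mem_selSet (hn : IsSelection nx) (hG : Good nx g v l) {h : Fin M × Fin K}
    {R : List (Fin M × Fin K)}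
    (hgR : IsGeo g v (h :: R)) (he : Even R.length)
    (hl : R.length + 2 ≤ 2 * l) (hS : g h ∈ selSet nx g v l) :
    g (nx h) ∈ selSet nx g v l := by
  simp only [selSet, Finset.mem_filter, Finset.mem_univ, true_and] at hS
  obtain ⟨P, hP, hPe, hPl, hend⟩ := hS
  have hgP := hG.isGeo hn P (isSelX_of_sel hn hP) hPl
  have hdP := hgP.atDist (isWalk_of_sel hn hP)
  rw [hend] at hdP
  have hlen : P.length = R.length := by
    rcases hgR.1 with h' | h'
    · exact hdP.unique h'.1
    · exact absurd he ((reach_parity _).2 _ h'.1.1)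
  have hstep : h ∈ selSteps nx g v P := by
    cases P with
    | nil => simpa [selSteps, endNode, eq_comm] using hend
    | cons p P =>
      have hne : ¬ Even P.length := by
        simpa [Nat.even_add_one] using hPe
      rw [selSteps, if_neg hne]
      rw [endNode, if_neg hne] at hend
      simp only [Finset.mem_filter, Finset.mem_univ, true_and]
      refine ⟨(Sum.inl_injective hend).symm, ?_⟩
      rintro rfl
      have := hgP.1.unique hgR.1
      simp only [List.length_cons] at hlen
      omega
  simp only [selSet, Finset.mem_filter, Finset.mem_univ, true_and]
  refine ⟨nx h :: h :: P, ⟨by simp [selSteps, hPe], hstep, hP⟩, ?_, ?_, ?_⟩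
  · simpa [Nat.even_add_one] using hPe
  · simp only [List.length_cons]; omega
  · rw [endNode, if_neg]
    simpa [Nat.even_add_one] using hPe

/-- Every check node near `v` is entered by a shortest path. -/
lemma exists_geo_row {q : Fin M × Fin K} {w : List (Fin M × Fin K)}
    (hw : IsWalk g v (q :: w)) (he : Even w.length) (hl : w.length + 2 ≤ 2 * l) :
    ∃ h R, IsWalk g v (h :: R) ∧ IsGeo g v (h :: R) ∧ Even R.length ∧ R.length + 2 ≤ 2 * l ∧
      h.1 = q.1 := by
  have hr := reach_endNode hw
  obtain ⟨t, ht, hd⟩ := exists_atDist hr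
  obtain ⟨R, hR, hgR, rfl, hend⟩ := exists_geo t _ hd
  simp only [List.length_cons] at ht
  rw [endNode, if_pos he] at hend
  cases R with
  | nil => simp [endNode] at hend
  | cons h R =>
    rw [endNode] at hend
    split_ifs at hend with hRe
    simp only [List.length_cons] at ht
    exact ⟨h, R, hR, hgR, hRe, by omega, Sum.inr_injective hend⟩

/-- If no cycle is closed near `v`, then each check node near `v` meets the selected set in no socket or
in two of them. -/
lemma Good.localSign_selSet (hn : IsSelection nx) (hG : Good nx g v l) :
    LocalSign g v l (signOf (selSet nx g v l)) := by
  intro q w hw he hl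
  obtain ⟨h, R, hR, hgR, hRe, hRl, hrow⟩ := exists_geo_row hw he hl
  rw [← hrow]
  by_cases hS : g h ∈ selSet nx g v l
  · have hS' := hG.next_mem_selSet hn hgR hRe hRl hS
    have hne : h.2 ≠ (nx h).2 := fun h' => hn.ne h (Prod.ext (hn.row h) h'.symm)
    have e1 : g (h.1, h.2) = g h := rfl
    have e2 : g (h.1, (nx h).2) = g (nx h) := by rw [← hn.row h]
    rw [Fintype.prod_eq_mul h.2 (nx h).2 hne, e1, e2]
    · simp [signOf, hS, hS']
    · intro i hi
      rw [signOf, if_neg]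
      intro hi'
      rcases (hG.mem_selSet_row hn hR hgR hRe hRl (p := (h.1, i)) rfl hi').1 with h' | h'
      · exact hi.1 (congrArg Prod.snd h')
      · exact hi.2 (congrArg Prod.snd h')
  · refine Finset.prod_eq_one fun i _ => ?_
    rw [signOf, if_neg]
    intro hi'
    exact hS (hG.mem_selSet_row hn hR hgR hRe hRl (p := (h.1, i)) rfl hi').2

lemma mem_selSet_self : v ∈ selSet nx g v l := by
  simp only [selSet, Finset.mem_filter, Finset.mem_univ, true_and]
  exact ⟨[], trivial, by simp, by simp, rfl⟩

/-- Two end nodes of selected walks that differ only in their last step form a local codeword. -/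
lemma Good.localSign_pair (hn : IsSelection nx) (hn3 : ∀ q, nx (nx q) ≠ q) (hG : Good nx g v l)
    {p : Fin M × Fin K} {w : List (Fin M × Fin K)} (hw : Follows (selSteps nx g v) (p :: w))
    (hlen : w.length + 2 = 2 * l) :
    LocalSign g v l (signOf {g (nx p), g (nx (nx p))}) ∧
      g (nx p) ∈ selSet nx g v l ∧ g (nx (nx p)) ∉ selSet nx g v l := by
  have he : Even w.length := by
    rcases Nat.even_or_odd w.length with h | ⟨k, hk⟩
    · exact h
    · omega
  have hX1 : IsSelX nx g v (nx p :: p :: w) :=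
    ⟨by simp [steps, he, hn.row, hn.ne], hw⟩
  have hX2 : IsSelX nx g v (nx (nx p) :: p :: w) :=
    ⟨by simp [steps, he, hn.row, hn3], hw⟩
  have hS1 : g (nx p) ∈ selSet nx g v l := by
    simp only [selSet, Finset.mem_filter, Finset.mem_univ, true_and]
    refine ⟨nx p :: p :: w, ⟨by simp [selSteps, he], hw⟩, ?_, ?_, ?_⟩
    · simpa [Nat.even_add_one] using he
    · simp only [List.length_cons]; omega
    · rw [endNode, if_neg]
      simpa [Nat.even_add_one] using he
  -- a check node near `v` that is adjacent to the end of one of the two walks is the common one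
  have key : ∀ s, IsSelX nx g v (s :: p :: w) → ∀ h R, IsWalk g v (h :: R) →
      IsGeo g v (h :: R) → Even R.length → R.length + 2 ≤ 2 * l →
      ∀ i, g (h.1, i) = g s → (h.1, i) = s := by
    intro s hs h R hR hgR hRe hRl i hi
    have hgs := hG.isGeo hn _ hs (by simp only [List.length_cons]; omega)
    have hds := hgs.atDist (isWalk_of_selX hn hs)
    have hodd : ¬ Even (p :: w).length := by simpa [Nat.even_add_one] using he
    have hend : endNode g v (s :: p :: w) = Sum.inl (g (h.1, i)) := by
      rw [endNode, if_neg hodd, hi]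
    have hdc : AtDist g v (R.length + 1) (Sum.inr h.1) := by
      have := hgR.atDist hR
      rwa [endNode, if_pos hRe] at this
    have hmem : (h.1, i) ∈ (s :: p :: w) ++ h :: R := by
      refine EdgeClosed.mem_of_ends (hG _ (h :: R) hs hR
        (by simp only [List.length_cons]; omega) (by simp only [List.length_cons]; omega))
        (Or.inl ⟨hend, by rw [endNode, if_pos hRe]⟩)
    rw [hend] at hds
    simp only [List.length_cons] at hds
    rcases edgeAt_of_atDist (q := (h.1, i)) hds hdc with ⟨h1, h2⟩ | ⟨h1, h2⟩
    · omega
    · rcases List.mem_append.1 hmem with h' | h'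
      · exact hgs.eq_head h' (by rwa [List.length_cons, show w.length + 1 = R.length + 1 by omega])
      · have := hgR.lt h' h2
        simp at this
  refine ⟨?_, hS1, ?_⟩
  · intro q w' hw' he' hl'
    obtain ⟨h, R, hR, hgR, hRe, hRl, hrow⟩ := exists_geo_row hw' he' hl'
    rw [← hrow]
    have k1 := key _ hX1 h R hR hgR hRe hRl
    have k2 := key _ hX2 h R hR hgR hRe hRl
    by_cases hc : h.1 = p.1
    · have e1 : (h.1, (nx p).2) = nx p := by rw [hc, ← hn.row p]
      have e2 : (h.1, (nx (nx p)).2) = nx (nx p) := by rw [hc, ← hn.row p, ← hn.row (nx p)]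
      have hne : (nx p).2 ≠ (nx (nx p)).2 := fun h' =>
        hn.ne (nx p) (e2.symm.trans ((by rw [h']) : _ = (h.1, (nx p).2)) |>.trans e1)
      rw [Fintype.prod_eq_mul (nx p).2 (nx (nx p)).2 hne, e1, e2]
      · simp [signOf]
      · intro i hi
        rw [signOf, if_neg]
        rw [Finset.mem_insert, Finset.mem_singleton]
        rintro (h' | h')
        · exact hi.1 (congrArg Prod.snd (k1 i h'))
        · exact hi.2 (congrArg Prod.snd (k2 i h'))
    · refine Finset.prod_eq_one fun i _ => ?_
      rw [signOf, if_neg]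
      rw [Finset.mem_insert, Finset.mem_singleton]
      rintro (h' | h')
      · exact hc (by have := congrArg Prod.fst (k1 i h'); simpa only [hn.row] using this)
      · exact hc (by have := congrArg Prod.fst (k2 i h'); simpa only [hn.row] using this)
  · intro hS2
    -- the sockets `p`, `nx p` and `nx (nx p)` of one check node are distinct
    obtain ⟨h, R, hR, hgR, hRe, hRl, hrow⟩ := exists_geo_row (isWalk_of_sel hn hw) he
      (l := l) (by omega)
    have hS0 : g p ∈ selSet nx g v l := by
      simp only [selSet, Finset.mem_filter, Finset.mem_univ, true_and]
      refine ⟨w, hw.2, he, by omega, ?_⟩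
      rw [endNode_of_mem_steps (selSteps_subset hn w hw.1), if_pos he]
    have a0 := (hG.mem_selSet_row hn hR hgR hRe hRl hrow.symm hS0).1
    have a1 := (hG.mem_selSet_row hn hR hgR hRe hRl ((hn.row p).trans hrow.symm) hS1).1
    have a2 := (hG.mem_selSet_row hn hR hgR hRe hRl
      ((hn.row (nx p)).trans ((hn.row p).trans hrow.symm)) hS2).1
    have n1 := hn.ne p
    have n2 := hn.ne (nx p)
    have n3 := hn3 p
    rcases a0 with a0 | a0
    · rw [← a0] at a1 a2
      rcases a2 with a2 | a2
      · exact n3 a2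
      · exact n2 a2
    · rcases a1 with a1 | a1
      · rw [← a1] at a2 a0
        rcases a2 with a2 | a2
        · exact n2 a2
        · exact n3 (a2.trans a0.symm)
      · exact n1 (a1.trans a0.symm)

end

/-! ### Counting walks -/

/-- The lists of length `n` that follow `f`. -/
def followLists {α : Type*} [DecidableEq α] (f : List α → Finset α) : ℕ → Finset (List α)
  | 0 => {[]}
  | n + 1 => (followLists f n).biUnion fun w => (f w).image fun q => q :: w

lemma mem_followLists {α : Type*} [DecidableEq α] {f : List α → Finset α} {n : ℕ} {w : List α} :
    w ∈ followLists f n ↔ Follows f w ∧ w.length = n := by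
  induction n generalizing w with
  | zero =>
    simp only [followLists, Finset.mem_singleton, List.length_eq_zero_iff]
    exact ⟨fun h => ⟨h ▸ trivial, h⟩, fun h => h.2⟩
  | succ n ih =>
    simp only [followLists, Finset.mem_biUnion, Finset.mem_image, ih]
    constructor
    · rintro ⟨w', ⟨h1, h2⟩, q, hq, rfl⟩
      exact ⟨⟨hq, h1⟩, by simp [h2]⟩
    · rintro ⟨h1, h2⟩
      cases w with
      | nil => simp at h2
      | cons q w' => exact ⟨w', ⟨h1.2, by simpa using h2⟩, q, h1.1, rfl⟩

lemma card_followLists_succ {α : Type*} [DecidableEq α] {f : List α → Finset α} {n b : ℕ}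
    (h : ∀ w, w.length = n → (f w).card ≤ b) :
    (followLists f (n + 1)).card ≤ (followLists f n).card * b :=
  Finset.card_biUnion_le_card_mul _ _ _ fun w hw =>
    Finset.card_image_le.trans (h w (mem_followLists.1 hw).2)

section
variable {M K N J : ℕ} {g : Fin M × Fin K → Fin N} {v : Fin N} {l : ℕ}
  {nx : Fin M × Fin K → Fin M × Fin K}

lemma card_row_ne (p : Fin M × Fin K) :
    (Finset.univ.filter fun q : Fin M × Fin K => q.1 = p.1 ∧ q ≠ p).card = K - 1 := by
  have : (Finset.univ.filter fun q : Fin M × Fin K => q.1 = p.1 ∧ q ≠ p)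
      = (Finset.univ.erase p.2).image fun i => (p.1, i) := by
    ext ⟨c, i⟩
    simp only [Finset.mem_filter, Finset.mem_univ, true_and, Finset.mem_image, Finset.mem_erase,
      and_true]
    constructor
    · rintro ⟨rfl, h⟩
      exact ⟨i, fun h' => h (Prod.ext rfl h'), rfl⟩
    · rintro ⟨j, hj, h⟩
      obtain ⟨rfl, rfl⟩ := Prod.mk.inj h
      exact ⟨rfl, fun h' => hj (congrArg Prod.snd h')⟩
  rw [this, Finset.card_image_of_injective _ (fun a b h => congrArg Prod.snd h),
    Finset.card_erase_of_mem (Finset.mem_univ _), Finset.card_univ, Fintype.card_fin]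

lemma card_fiber_ne (hg : IsSocket J g) (p : Fin M × Fin K) :
    (Finset.univ.filter fun q => g q = g p ∧ q ≠ p).card = J - 1 := by
  have : (Finset.univ.filter fun q => g q = g p ∧ q ≠ p)
      = (Finset.univ.filter fun q => g q = g p).erase p := by
    ext q; simp [and_comm]
  rw [this, Finset.card_erase_of_mem (by simp), hg.2]

lemma card_walks (hg : IsSocket J g) (k : ℕ) :
    (followLists (steps g v) (2 * k + 1)).card ≤ J * ((J - 1) * (K - 1)) ^ k ∧
    (followLists (steps g v) (2 * k + 2)).card ≤ J * ((J - 1) * (K - 1)) ^ k * (K - 1) := by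
  have heven : ∀ k, (followLists (steps g v) (2 * k + 2)).card
      ≤ (followLists (steps g v) (2 * k + 1)).card * (K - 1) := fun k =>
    card_followLists_succ fun w hw => by
      cases w with
      | nil => simp at hw
      | cons p w =>
        have : Even w.length := ⟨k, by simp only [List.length_cons] at hw; omega⟩
        rw [steps, if_pos this, card_row_ne]
  have key : (followLists (steps g v) (2 * k + 1)).card ≤ J * ((J - 1) * (K - 1)) ^ k := by
    induction k with
    | zero =>
      refine (card_followLists_succ (n := 0) (b := J) fun w hw => ?_).trans ?_
      · obtain rfl := List.length_eq_zero_iff.1 hw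
        rw [steps, hg.2]
      · simp [followLists]
    | succ k ih =>
      refine (card_followLists_succ (n := 2 * k + 2) (b := J - 1) fun w hw => ?_).trans ?_
      · cases w with
        | nil => simp at hw
        | cons p w =>
          have : ¬ Even w.length := by
            rw [Nat.not_even_iff_odd]
            exact ⟨k, by simp only [List.length_cons] at hw; omega⟩
          rw [steps, if_neg this, card_fiber_ne hg]
      · calc _ ≤ J * ((J - 1) * (K - 1)) ^ k * (K - 1) * (J - 1) := by
              gcongr; exact (heven k).trans (by gcongr)
          _ = _ := by ring
  exact ⟨key, (heven k).trans (by gcongr)⟩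

lemma card_selWalks (hg : IsSocket J g) (k : ℕ) :
    (followLists (selSteps nx g v) (2 * k + 1)).card ≤ J * (J - 1) ^ k ∧
    (followLists (selSteps nx g v) (2 * k + 2)).card ≤ J * (J - 1) ^ k := by
  have heven : ∀ k, (followLists (selSteps nx g v) (2 * k + 2)).card
      ≤ (followLists (selSteps nx g v) (2 * k + 1)).card * 1 := fun k =>
    card_followLists_succ fun w hw => by
      cases w with
      | nil => simp at hw
      | cons p w =>
        have : Even w.length := ⟨k, by simp only [List.length_cons] at hw; omega⟩
        rw [selSteps, if_pos this, Finset.card_singleton]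
  have key : (followLists (selSteps nx g v) (2 * k + 1)).card ≤ J * (J - 1) ^ k := by
    induction k with
    | zero =>
      refine (card_followLists_succ (n := 0) (b := J) fun w hw => ?_).trans ?_
      · obtain rfl := List.length_eq_zero_iff.1 hw
        rw [selSteps, hg.2]
      · simp [followLists]
    | succ k ih =>
      refine (card_followLists_succ (n := 2 * k + 2) (b := J - 1) fun w hw => ?_).trans ?_
      · cases w with
        | nil => simp at hw
        | cons p w =>
          have : ¬ Even w.length := by
            rw [Nat.not_even_iff_odd]
            exact ⟨k, by simp only [List.length_cons] at hw; omega⟩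
          rw [selSteps, if_neg this, card_fiber_ne hg]
      · calc _ ≤ J * (J - 1) ^ k * (J - 1) := by
              gcongr; exact (heven k).trans (by rw [mul_one]; exact ih)
          _ = _ := by ring
  exact ⟨key, (heven k).trans (by rw [mul_one]; exact key)⟩

/-- The number of variable nodes in a tree of depth `2 * l` in which the root has `J` children,
every other variable node has `J - 1` children, and every check node has one child. -/
def devSize (J l : ℕ) : ℕ := 1 + ∑ k ∈ Finset.range l, J * (J - 1) ^ k

lemma card_selSet_le (hg : IsSocket J g) : (selSet nx g v l).card ≤ devSize J l := by
  classical
  have hsub : selSet nx g v l ⊆ {v} ∪ (Finset.range l).biUnion fun k =>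
      (followLists (selSteps nx g v) (2 * k + 2)).image fun w =>
        Sum.elim id (fun _ => v) (endNode g v w) := by
    intro u hu
    simp only [selSet, Finset.mem_filter, Finset.mem_univ, true_and] at hu
    obtain ⟨w, hw, ⟨m, hm⟩, hl, hend⟩ := hu
    rw [Finset.mem_union, Finset.mem_singleton, Finset.mem_biUnion]
    rcases Nat.eq_zero_or_pos m with rfl | hpos
    · obtain rfl := List.length_eq_zero_iff.1 (by simpa using hm)
      exact Or.inl (Sum.inl_injective hend).symm
    · refine Or.inr ⟨m - 1, Finset.mem_range.2 (by omega), Finset.mem_image.2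
        ⟨w, mem_followLists.2 ⟨hw, by omega⟩, ?_⟩⟩
      rw [hend]; rfl
  refine (Finset.card_le_card hsub).trans ((Finset.card_union_le _ _).trans ?_)
  rw [Finset.card_singleton, devSize]
  gcongr
  refine Finset.card_biUnion_le.trans (Finset.sum_le_sum fun k _ => ?_)
  exact Finset.card_image_le.trans (card_selWalks hg k).2

lemma exists_selWalk (hg : IsSocket J g) (hJ : 2 ≤ J) (n : ℕ) :
    ∃ w, Follows (selSteps nx g v) w ∧ w.length = n := by
  induction n with
  | zero => exact ⟨[], trivial, rfl⟩
  | succ n ih =>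
    obtain ⟨w, hw, hl⟩ := ih
    have : (selSteps nx g v w).Nonempty := by
      cases w with
      | nil => rw [selSteps, ← Finset.card_pos, hg.2]; omega
      | cons p w =>
        rw [selSteps]
        split_ifs
        · simp
        · rw [← Finset.card_pos, card_fiber_ne hg]; omega
    obtain ⟨q, hq⟩ := this
    exact ⟨q :: w, ⟨hq, hw⟩, by simp [hl]⟩

/-! ### Switching two edges -/

/-- Exchanging the ends of the edges `p` and `p'` keeps the graph regular and without parallel edges. -/
lemma IsSocket.swap (hg : IsSocket J g) {p p' : Fin M × Fin K} (h1 : ∀ i, g (p.1, i) ≠ g p')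
    (h2 : ∀ i, g (p'.1, i) ≠ g p) : IsSocket J (g ∘ Equiv.swap p p') := by
  constructor
  · intro c i j h
    simp only [Function.comp] at h
    have hij : ∀ i j, (c, i) = p → (c, j) ≠ p → g (Equiv.swap p p' (c, i)) ≠
        g (Equiv.swap p p' (c, j)) := by
      rintro i j rfl hj h
      rw [Equiv.swap_apply_left] at h
      by_cases hj' : (c, j) = p'
      · exact h1 j (by rw [hj'])
      · rw [Equiv.swap_apply_of_ne_of_ne hj hj'] at h
        exact h1 j h.symm
    have hij' : ∀ i j, (c, i) = p' → (c, j) ≠ p' → g (Equiv.swap p p' (c, i)) ≠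
        g (Equiv.swap p p' (c, j)) := by
      rintro i j rfl hj h
      rw [Equiv.swap_apply_right] at h
      by_cases hj' : (c, j) = p
      · exact h2 j (by rw [hj'])
      · rw [Equiv.swap_apply_of_ne_of_ne hj' hj] at h
        exact h2 j h.symm
    by_contra hne
    have hne' : (c, i) ≠ (c, j) := fun h => hne (congrArg Prod.snd h)
    by_cases a1 : (c, i) = p
    · exact hij i j a1 (fun h => hne' (a1.trans h.symm)) h
    by_cases a2 : (c, j) = p
    · exact hij j i a2 a1 h.symm
    by_cases a3 : (c, i) = p'
    · exact hij' i j a3 (fun h => hne' (a3.trans h.symm)) h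
    by_cases a4 : (c, j) = p'
    · exact hij' j i a4 a3 h.symm
    rw [Equiv.swap_apply_of_ne_of_ne a1 a3, Equiv.swap_apply_of_ne_of_ne a2 a4] at h
    exact hne (hg.1 c h)
  · intro u
    rw [← hg.2 u]
    exact Finset.card_equiv (Equiv.swap p p') (by simp)

lemma mem_steps_congr {g' : Fin M × Fin K → Fin N} {q : Fin M × Fin K}
    {w : List (Fin M × Fin K)} (h : ∀ x ∈ q :: w, g' x = g x) (hq : q ∈ steps g v w) :
    q ∈ steps g' v w := by
  have hq' := h q (by simp)
  cases w with
  | nil => simpa [steps, hq'] using hq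
  | cons p w =>
    have hp := h p (by simp)
    simp only [steps] at hq ⊢
    split_ifs at hq ⊢
    · exact hq
    · simpa [hq', hp] using hq

lemma mem_selSteps_congr {g' : Fin M × Fin K → Fin N} {q : Fin M × Fin K}
    {w : List (Fin M × Fin K)} (h : ∀ x ∈ q :: w, g' x = g x) (hq : q ∈ selSteps nx g v w) :
    q ∈ selSteps nx g' v w := by
  have hq' := h q (by simp)
  cases w with
  | nil => simpa [selSteps, hq'] using hq
  | cons p w =>
    have hp := h p (by simp)
    simp only [selSteps] at hq ⊢
    split_ifs at hq ⊢
    · exact hq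
    · simpa [hq', hp] using hq

lemma isWalk_congr {g' : Fin M × Fin K → Fin N} {w : List (Fin M × Fin K)}
    (h : ∀ x ∈ w, g' x = g x) (hw : IsWalk g v w) : IsWalk g' v w := by
  induction w with
  | nil => trivial
  | cons q w ih =>
    exact ⟨mem_steps_congr h hw.1, ih (fun x hx => h x (List.mem_cons_of_mem _ hx)) hw.2⟩

lemma follows_selSteps_congr {g' : Fin M × Fin K → Fin N} {w : List (Fin M × Fin K)}
    (h : ∀ x ∈ w, g' x = g x) (hw : Follows (selSteps nx g v) w) :
    Follows (selSteps nx g' v) w := by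
  induction w with
  | nil => trivial
  | cons q w ih =>
    exact ⟨mem_selSteps_congr h hw.1, ih (fun x hx => h x (List.mem_cons_of_mem _ hx)) hw.2⟩

lemma isSelX_congr {g' : Fin M × Fin K → Fin N} {w : List (Fin M × Fin K)}
    (h : ∀ x ∈ w, g' x = g x) (hw : IsSelX nx g v w) : IsSelX nx g' v w := by
  cases w with
  | nil => trivial
  | cons q w =>
    exact ⟨mem_steps_congr h hw.1,
      follows_selSteps_congr (fun x hx => h x (List.mem_cons_of_mem _ hx)) hw.2⟩

/-- The sockets of the check nodes that the edges in `A` meet. -/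
def rowSlots (A : List (Fin M × Fin K)) : Finset (Fin M × Fin K) :=
  A.toFinset.biUnion fun q => Finset.univ.filter fun p => p.1 = q.1

/-- The sockets attached to `v` and to the variable nodes that the edges in `A` meet. -/
def valSlots (g : Fin M × Fin K → Fin N) (v : Fin N) (A : List (Fin M × Fin K)) :
    Finset (Fin M × Fin K) :=
  (Finset.univ.filter fun p => g p = v) ∪
    A.toFinset.biUnion fun q => Finset.univ.filter fun p => g p = g q

lemma card_row (c : Fin M) : (Finset.univ.filter fun p : Fin M × Fin K => p.1 = c).card = K := by
  have : (Finset.univ.filter fun p : Fin M × Fin K => p.1 = c) = {c} ×ˢ Finset.univ := by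
    ext ⟨a, b⟩; simp [eq_comm]
  rw [this]; simp

lemma card_rowSlots_le (A : List (Fin M × Fin K)) : (rowSlots A).card ≤ A.length * K :=
  (Finset.card_biUnion_le_card_mul _ _ K fun q _ => (card_row q.1).le).trans
    (by gcongr; exact A.toFinset_card_le)

lemma card_valSlots_le (hg : IsSocket J g) (A : List (Fin M × Fin K)) :
    (valSlots g v A).card ≤ (A.length + 1) * J := by
  refine (Finset.card_union_le _ _).trans ?_
  rw [hg.2, add_mul, one_mul, add_comm]
  gcongr
  exact (Finset.card_biUnion_le_card_mul _ _ J fun q _ => (hg.2 (g q)).le).trans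
    (by gcongr; exact A.toFinset_card_le)

/-- The sockets with which `p` may be exchanged, where the edges in `A` are kept. -/
def swapSlots (g : Fin M × Fin K → Fin N) (A : List (Fin M × Fin K)) (p : Fin M × Fin K) :
    Finset (Fin M × Fin K) :=
  Finset.univ.filter fun p' => p' ∉ A ∧ (∀ i, g (p.1, i) ≠ g p') ∧ ∀ i, g (p'.1, i) ≠ g p

lemma card_swapSlots (hg : IsSocket J g) (A : List (Fin M × Fin K)) (p : Fin M × Fin K) :
    M * K ≤ (swapSlots g A p).card + (A.length + 2 * (J * K)) := by
  let B : Finset (Fin M × Fin K) := A.toFinset ∪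
    ((Finset.univ.biUnion fun i : Fin K => Finset.univ.filter fun p' => g p' = g (p.1, i)) ∪
      (Finset.univ.filter fun q => g q = g p).biUnion fun q =>
        Finset.univ.filter fun p' : Fin M × Fin K => p'.1 = q.1)
  have hB : B.card ≤ A.length + 2 * (J * K) := by
    refine (Finset.card_union_le _ _).trans (add_le_add A.toFinset_card_le
      ((Finset.card_union_le _ _).trans ?_))
    rw [two_mul]
    refine add_le_add ?_ ?_
    · refine (Finset.card_biUnion_le_card_mul _ _ J fun i _ => (hg.2 _).le).trans ?_
      rw [Finset.card_univ, Fintype.card_fin, mul_comm]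
    · refine (Finset.card_biUnion_le_card_mul _ _ K fun q _ => (card_row q.1).le).trans ?_
      rw [hg.2]
  have huniv : (Finset.univ : Finset (Fin M × Fin K)) ⊆ swapSlots g A p ∪ B := by
    intro p' _
    by_cases h : p' ∈ swapSlots g A p
    · exact Finset.mem_union_left _ h
    · refine Finset.mem_union_right _ ?_
      simp only [swapSlots, Finset.mem_filter, Finset.mem_univ, true_and, not_and_or, not_not,
        not_forall] at h
      simp only [B, Finset.mem_union, Finset.mem_biUnion, Finset.mem_filter, Finset.mem_univ,
        true_and, List.mem_toFinset]
      rcases h with h | ⟨i, h⟩ | ⟨i, h⟩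
      · exact Or.inl h
      · exact Or.inr (Or.inl ⟨i, h.symm⟩)
      · exact Or.inr (Or.inr ⟨(p'.1, i), h, rfl⟩)
  have := Finset.card_le_card huniv
  rw [Finset.card_univ, Fintype.card_prod, Fintype.card_fin, Fintype.card_fin] at this
  exact this.trans ((Finset.card_union_le _ _).trans (by omega))

/-- The walks of at most `2 * l` steps. -/
def walkSet (g : Fin M × Fin K → Fin N) (v : Fin N) (l : ℕ) : Finset (List (Fin M × Fin K)) :=
  (Finset.range (2 * l + 1)).biUnion fun n => followLists (steps g v) n

/-- The selected walks of at most `2 * l` steps, the last of which is arbitrary. -/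
def selXSet (nx : Fin M × Fin K → Fin M × Fin K) (g : Fin M × Fin K → Fin N) (v : Fin N) (l : ℕ) :
    Finset (List (Fin M × Fin K)) :=
  {[]} ∪ (Finset.range (2 * l)).biUnion fun n => (followLists (selSteps nx g v) n).biUnion fun w =>
    (steps g v w).image fun q => q :: w

lemma mem_walkSet {w : List (Fin M × Fin K)} :
    w ∈ walkSet g v l ↔ IsWalk g v w ∧ w.length ≤ 2 * l := by
  simp only [walkSet, Finset.mem_biUnion, Finset.mem_range, mem_followLists]
  constructor
  · rintro ⟨n, hn, h, rfl⟩
    exact ⟨h, by omega⟩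
  · rintro ⟨h, hl⟩
    exact ⟨_, by omega, h, rfl⟩

lemma mem_selXSet {w : List (Fin M × Fin K)} :
    w ∈ selXSet nx g v l ↔ IsSelX nx g v w ∧ w.length ≤ 2 * l := by
  simp only [selXSet, Finset.mem_union, Finset.mem_singleton, Finset.mem_biUnion, Finset.mem_range,
    mem_followLists, Finset.mem_image]
  constructor
  · rintro (rfl | ⟨n, hn, w', ⟨h, rfl⟩, q, hq, rfl⟩)
    · exact ⟨trivial, by simp⟩
    · exact ⟨⟨hq, h⟩, by simp only [List.length_cons]; omega⟩
  · rintro ⟨h, hl⟩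
    cases w with
    | nil => exact Or.inl rfl
    | cons q w =>
      simp only [List.length_cons] at hl
      exact Or.inr ⟨_, by omega, w, ⟨h.2, rfl⟩, q, h.1, rfl⟩

lemma card_walkSet_le (hg : IsSocket J g) (hJ : 2 ≤ J) (hK : 2 ≤ K) :
    (walkSet g v l).card ≤ (2 * l + 1) * (J * ((J - 1) * (K - 1)) ^ l) := by
  refine (Finset.card_biUnion_le_card_mul _ _ (J * ((J - 1) * (K - 1)) ^ l) fun n hn => ?_).trans
    (by rw [Finset.card_range])
  have hn' := Finset.mem_range.1 hn
  have h1 : 1 ≤ (J - 1) * (K - 1) := Nat.mul_pos (by omega) (by omega)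
  rcases Nat.even_or_odd' n with ⟨k, rfl | rfl⟩
  · rcases k with _ | k
    · simp only [followLists, Finset.card_singleton]
      exact Nat.mul_pos (by omega) (by positivity)
    · refine (card_walks hg k).2.trans ?_
      rw [mul_assoc]
      gcongr
      calc ((J - 1) * (K - 1)) ^ k * (K - 1)
          ≤ ((J - 1) * (K - 1)) ^ k * ((J - 1) * (K - 1)) := by
            gcongr; exact Nat.le_mul_of_pos_left _ (by omega)
        _ = ((J - 1) * (K - 1)) ^ (k + 1) := by rw [pow_succ]
        _ ≤ _ := Nat.pow_le_pow_right h1 (by omega)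
  · refine (card_walks hg k).1.trans ?_
    gcongr
    omega

lemma card_steps_le (hg : IsSocket J g) (w : List (Fin M × Fin K)) :
    (steps g v w).card ≤ J + K := by
  cases w with
  | nil => rw [steps, hg.2]; omega
  | cons p w =>
    rw [steps]
    split_ifs
    · rw [card_row_ne]; omega
    · rw [card_fiber_ne hg]; omega

lemma card_selXSet_le (hg : IsSocket J g) (hJ : 2 ≤ J) :
    (selXSet nx g v l).card ≤ (2 * l + 1) * (J * (J - 1) ^ l * (J + K)) := by
  have h1 : 1 ≤ J - 1 := by omega
  have hpos : 1 ≤ J * (J - 1) ^ l * (J + K) :=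
    Nat.mul_pos (Nat.mul_pos (by omega) (by positivity)) (by omega)
  refine (Finset.card_union_le _ _).trans ?_
  rw [Finset.card_singleton, add_mul, one_mul, add_comm]
  refine add_le_add ?_ hpos
  refine (Finset.card_biUnion_le_card_mul _ _ (J * (J - 1) ^ l * (J + K)) fun n hn => ?_).trans
    (by rw [Finset.card_range])
  have hn' := Finset.mem_range.1 hn
  refine (Finset.card_biUnion_le_card_mul _ _ (J + K) fun w _ =>
    Finset.card_image_le.trans (card_steps_le hg w)).trans ?_
  gcongr
  rcases Nat.even_or_odd' n with ⟨k, rfl | rfl⟩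
  · rcases k with _ | k
    · simp only [followLists, Finset.card_singleton]
      exact Nat.mul_pos (by omega) (by positivity)
    · refine (card_selWalks hg k).2.trans ?_
      gcongr
      omega
  · refine (card_selWalks hg k).1.trans ?_
    gcongr
    omega

open Classical in
/-- The socket assignments for which some edge closes a cycle near `v`. -/
noncomputable def badSockets (nx : Fin M × Fin K → Fin M × Fin K) (J : ℕ) (v : Fin N) (l : ℕ) :
    Finset (Fin M × Fin K → Fin N) :=
  (sockets N M J K).filter fun g => ¬ Good nx g v l

/-- Few socket assignments are bad: switching the edge that closes a cycle with a random edge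
destroys the cycle, and the switched edges can be reconstructed from few data. -/
lemma card_badSockets_mul_le (nx : Fin M × Fin K → Fin M × Fin K) (v : Fin N) (l : ℕ)
    (hJ : 2 ≤ J) (hK : 2 ≤ K) :
    (badSockets nx J v l).card * (M * K - (4 * l + 2 * (J * K))) ≤
      (sockets N M J K).card *
        ((2 * l + 1) * (J * (J - 1) ^ l * (J + K)) * ((2 * l + 1) * (J * ((J - 1) * (K - 1)) ^ l)) *
          (4 * l * K * ((4 * l + 1) * J))) := by
  classical
  -- A selected walk and a walk with an edge outside them that joins two of their nodes.
  have hex : ∀ g ∈ badSockets nx J v l, ∃ t : (List (Fin M × Fin K) × List (Fin M × Fin K)) ×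
      (Fin M × Fin K), t.1.1 ∈ selXSet nx g v l ∧ t.1.2 ∈ walkSet g v l ∧
        t.2 ∈ rowSlots (t.1.1 ++ t.1.2) ∧ t.2 ∈ valSlots g v (t.1.1 ++ t.1.2) ∧
        t.2 ∉ t.1.1 ++ t.1.2 := by
    intro g hg
    have hbad := (Finset.mem_filter.1 hg).2
    simp only [Good, EdgeClosed, not_forall] at hbad
    obtain ⟨P, R, hP, hR, hPl, hRl, p, hrow, hval, hp⟩ := hbad
    refine ⟨((P, R), p), mem_selXSet.2 ⟨hP, hPl⟩, mem_walkSet.2 ⟨hR, hRl⟩, ?_, ?_, hp⟩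
    · simpa [rowSlots] using hrow
    · simpa [valSlots] using hval
  rcases (badSockets nx J v l).eq_empty_or_nonempty with hempty | ⟨g0, hg0⟩
  · simp [hempty]
  have : Nonempty (Fin M × Fin K) := ⟨(hex g0 hg0).choose.2⟩
  choose! t ht1 ht2 ht3 ht4 ht5 using hex
  let A := fun g : Fin M × Fin K → Fin N => (t g).1.1 ++ (t g).1.2
  have hA : ∀ g ∈ badSockets nx J v l, (A g).length ≤ 4 * l := by
    intro g hg
    have h1 := (mem_selXSet.1 (ht1 g hg)).2
    have h2 := (mem_walkSet.1 (ht2 g hg)).2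
    simp only [A, List.length_append]; omega
  have hsock : ∀ g ∈ badSockets nx J v l, IsSocket J g := fun g hg =>
    mem_sockets.1 (Finset.mem_filter.1 hg).1
  -- The exchanges of the closing socket, and the data from which they can be undone: the new
  -- assignment, the two walks (which the exchange does not touch), the closing socket, which lies at
  -- a check node of the walks, and its partner, which is now attached to a variable node of the walks.
  let src := (badSockets nx J v l).sigma fun g => swapSlots g (A g) (t g).2
  let tgt := (sockets N M J K).sigma fun g => (selXSet nx g v l ×ˢ walkSet g v l).sigma fun PR =>
    (rowSlots (PR.1 ++ PR.2) ×ˢ valSlots g v (PR.1 ++ PR.2)).filter fun _ =>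
      (PR.1 ++ PR.2).length ≤ 4 * l
  have hsrc : (badSockets nx J v l).card * (M * K - (4 * l + 2 * (J * K))) ≤ src.card := by
    rw [Finset.card_sigma, ← smul_eq_mul]
    refine Finset.card_nsmul_le_sum _ _ _ fun g hg => ?_
    have := card_swapSlots (hsock g hg) (A g) (t g).2
    have := hA g hg
    omega
  have htgt : tgt.card ≤ (sockets N M J K).card *
        ((2 * l + 1) * (J * (J - 1) ^ l * (J + K)) * ((2 * l + 1) * (J * ((J - 1) * (K - 1)) ^ l)) *
          (4 * l * K * ((4 * l + 1) * J))) := by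
    rw [Finset.card_sigma, ← smul_eq_mul (sockets N M J K).card]
    refine Finset.sum_le_card_nsmul _ _ _ fun g hg => ?_
    have hg' := mem_sockets.1 hg
    rw [Finset.card_sigma]
    refine (Finset.sum_le_card_nsmul _ _ (4 * l * K * ((4 * l + 1) * J)) fun PR _ => ?_).trans ?_
    · by_cases hl : (PR.1 ++ PR.2).length ≤ 4 * l
      · refine (Finset.card_filter_le _ _).trans ?_
        rw [Finset.card_product]
        exact Nat.mul_le_mul ((card_rowSlots_le _).trans (by gcongr))
          ((card_valSlots_le hg' _).trans (by gcongr))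
      · rw [Finset.filter_false_of_mem fun _ _ => hl]; simp
    · rw [smul_eq_mul, Finset.card_product]
      gcongr
      · exact card_selXSet_le hg' hJ
      · exact card_walkSet_le hg' hJ hK
  refine hsrc.trans (le_trans ?_ htgt)
  refine Finset.card_le_card_of_injOn
    (fun x => ⟨x.1 ∘ Equiv.swap (t x.1).2 x.2, ⟨(t x.1).1, ((t x.1).2, x.2)⟩⟩) ?_ ?_
  · rintro ⟨g, p'⟩ hx
    simp only [src, Finset.coe_sigma, Set.mem_sigma_iff, Finset.mem_coe] at hx
    obtain ⟨hg, hp'⟩ := hx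
    simp only [swapSlots, Finset.mem_filter, Finset.mem_univ, true_and] at hp'
    have hsame : ∀ x ∈ A g, (g ∘ Equiv.swap (t g).2 p') x = g x := by
      intro x hx
      simp only [Function.comp]
      rw [Equiv.swap_apply_of_ne_of_ne]
      · rintro rfl; exact ht5 g hg hx
      · rintro rfl; exact hp'.1 hx
    simp only [tgt, Finset.coe_sigma, Set.mem_sigma_iff, Finset.mem_coe,
      Finset.mem_filter, Finset.mem_product]
    have h1 := mem_selXSet.1 (ht1 g hg)
    have h2 := mem_walkSet.1 (ht2 g hg)
    refine ⟨mem_sockets.2 ((hsock g hg).swap hp'.2.1 hp'.2.2), ⟨?_, ?_⟩, ⟨ht3 g hg, ?_⟩, hA g hg⟩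
    · exact mem_selXSet.2
        ⟨isSelX_congr (fun x hx => hsame x (List.mem_append_left _ hx)) h1.1, h1.2⟩
    · exact mem_walkSet.2
        ⟨isWalk_congr (fun x hx => hsame x (List.mem_append_right _ hx)) h2.1, h2.2⟩
    · have h4 := ht4 g hg
      simp only [valSlots, Finset.mem_union, Finset.mem_filter, Finset.mem_univ, true_and,
        Finset.mem_biUnion, List.mem_toFinset] at h4 ⊢
      have e : (g ∘ Equiv.swap (t g).2 p') p' = g (t g).2 := by simp
      rw [e]
      rcases h4 with h4 | ⟨q, hq, h4⟩
      · exact Or.inl h4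
      · exact Or.inr ⟨q, hq, by rw [h4]; exact (hsame q hq).symm⟩
  · rintro ⟨g, p'⟩ _ ⟨g2, p2'⟩ _ h
    simp only [Sigma.mk.injEq] at h
    obtain ⟨h1, h2⟩ := h
    have h2 := eq_of_heq h2
    simp only [Sigma.mk.injEq] at h2
    obtain ⟨-, h2⟩ := h2
    have h2 := Prod.mk.inj (eq_of_heq h2)
    -- an exchange is its own inverse
    have hg : g = g2 := by
      rw [h2.1, h2.2] at h1
      ext x
      have := congrFun h1 (Equiv.swap (t g2).2 p2' x)
      simp only [Function.comp, Equiv.swap_apply_self] at this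
      rw [this]
    subst hg
    simp [h2.2]

/-! ### Twins -/

open Classical in
/-- The socket assignments for which some variable node `u ≠ v` shares at least `k` check nodes with
`v`, and whose other check nodes do not meet those neighbours of `v` that the selection picks. -/
noncomputable def twinSockets (nx : Fin M × Fin K → Fin M × Fin K) (J : ℕ) (v : Fin N) (k : ℕ) :
    Finset (Fin M × Fin K → Fin N) :=
  (sockets N M J K).filter fun g => ∃ u, u ≠ v ∧
    k ≤ (Finset.univ.filter fun p => g p = v ∧ ∃ j, g (p.1, j) = u).card ∧
    ∀ p d, g p = v → g d = u → (∀ j, g (p.1, j) ≠ u) → (∀ j, g (d.1, j) ≠ v) →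
      ∀ j, g (d.1, j) ≠ g (nx p)

/-- If all check nodes of `u` are check nodes of `v`, then the converse holds, as the degrees agree. -/
lemma IsSocket.rows_subset_symm (hg : IsSocket J g) {u v : Fin N}
    (h : ∀ d, g d = u → ∃ j, g (d.1, j) = v) (p : Fin M × Fin K) (hp : g p = v) :
    ∃ j, g (p.1, j) = u := by
  have hsub : checksOf (matOf g) u ⊆ checksOf (matOf g) v := by
    intro c hc
    rw [checksOf_matOf, Finset.mem_image] at hc ⊢
    obtain ⟨d, hd, rfl⟩ := hc
    obtain ⟨j, hj⟩ := h d (by simpa using hd)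
    exact ⟨(d.1, j), by simpa using hj, rfl⟩
  have heq := Finset.eq_of_subset_of_card_le hsub
    (by rw [card_checksOf_matOf hg, card_checksOf_matOf hg])
  have : p.1 ∈ checksOf (matOf g) u := by
    rw [heq, checksOf_matOf]
    exact Finset.mem_image_of_mem _ (by simpa using hp)
  rw [checksOf_matOf, Finset.mem_image] at this
  obtain ⟨q, hq, hq'⟩ := this
  exact ⟨q.2, by rw [← hq']; simpa using hq⟩

/-- Gaining one more common check node of `v` and `u` costs a factor that is polynomial in `M * K`: the
edge that the selection picks at a check node of `v` is exchanged with an edge of `u`, and the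
exchange is determined by the two sockets. -/
lemma card_twinSockets_succ (hn : IsSelection nx) (v : Fin N) {k : ℕ} (hk : k < J) :
    (twinSockets nx J v k).card ≤ (twinSockets nx J v (k + 1)).card * (M * K) ^ 2 := by
  classical
  have key : ∀ g ∈ twinSockets nx J v k, ∃ t : (Fin M × Fin K) × (Fin M × Fin K),
      g ∘ Equiv.swap t.1 t.2 ∈ twinSockets nx J v (k + 1) := by
    intro g hgm
    simp only [twinSockets, Finset.mem_filter, mem_sockets] at hgm
    obtain ⟨hg, u, huv, hcard, hinv⟩ := hgm
    -- if `u` is a twin already, then nothing is to be done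
    by_cases hall : ∀ p, g p = v → ∃ j, g (p.1, j) = u
    · obtain ⟨p, -⟩ := Finset.card_pos.1 ((Nat.zero_le k).trans_lt (hk.trans_eq (hg.2 v).symm))
      refine ⟨(p, p), ?_⟩
      simp only [Equiv.swap_self, Equiv.coe_refl, Function.comp_id, twinSockets, Finset.mem_filter,
        mem_sockets]
      refine ⟨hg, u, huv, ?_, hinv⟩
      rw [Finset.filter_congr (q := fun p => g p = v)
        fun p _ => ⟨fun h => h.1, fun h => ⟨h, hall p h⟩⟩, hg.2]
      exact hk
    push Not at hall
    obtain ⟨p, hp, hpu⟩ := hall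
    obtain ⟨d, hd, hdv⟩ : ∃ d, g d = u ∧ ∀ j, g (d.1, j) ≠ v := by
      by_contra! hcon
      obtain ⟨j, hj⟩ := hg.rows_subset_symm (fun d hd => hcon d hd) p hp
      exact hpu j hj
    refine ⟨(nx p, d), ?_⟩
    have hnxv : g (nx p) ≠ v := fun h => hn.ne p (hg.eq_of_row (hn.row p) (h.trans hp.symm))
    have hsw : ∀ q, q ≠ nx p → q ≠ d → (g ∘ Equiv.swap (nx p) d) q = g q := fun q h1 h2 => by
      simp only [Function.comp]; rw [Equiv.swap_apply_of_ne_of_ne h1 h2]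
    have hs1 : (g ∘ Equiv.swap (nx p) d) (nx p) = u := by simp [hd]
    have hs2 : (g ∘ Equiv.swap (nx p) d) d = g (nx p) := by simp
    have hnxu : g (nx p) ≠ u := by
      have := hpu (nx p).2
      rwa [← hn.row p] at this
    have hg' : IsSocket J (g ∘ Equiv.swap (nx p) d) := by
      refine hg.swap (fun i => ?_) (fun i => hinv p d hp hd hpu hdv i)
      rw [hn.row, hd]; exact hpu i
    have hv : ∀ q, (g ∘ Equiv.swap (nx p) d) q = v ↔ g q = v := by
      intro q
      by_cases h1 : q = nx p
      · rw [h1, hs1]; exact ⟨fun h => absurd h huv, fun h => absurd h hnxv⟩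
      by_cases h2 : q = d
      · rw [h2, hs2, hd]; exact ⟨fun h => absurd h hnxv, fun h => absurd h huv⟩
      rw [hsw q h1 h2]
    -- common check nodes stay common
    have hold : ∀ q, g q = v → ∀ j, g (q.1, j) = u → (g ∘ Equiv.swap (nx p) d) (q.1, j) = u := by
      intro q hq j hj
      rw [hsw]
      · exact hj
      · intro h
        exact hnxu (h ▸ hj)
      · intro h
        have h1 : q.1 = d.1 := by rw [← h]
        exact hdv q.2 (by rw [← h1]; exact hq)
    simp only [twinSockets, Finset.mem_filter, mem_sockets]
    refine ⟨hg', u, huv, ?_, ?_⟩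
    · have hpn : p ∉ Finset.univ.filter fun p => g p = v ∧ ∃ j, g (p.1, j) = u := by
        simp only [Finset.mem_filter, Finset.mem_univ, true_and, not_and, not_exists]
        exact fun _ => hpu
      calc k + 1 ≤ (insert p (Finset.univ.filter fun p => g p = v ∧ ∃ j, g (p.1, j) = u)).card := by
            rw [Finset.card_insert_of_notMem hpn]; omega
        _ ≤ _ := by
            refine Finset.card_le_card fun q hq => ?_
            simp only [Finset.mem_filter, Finset.mem_univ, true_and, hv]
            rcases Finset.mem_insert.1 hq with rfl | hq
            · exact ⟨hp, (nx q).2, by rw [← hn.row q]; exact hs1⟩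
            · simp only [Finset.mem_filter, Finset.mem_univ, true_and] at hq
              obtain ⟨h1, j, hj⟩ := hq
              exact ⟨h1, j, hold q h1 j hj⟩
    · intro p2 d2 hp2 hd2 hpu2 hdv2 j
      rw [hv] at hp2
      have hrow2 : p2.1 ≠ p.1 := fun h => hpu2 (nx p).2 (by
        rw [h, ← hn.row p]; exact hs1)
      have hdp : d2.1 ≠ p.1 := fun h => hdv2 p.2 (by rw [h]; exact (hv p).2 hp)
      have hd2d : d2 ≠ d := by
        rintro rfl
        rw [hs2] at hd2
        exact hnxu hd2
      have hd2p : d2 ≠ nx p := by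
        rintro rfl
        exact hdp (hn.row p)
      rw [hsw d2 hd2p hd2d] at hd2
      have hdd : d2.1 ≠ d.1 := fun h => hd2d (hg.eq_of_row h (hd2.trans hd.symm))
      have hpd : p2.1 ≠ d.1 := fun h => hdv p2.2 (by rw [← h]; exact hp2)
      rw [hsw (d2.1, j) (fun h => hdp (by rw [← hn.row p, ← h]))
          (fun h => hdd (by rw [← h])),
        hsw (nx p2) (fun h => hrow2 (by rw [← hn.row p2, h, hn.row]))
          (fun h => hpd (by rw [← hn.row p2, h]))]
      refine hinv p2 d2 hp2 hd2 (fun i hi => hpu2 i (hold p2 hp2 i hi)) (fun i hi => ?_) j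
      exact hdv2 i ((hv _).2 hi)
  rcases (twinSockets nx J v k).eq_empty_or_nonempty with hempty | ⟨g0, hg0⟩
  · simp [hempty]
  have : Nonempty (Fin M × Fin K) := ⟨(key g0 hg0).choose.1⟩
  choose! t ht using key
  have hcard : (M * K) ^ 2 = (Finset.univ : Finset ((Fin M × Fin K) × (Fin M × Fin K))).card := by
    simp [sq]
  rw [hcard, ← Finset.card_product]
  refine Finset.card_le_card_of_injOn (fun g => (g ∘ Equiv.swap (t g).1 (t g).2, t g)) ?_ ?_
  · intro g hg
    simpa using ht g hg
  · intro g _ g2 _ h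
    simp only [Prod.mk.injEq] at h
    obtain ⟨h1, h2⟩ := h
    rw [h2] at h1
    ext x
    have := congrFun h1 (Equiv.swap (t g2).1 (t g2).2 x)
    simp only [Function.comp, Equiv.swap_apply_self] at this
    rw [this]

end

section
variable {M K N J : ℕ} {g : Fin M × Fin K → Fin N} {v : Fin N} {l : ℕ}
  {nx : Fin M × Fin K → Fin M × Fin K}

lemma sockets_subset_twinSockets (v : Fin N) (hn : IsSelection nx)
    (hN : J * (K * (J * K)) + 1 < N) :
    sockets N M J K ⊆ twinSockets nx J v 0 := by
  classical
  intro g hg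
  have hg' := mem_sockets.1 hg
  -- the variable nodes at distance at most four from `v`
  let B : Finset (Fin N) := (Finset.univ.filter fun p => g p = v).biUnion fun p =>
    Finset.univ.biUnion fun i : Fin K =>
      (Finset.univ.filter fun d => g d = g (p.1, i)).biUnion fun d =>
        Finset.univ.image fun j : Fin K => g (d.1, j)
  have hB : B.card ≤ J * (K * (J * K)) := by
    refine (Finset.card_biUnion_le_card_mul _ _ (K * (J * K)) fun p _ => ?_).trans
      (by rw [hg'.2])
    refine (Finset.card_biUnion_le_card_mul _ _ (J * K) fun i _ => ?_).trans
      (by rw [Finset.card_univ, Fintype.card_fin])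
    refine (Finset.card_biUnion_le_card_mul _ _ K fun d _ => ?_).trans
      (by rw [hg'.2])
    refine Finset.card_image_le.trans (by rw [Finset.card_univ, Fintype.card_fin])
  obtain ⟨u, hu⟩ : ∃ u, u ∉ insert v B := by
    by_contra! h
    have h1 : (Finset.univ : Finset (Fin N)) ⊆ insert v B := fun u _ => h u
    have h2 := (Finset.card_le_card h1).trans (Finset.card_insert_le _ _)
    rw [Finset.card_univ, Fintype.card_fin] at h2
    omega
  rw [Finset.mem_insert, not_or] at hu
  simp only [twinSockets, Finset.mem_filter, mem_sockets]
  refine ⟨hg', u, hu.1, Nat.zero_le _, fun p d hp hd _ _ j hj => hu.2 ?_⟩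
  simp only [B, Finset.mem_biUnion, Finset.mem_filter, Finset.mem_univ, true_and, Finset.mem_image]
  exact ⟨p, hp, (nx p).2, (d.1, j), by rw [hj, ← hn.row p], d.2, hd⟩

/-- A not too small fraction of the socket assignments gives `v` a twin. -/
lemma card_sockets_le_twin (hn : IsSelection nx) (v : Fin N) (hN : J * (K * (J * K)) + 1 < N) :
    (sockets N M J K).card ≤ (twinSockets nx J v J).card * ((M * K) ^ 2) ^ J := by
  have key : ∀ k ≤ J, (sockets N M J K).card
      ≤ (twinSockets nx J v k).card * ((M * K) ^ 2) ^ k := by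
    intro k
    induction k with
    | zero =>
      intro _
      simpa using Finset.card_le_card (sockets_subset_twinSockets v hn hN)
    | succ k ih =>
      intro hk
      refine (ih (by omega)).trans ?_
      refine (Nat.mul_le_mul_right _ (card_twinSockets_succ hn v hk)).trans (le_of_eq ?_)
      ring
  exact key J le_rfl

/-- A variable node and its twin form a codeword. -/
lemma exists_twin (hgm : g ∈ twinSockets nx J v J) :
    ∃ u, u ≠ v ∧ ∀ c, ∏ i, signOf {v, u} (g (c, i)) = 1 := by
  simp only [twinSockets, Finset.mem_filter, mem_sockets] at hgm
  obtain ⟨hg, u, huv, hcard, -⟩ := hgm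
  have hsub : (Finset.univ.filter fun p => g p = v ∧ ∃ j, g (p.1, j) = u)
      ⊆ Finset.univ.filter fun p => g p = v := by
    intro p hp
    simp only [Finset.mem_filter, Finset.mem_univ, true_and] at hp ⊢
    exact hp.1
  have heq := Finset.eq_of_subset_of_card_le hsub (by rw [hg.2]; exact hcard)
  have h1 : ∀ p, g p = v → ∃ j, g (p.1, j) = u := by
    intro p hp
    have : p ∈ Finset.univ.filter fun p => g p = v := by simpa using hp
    rw [← heq] at this
    simp only [Finset.mem_filter, Finset.mem_univ, true_and] at this
    exact this.2
  have h2 : ∀ p, g p = u → ∃ j, g (p.1, j) = v := hg.rows_subset_symm h1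
  refine ⟨u, huv, fun c => ?_⟩
  by_cases hc : ∃ i, g (c, i) = v
  · obtain ⟨i, hi⟩ := hc
    obtain ⟨j, hj⟩ := h1 (c, i) hi
    have hij : i ≠ j := by
      rintro rfl
      exact huv (hj.symm.trans hi)
    rw [Fintype.prod_eq_mul i j hij]
    · change g (c, j) = u at hj
      simp [signOf, hi, hj]
    · intro k hk
      rw [signOf, if_neg]
      rw [Finset.mem_insert, Finset.mem_singleton]
      rintro (h | h)
      · exact hk.1 (hg.1 c (h.trans hi.symm))
      · exact hk.2 (hg.1 c (h.trans hj.symm))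
  · refine Finset.prod_eq_one fun k _ => ?_
    rw [signOf, if_neg]
    rw [Finset.mem_insert, Finset.mem_singleton]
    rintro (h | h)
    · exact hc ⟨k, h⟩
    · exact hc (h2 (c, k) h)

/-! ### Check nodes of degree two -/

/-- For `K = 2`, or without iterations, the selected walks are all walks, and their ends always form
a local codeword. -/
lemma localSign_selSet_of_two (hn : IsSelection nx) {g : Fin M × Fin K → Fin N}
    (hKl : K = 2 ∨ l = 0) : LocalSign g v l (signOf (selSet nx g v l)) := by
  intro q w hw he hl
  rcases hKl with rfl | rfl
  swap
  · omega
  have huniq : ∀ a b : Fin M × Fin 2, a.1 = b.1 → a ≠ b → a = nx b := by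
    rintro ⟨c, i⟩ ⟨d, j⟩ h1 h2
    obtain rfl : c = d := h1
    have h3 := hn.row (c, j)
    have h4 := hn.ne (c, j)
    generalize nx (c, j) = r at h3 h4 ⊢
    obtain ⟨e, k⟩ := r
    obtain rfl : e = c := h3
    have a1 : i ≠ j := fun h => h2 (by rw [h])
    have a2 : k ≠ j := fun h => h4 (by rw [h])
    have : i = k := by omega
    rw [this]
  have hsel : ∀ w : List (Fin M × Fin 2), IsWalk g v w → Follows (selSteps nx g v) w := by
    intro w
    induction w with
    | nil => exact fun h => h
    | cons q w ih =>
      rintro ⟨h1, h2⟩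
      refine ⟨?_, ih h2⟩
      cases w with
      | nil => exact h1
      | cons p w =>
        simp only [steps, selSteps] at h1 ⊢
        split_ifs at h1 ⊢
        · simp only [Finset.mem_filter, Finset.mem_univ, true_and] at h1
          rw [Finset.mem_singleton]
          exact huniq q p h1.1 h1.2
        · exact h1
  have hq : g q ∈ selSet nx g v l := by
    simp only [selSet, Finset.mem_filter, Finset.mem_univ, true_and]
    exact ⟨w, hsel w hw.2, he, by omega, by rw [endNode_of_mem_steps hw.1, if_pos he]⟩
  have hq' : g (nx q) ∈ selSet nx g v l := by
    simp only [selSet, Finset.mem_filter, Finset.mem_univ, true_and]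
    refine ⟨nx q :: q :: w, ⟨by simp [selSteps, he], hsel _ hw⟩, ?_, ?_, ?_⟩
    · simpa [Nat.even_add_one] using he
    · simp only [List.length_cons]; omega
    · rw [endNode, if_neg]
      simpa [Nat.even_add_one] using he
  have hne : q.2 ≠ (nx q).2 := fun h => hn.ne q (Prod.ext (hn.row q) h.symm)
  have e2 : g (q.1, (nx q).2) = g (nx q) := by rw [← hn.row q]
  rw [Fintype.prod_eq_mul q.2 (nx q).2 hne]
  · rw [e2, signOf, signOf, if_pos hq', if_pos hq]; norm_num
  · intro i hi
    exfalso
    have := hi.1; have := hi.2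
    omega

/-- The cyclic successor of a socket at its check node. -/
def cyc (q : Fin M × Fin K) : Fin M × Fin K := (q.1, finRotate K q.2)

lemma finRotate_ne (hK : 2 ≤ K) (i : Fin K) : finRotate K i ≠ i := by
  obtain ⟨n, rfl⟩ : ∃ n, K = n + 2 := ⟨K - 2, by omega⟩
  rw [finRotate_apply]
  simp

lemma finRotate_finRotate_ne (hK : 3 ≤ K) (i : Fin K) : finRotate K (finRotate K i) ≠ i := by
  obtain ⟨n, rfl⟩ : ∃ n, K = n + 3 := ⟨K - 3, by omega⟩
  rw [finRotate_apply, finRotate_apply, add_assoc]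
  intro h
  have h2 : (1 + 1 : Fin (n + 3)) = 0 := by simpa using h
  have := congrArg Fin.val h2
  rw [Fin.val_add] at this
  simp [Nat.mod_eq_of_lt (show 2 < n + 3 by omega)] at this

lemma isSelection_cyc (hK : 2 ≤ K) : IsSelection (cyc : Fin M × Fin K → Fin M × Fin K) :=
  ⟨fun _ => rfl, fun q h => finRotate_ne hK q.2 (congrArg Prod.snd h)⟩

lemma cyc_cyc_ne (hK : 3 ≤ K) (q : Fin M × Fin K) : cyc (cyc q) ≠ q :=
  fun h => finRotate_finRotate_ne hK q.2 (congrArg Prod.snd h)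

end

/-! ### Symmetric channels -/

open MeasureTheory

/-- The error weight of an output message when the bit `0` was sent; an undecided bit counts half. -/
noncomputable def half (x : ℝ) : ℝ := if x < 0 then 1 else if x = 0 then 1 / 2 else 0

lemma half_neg (x : ℝ) : half (-x) = 1 - half x := by
  unfold half
  rcases lt_trichotomy x 0 with h | h | h
  · rw [if_neg (by linarith), if_neg (by linarith), if_pos h]; ring
  · subst h; norm_num
  · rw [if_pos (by linarith), if_neg (by linarith), if_neg (by linarith)]; ring

lemma half_nonneg (x : ℝ) : 0 ≤ half x := by
  unfold half; split_ifs <;> norm_num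

lemma half_le_one (x : ℝ) : half x ≤ 1 := by
  unfold half; split_ifs <;> norm_num

lemma measurable_half : Measurable half :=
  Measurable.ite measurableSet_Iio measurable_const
    (Measurable.ite (measurableSet_singleton 0) measurable_const measurable_const)

/-- `ν` is the output law for the input `0`, `Λ` the log-likelihood ratio, and `ι` an involution of
the output space that exchanges the output laws of the two inputs. -/
structure SymLLR {Y : Type} [MeasurableSpace Y] (ν : Measure Y) (Λ : Y → ℝ) (ι : Y → Y) :
    Prop where
  prob : IsProbabilityMeasure ν
  meas_llr : Measurable Λ
  meas_flip : Measurable ι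
  odd : ∀ y, Λ (ι y) = -Λ y
  invol : ∀ y, ι (ι y) = y
  map_eq : ν.map ι = ν.withDensity fun y => ENNReal.ofReal (Real.exp (-Λ y))

/-- Flip the outputs at the positions in `S`. -/
def flipOn {Y : Type} {N : ℕ} (ι : Y → Y) (S : Finset (Fin N)) (y : Fin N → Y) (i : Fin N) : Y :=
  if i ∈ S then ι (y i) else y i

/-- The sum of the log-likelihood ratios at the positions in `S`. -/
def llrSum {Y : Type} {N : ℕ} (Λ : Y → ℝ) (S : Finset (Fin N)) (y : Fin N → Y) : ℝ :=
  ∑ i ∈ S, Λ (y i)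

lemma llrSum_flipOn_of_disjoint {Y : Type} {Λ : Y → ℝ} {ι : Y → Y} {N : ℕ} {S T : Finset (Fin N)}
    (hST : Disjoint S T)
    (y : Fin N → Y) : llrSum Λ S (flipOn ι T y) = llrSum Λ S y :=
  Finset.sum_congr rfl fun i hi => by
    rw [flipOn, if_neg (Finset.disjoint_left.1 hST hi)]

section
variable {Y : Type} [MeasurableSpace Y] {ν : Measure Y} {Λ : Y → ℝ} {ι : Y → Y} {N : ℕ}

/-- The law of the received word when the word `0` is sent. -/
noncomputable abbrev zeroLaw (ν : Measure Y) (N : ℕ) : Measure (Fin N → Y) :=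
  Measure.pi fun _ => ν

/-- A product of measures with densities has the product density. -/
lemma pi_withDensity_ofReal [IsProbabilityMeasure ν] (ρ : Fin N → Y → ℝ) (h0 : ∀ i y, 0 ≤ ρ i y)
    (hi : ∀ i, Integrable (ρ i) ν) :
    Measure.pi (fun i => ν.withDensity fun y => ENNReal.ofReal (ρ i y))
      = (zeroLaw ν N).withDensity fun y => ENNReal.ofReal (∏ i, ρ i (y i)) := by
  have hfin : ∀ i, IsFiniteMeasure (ν.withDensity fun y => ENNReal.ofReal (ρ i y)) := fun i =>
    isFiniteMeasure_withDensity_ofReal (hi i).2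
  refine Measure.pi_eq fun s hs => ?_
  have hbox : MeasurableSet (Set.univ.pi s) := MeasurableSet.univ_pi hs
  rw [withDensity_apply _ hbox]
  have hprod : Integrable (fun y : Fin N → Y => ∏ i, (s i).indicator (ρ i) (y i)) (zeroLaw ν N) :=
    Integrable.fintype_prod_dep fun i => (hi i).indicator (hs i)
  have hind : ∀ y : Fin N → Y, (Set.univ.pi s).indicator (fun y => ∏ i, ρ i (y i)) y
      = ∏ i, (s i).indicator (ρ i) (y i) := by
    intro y
    by_cases hy : y ∈ Set.univ.pi s
    · rw [Set.indicator_of_mem hy]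
      exact Finset.prod_congr rfl fun i _ => by
        rw [Set.indicator_of_mem (hy i (Set.mem_univ i))]
    · rw [Set.indicator_of_notMem hy]
      simp only [Set.mem_pi, Set.mem_univ, forall_const, not_forall] at hy
      obtain ⟨i, hi⟩ := hy
      exact (Finset.prod_eq_zero (Finset.mem_univ i) (Set.indicator_of_notMem hi _)).symm
  have h1 : ∫⁻ y in Set.univ.pi s, ENNReal.ofReal (∏ i, ρ i (y i)) ∂(zeroLaw ν N)
      = ENNReal.ofReal (∫ y, ∏ i, (s i).indicator (ρ i) (y i) ∂(zeroLaw ν N)) := by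
    rw [ofReal_integral_eq_lintegral_ofReal hprod
      (Filter.Eventually.of_forall fun y => Finset.prod_nonneg fun i _ =>
        Set.indicator_nonneg (fun y _ => h0 i y) _), ← lintegral_indicator hbox]
    refine lintegral_congr fun y => ?_
    rw [← hind]
    by_cases hy : y ∈ Set.univ.pi s
    · simp [hy]
    · simp [hy]
  rw [h1, integral_fintype_prod_eq_prod (fun i => (s i).indicator (ρ i)),
    ENNReal.ofReal_prod_of_nonneg fun i _ =>
      integral_nonneg fun y => Set.indicator_nonneg (fun y _ => h0 i y) _]
  refine Finset.prod_congr rfl fun i _ => ?_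
  rw [withDensity_apply _ (hs i), integral_indicator (hs i),
    ofReal_integral_eq_lintegral_ofReal (hi i).integrableOn
      (Filter.Eventually.of_forall fun y => h0 i y)]

namespace SymLLR

lemma integrable_exp (h : SymLLR ν Λ ι) : Integrable (fun y => Real.exp (-Λ y)) ν := by
  have := h.prob
  refine ⟨(h.meas_llr.neg.exp).aestronglyMeasurable, ?_⟩
  rw [hasFiniteIntegral_iff_ofReal (Filter.Eventually.of_forall fun y => (Real.exp_pos _).le)]
  have h1 : (ν.map ι) Set.univ = 1 := by
    rw [Measure.map_apply h.meas_flip MeasurableSet.univ]; simp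
  rw [h.map_eq, withDensity_apply _ MeasurableSet.univ, Measure.restrict_univ] at h1
  rw [h1]; exact ENNReal.one_lt_top

lemma measurable_flipOn (h : SymLLR ν Λ ι) (S : Finset (Fin N)) : Measurable (flipOn ι S) := by
  refine measurable_pi_lambda _ fun i => ?_
  unfold flipOn
  by_cases hi : i ∈ S
  · simp only [hi, if_true]; exact h.meas_flip.comp (measurable_pi_apply i)
  · simp only [hi, if_false]; exact measurable_pi_apply i

lemma measurable_llrSum (h : SymLLR ν Λ ι) (S : Finset (Fin N)) : Measurable (llrSum Λ S) :=
  Finset.measurable_fun_sum _ fun i _ => h.meas_llr.comp (measurable_pi_apply i)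

/-- The word with ones on `S` leads to the output law with likelihood ratio `exp (-llrSum Λ S)`. -/
lemma map_flipOn (h : SymLLR ν Λ ι) (S : Finset (Fin N)) :
    (zeroLaw ν N).map (flipOn ι S)
      = (zeroLaw ν N).withDensity fun y => ENNReal.ofReal (Real.exp (-llrSum Λ S y)) := by
  have := h.prob
  have h1 : flipOn ι S = fun (y : Fin N → Y) i => (if i ∈ S then ι else id) (y i) := by
    ext y i; unfold flipOn; split_ifs <;> rfl
  have hm : ∀ i : Fin N, Measurable (if i ∈ S then ι else id) := fun i => by
    split_ifs
    · exact h.meas_flip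
    · exact measurable_id
  have : ∀ i : Fin N, IsProbabilityMeasure (ν.map (if i ∈ S then ι else id)) := fun i =>
    Measure.isProbabilityMeasure_map (hm i).aemeasurable
  rw [h1, Measure.pi_map_pi fun i => (hm i).aemeasurable]
  have h2 : ∀ i : Fin N, ν.map (if i ∈ S then ι else id)
      = ν.withDensity fun y => ENNReal.ofReal (if i ∈ S then Real.exp (-Λ y) else 1) := by
    intro i
    by_cases hi : i ∈ S
    · simp only [hi, if_true]; exact h.map_eq
    · simp [hi]
  simp only [h2]
  rw [pi_withDensity_ofReal]
  · congr 1
    ext y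
    rw [Finset.prod_ite_mem, Finset.univ_inter, llrSum, ← Finset.sum_neg_distrib, Real.exp_sum]
  · intro i y
    split_ifs <;> positivity
  · intro i
    by_cases hi : i ∈ S
    · simp only [hi, if_true]; exact h.integrable_exp
    · simp [hi]

lemma integrable_exp_llrSum (h : SymLLR ν Λ ι) (S : Finset (Fin N)) :
    Integrable (fun y => Real.exp (-llrSum Λ S y)) (zeroLaw ν N) := by
  have := h.prob
  refine ⟨((h.measurable_llrSum S).neg.exp).aestronglyMeasurable, ?_⟩
  rw [hasFiniteIntegral_iff_ofReal (Filter.Eventually.of_forall fun y => (Real.exp_pos _).le)]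
  have h1 : ((zeroLaw ν N).map (flipOn ι S)) Set.univ = 1 := by
    rw [Measure.map_apply (h.measurable_flipOn S) MeasurableSet.univ]; simp
  rw [h.map_flipOn, withDensity_apply _ MeasurableSet.univ, Measure.restrict_univ] at h1
  rw [h1]; exact ENNReal.one_lt_top

/-- Change of measure: flipping the outputs on `S`. -/
lemma integral_flipOn (h : SymLLR ν Λ ι) (S : Finset (Fin N)) {F : (Fin N → Y) → ℝ}
    (hF : Measurable F) :
    ∫ y, F (flipOn ι S y) ∂(zeroLaw ν N) = ∫ y, F y * Real.exp (-llrSum Λ S y) ∂(zeroLaw ν N) := by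
  rw [← integral_map (h.measurable_flipOn S).aemeasurable hF.aestronglyMeasurable, h.map_flipOn,
    integral_withDensity_eq_integral_toReal_smul
      (show Measurable fun y => ENNReal.ofReal (Real.exp (-llrSum Λ S y)) from
        ENNReal.measurable_ofReal.comp (h.measurable_llrSum S).neg.exp)
      (Filter.Eventually.of_forall fun _ => ENNReal.ofReal_lt_top)]
  refine integral_congr_ae (Filter.Eventually.of_forall fun y => ?_)
  simp only [smul_eq_mul]
  rw [ENNReal.toReal_ofReal (Real.exp_pos _).le, mul_comm]

lemma llrSum_flipOn (h : SymLLR ν Λ ι) (S : Finset (Fin N)) (y : Fin N → Y) :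
    llrSum Λ S (flipOn ι S y) = -llrSum Λ S y := by
  rw [llrSum, llrSum, ← Finset.sum_neg_distrib]
  refine Finset.sum_congr rfl fun i hi => ?_
  rw [flipOn, if_pos hi, h.odd]

/-- A bounded function is integrable, also against a likelihood ratio. -/
lemma integrable_mul_exp (h : SymLLR ν Λ ι) (S : Finset (Fin N)) {F : (Fin N → Y) → ℝ}
    (hF : Measurable F) {C : ℝ} (hC : ∀ y, |F y| ≤ C) :
    Integrable (fun y => F y * Real.exp (-llrSum Λ S y)) (zeroLaw ν N) :=
  (h.integrable_exp_llrSum S).bdd_mul hF.aestronglyMeasurable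
    (Filter.Eventually.of_forall hC)

lemma integrable_bdd (h : SymLLR ν Λ ι) {F : (Fin N → Y) → ℝ}
    (hF : Measurable F) {C : ℝ} (hC : ∀ y, |F y| ≤ C) : Integrable F (zeroLaw ν N) := by
  have := h.prob
  exact Integrable.of_bound hF.aestronglyMeasurable C (Filter.Eventually.of_forall hC)

/-- The error probability of the optimal decision between the words `0` and the indicator of `S`,
where ties are broken by a fair coin. -/
noncomputable def _root_.LDPC.pairError (ν : Measure Y) (Λ : Y → ℝ) (S : Finset (Fin N)) : ℝ :=
  ∫ y, half (llrSum Λ S y) ∂(zeroLaw ν N)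

/-- Each decision rule that is equivariant under the flip of `S` errs at least as often as the
optimal decision between two words that differ on `S`. -/
lemma pairError_le (h : SymLLR ν Λ ι) (S : Finset (Fin N)) {f : (Fin N → Y) → ℝ}
    (hf : Measurable f) (h0 : ∀ y, 0 ≤ f y) (h1 : ∀ y, f y ≤ 1)
    (hfS : ∀ y, f (flipOn ι S y) = 1 - f y) :
    pairError ν Λ S ≤ ∫ y, f y ∂(zeroLaw ν N) := by
  have hm : Measurable fun y => half (llrSum Λ S y) :=
    measurable_half.comp (h.measurable_llrSum S)
  have hif := h.integrable_bdd hf (C := 1) fun y => abs_le.2 ⟨by linarith [h0 y], h1 y⟩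
  have hih := h.integrable_bdd hm (C := 1) fun y =>
    abs_le.2 ⟨by linarith [half_nonneg (llrSum Λ S y)], half_le_one _⟩
  have hmd : Measurable fun y => f y - half (llrSum Λ S y) := hf.sub hm
  have hbd : ∀ y, |f y - half (llrSum Λ S y)| ≤ 1 := fun y => abs_le.2
    ⟨by linarith [h0 y, half_le_one (llrSum Λ S y)],
      by linarith [h1 y, half_nonneg (llrSum Λ S y)]⟩
  have key := h.integral_flipOn S hmd
  have h2 : ∀ y, f (flipOn ι S y) - half (llrSum Λ S (flipOn ι S y))
      = -(f y - half (llrSum Λ S y)) := fun y => by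
    rw [hfS, h.llrSum_flipOn, half_neg]; ring
  simp only [h2] at key
  rw [integral_neg] at key
  have h3 : 0 ≤ ∫ y, ((f y - half (llrSum Λ S y))
      - (f y - half (llrSum Λ S y)) * Real.exp (-llrSum Λ S y)) ∂(zeroLaw ν N) := by
    refine integral_nonneg fun y => ?_
    have hfac : (f y - half (llrSum Λ S y)) - (f y - half (llrSum Λ S y)) *
        Real.exp (-llrSum Λ S y)
        = (f y - half (llrSum Λ S y)) * (1 - Real.exp (-llrSum Λ S y)) := by ring
    simp only [Pi.zero_apply]
    rw [hfac]
    rcases lt_trichotomy (llrSum Λ S y) 0 with hl | hl | hl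
    · have : half (llrSum Λ S y) = 1 := if_pos hl
      rw [this]
      have := Real.one_le_exp (x := -llrSum Λ S y) (by linarith)
      nlinarith [h1 y]
    · simp [hl]
    · have : half (llrSum Λ S y) = 0 := by
        unfold half; rw [if_neg (by linarith), if_neg (by linarith)]
      rw [this]
      have := Real.exp_le_one_iff.2 (show -llrSum Λ S y ≤ 0 by linarith)
      nlinarith [h0 y]
  rw [integral_sub (h.integrable_bdd hmd hbd) (h.integrable_mul_exp S hmd hbd), ← key,
    integral_sub hif hih] at h3
  rw [pairError]
  linarith

lemma integral_min_one (h : SymLLR ν Λ ι) (S : Finset (Fin N)) :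
    ∫ y, min 1 (Real.exp (-llrSum Λ S y)) ∂(zeroLaw ν N) = 2 * pairError ν Λ S := by
  have hm : Measurable fun y => half (llrSum Λ S y) :=
    measurable_half.comp (h.measurable_llrSum S)
  have hb : ∀ y, |half (llrSum Λ S y)| ≤ 1 := fun y =>
    abs_le.2 ⟨by linarith [half_nonneg (llrSum Λ S y)], half_le_one _⟩
  have hb' : ∀ y, |1 - half (llrSum Λ S y)| ≤ 1 := fun y =>
    abs_le.2 ⟨by linarith [half_le_one (llrSum Λ S y)], by linarith [half_nonneg (llrSum Λ S y)]⟩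
  have hm' : Measurable fun y => 1 - half (llrSum Λ S y) := measurable_const.sub hm
  have key := h.integral_flipOn S hm'
  have h2 : ∀ y, 1 - half (llrSum Λ S (flipOn ι S y)) = half (llrSum Λ S y) := fun y => by
    rw [h.llrSum_flipOn, half_neg]; ring
  simp only [h2] at key
  have h3 : ∀ y, min 1 (Real.exp (-llrSum Λ S y)) = half (llrSum Λ S y) +
      (1 - half (llrSum Λ S y)) * Real.exp (-llrSum Λ S y) := by
    intro y
    rcases lt_trichotomy (llrSum Λ S y) 0 with hl | hl | hl
    · have : half (llrSum Λ S y) = 1 := if_pos hl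
      rw [this, min_eq_left (Real.one_le_exp (by linarith))]; ring
    · rw [hl]; norm_num [half]
    · have : half (llrSum Λ S y) = 0 := by
        unfold half; rw [if_neg (by linarith), if_neg (by linarith)]
      rw [this, min_eq_right (Real.exp_le_one_iff.2 (by linarith))]; ring
  simp only [h3]
  rw [integral_add (h.integrable_bdd hm hb) (h.integrable_mul_exp S hm' hb'), ← key, pairError]
  ring

end SymLLR
end

open MeasureTheory ProbabilityTheory

/-- `F` depends only on the coordinates in `A`. -/
def SupportedOn {Y β : Type} {N : ℕ} (F : (Fin N → Y) → β) (A : Finset (Fin N)) : Prop :=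
  ∀ y y', (∀ i ∈ A, y i = y' i) → F y = F y'

lemma SupportedOn.mono {Y β : Type} {N : ℕ} {F : (Fin N → Y) → β} {A B : Finset (Fin N)}
    (hF : SupportedOn F A) (hAB : A ⊆ B) : SupportedOn F B :=
  fun y y' h => hF y y' fun i hi => h i (hAB hi)

lemma supportedOn_llrSum {Y : Type} {N : ℕ} (Λ : Y → ℝ) (S : Finset (Fin N)) :
    SupportedOn (llrSum Λ S) S := fun y y' h =>
  Finset.sum_congr rfl fun i hi => by rw [h i hi]

lemma flipOn_flipOn {Y : Type} {N : ℕ} {ι : Y → Y} (hι : ∀ y, ι (ι y) = y)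
    (S T : Finset (Fin N)) (y : Fin N → Y) :
    flipOn ι S (flipOn ι T y) = flipOn ι (symmDiff S T) y := by
  ext i
  simp only [flipOn, Finset.mem_symmDiff]
  by_cases h1 : i ∈ S <;> by_cases h2 : i ∈ T <;> simp [h1, h2, hι]

section
variable {Y : Type} [MeasurableSpace Y] {ν : Measure Y} {Λ : Y → ℝ} {ι : Y → Y} {N : ℕ}

/-- Functions of disjoint sets of coordinates are independent. -/
lemma indepFun_of_supportedOn [IsProbabilityMeasure ν] {F G : (Fin N → Y) → ℝ}
    (hF : Measurable F) (hG : Measurable G) {A B : Finset (Fin N)} (hAB : Disjoint A B)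
    (hFA : SupportedOn F A) (hGB : SupportedOn G B) : IndepFun F G (zeroLaw ν N) := by
  classical
  obtain ⟨y0⟩ : Nonempty Y := nonempty_of_isProbabilityMeasure ν
  have hind : iIndepFun (fun (i : Fin N) (y : Fin N → Y) => y i) (zeroLaw ν N) :=
    iIndepFun_pi (X := fun _ => id) fun _ => aemeasurable_id
  have h1 := hind.indepFun_finset A B hAB fun i => measurable_pi_apply i
  have key : ∀ (E : (Fin N → Y) → ℝ) (C : Finset (Fin N)), Measurable E → SupportedOn E C →
      ∃ φ : (C → Y) → ℝ, Measurable φ ∧ E = φ ∘ fun y (i : C) => y i := by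
    intro E C hE hEC
    refine ⟨fun z => E fun i => if h : i ∈ C then z ⟨i, h⟩ else y0, ?_, ?_⟩
    · refine hE.comp (measurable_pi_lambda _ fun i => ?_)
      by_cases h : i ∈ C
      · simp only [h, dif_pos]; exact measurable_pi_apply _
      · simp only [h, dif_neg, not_false_iff]; exact measurable_const
    · ext y
      exact hEC _ _ fun i hi => by simp [hi]
  obtain ⟨φ, hφ, rfl⟩ := key F A hF hFA
  obtain ⟨ψ, hψ, rfl⟩ := key G B hG hGB
  exact h1.comp hφ hψ

lemma integral_mul_of_supportedOn [IsProbabilityMeasure ν] {F G : (Fin N → Y) → ℝ}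
    (hF : Measurable F) (hG : Measurable G) {A B : Finset (Fin N)} (hAB : Disjoint A B)
    (hFA : SupportedOn F A) (hGB : SupportedOn G B) :
    ∫ y, F y * G y ∂(zeroLaw ν N) = (∫ y, F y ∂(zeroLaw ν N)) * ∫ y, G y ∂(zeroLaw ν N) :=
  (indepFun_of_supportedOn hF hG hAB hFA hGB).integral_fun_mul_eq_mul_integral
    hF.aestronglyMeasurable hG.aestronglyMeasurable

lemma llrSum_insert {Y : Type} {N : ℕ} (Λ : Y → ℝ) {D : Finset (Fin N)} {b : Fin N} (hb : b ∉ D)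
    (y : Fin N → Y) : llrSum Λ (insert b D) y = llrSum Λ {b} y + llrSum Λ D y := by
  simp [llrSum, Finset.sum_insert hb]

namespace SymLLR

lemma integral_exp_llrSum (h : SymLLR ν Λ ι) (S : Finset (Fin N)) :
    ∫ y, Real.exp (-llrSum Λ S y) ∂(zeroLaw ν N) = 1 := by
  have := h.prob
  have := h.integral_flipOn S (F := fun _ => 1) measurable_const
  simpa using this.symm

end SymLLR

/-- The pointwise inequality behind `SymLLR.gain`. On the right, `t` chooses between the pairs
`{1, α * γ}` and `{δ * α, δ * γ}` of likelihoods. On the left, each product separates a function of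
`γ` from a function of `α` and `δ`, which are independent. -/
lemma min_add_mul_ge {α γ δ : ℝ} (hα : 0 < α) (hγ : 0 < γ) {t : ℝ} (ht0 : 0 ≤ t)
    (ht1 : t ≤ 1) :
    min 1 γ * ((1 + α) * min 1 δ) + (1 - min 1 γ) * min 1 (δ * α) + (γ - min 1 γ) * min α δ
      ≤ t * (1 + α * γ) + (1 - t) * (δ * α + δ * γ) := by
  have h1 : min 1 δ ≤ 1 := min_le_left _ _
  have h2 : min 1 δ ≤ δ := min_le_right _ _
  have h3 : min 1 (δ * α) ≤ 1 := min_le_left _ _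
  have h4 : min 1 (δ * α) ≤ δ * α := min_le_right _ _
  have h5 : min α δ ≤ α := min_le_left _ _
  have h6 : min α δ ≤ δ := min_le_right _ _
  have hμ0 : 0 ≤ min 1 γ := le_min zero_le_one hγ.le
  have hμ1 : 0 ≤ 1 - min 1 γ := by linarith [min_le_left 1 γ]
  have hμ2 : 0 ≤ γ - min 1 γ := by linarith [min_le_right 1 γ]
  have e1 : min 1 γ * (1 + α) + (1 - min 1 γ) + (γ - min 1 γ) * α = 1 + α * γ := by ring
  have e2 : min 1 γ * ((1 + α) * δ) + (1 - min 1 γ) * (δ * α) + (γ - min 1 γ) * δ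
      = δ * α + δ * γ := by ring
  have A : min 1 γ * ((1 + α) * min 1 δ) + (1 - min 1 γ) * min 1 (δ * α)
      + (γ - min 1 γ) * min α δ ≤ 1 + α * γ := by
    rw [← e1]
    gcongr
    · nlinarith
    · nlinarith
  have B : min 1 γ * ((1 + α) * min 1 δ) + (1 - min 1 γ) * min 1 (δ * α)
      + (γ - min 1 γ) * min α δ ≤ δ * α + δ * γ := by
    rw [← e2]
    gcongr
  nlinarith

/-- If the error indicator `f` is also invariant under the flip of a pair `{b, c}` with `b ∈ S` and
`c ∉ S`, then `f` decides between four words, and the bound `pairError S` can be improved: with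
probability `2 * pairError {c}` the position `b` carries no information. -/
lemma SymLLR.gain (h : SymLLR ν Λ ι) {D : Finset (Fin N)} {b c : Fin N} (hb : b ∉ D) (hc : c ∉ D)
    (hbc : c ≠ b) {f : (Fin N → Y) → ℝ}
    (hf : Measurable f) (h0 : ∀ y, 0 ≤ f y) (h1 : ∀ y, f y ≤ 1)
    (hfS : ∀ y, f (flipOn ι (insert b D) y) = 1 - f y)
    (hfb : ∀ y, f (flipOn ι {b, c} y) = f y) :
    2 * pairError ν Λ {c} * pairError ν Λ D + (1 - 2 * pairError ν Λ {c}) *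
      pairError ν Λ (insert b D) ≤ ∫ y, f y ∂(zeroLaw ν N) := by
  have hpr := h.prob
  have hfc : ∀ y, f (flipOn ι (insert c D) y) = 1 - f y := by
    intro y
    have e : insert c D = symmDiff (insert b D) {b, c} := by
      ext i
      simp only [Finset.mem_symmDiff, Finset.mem_insert, Finset.mem_singleton]
      by_cases i1 : i = b
      · subst i1; simp [hb, hbc.symm]
      · by_cases i2 : i = c
        · subst i2; simp [hc, hbc]
        · simp [i1, i2]
    rw [e, ← flipOn_flipOn h.invol, hfS, hfb]
  set α : (Fin N → Y) → ℝ := fun y => Real.exp (-llrSum Λ {b} y) with hα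
  set γ : (Fin N → Y) → ℝ := fun y => Real.exp (-llrSum Λ {c} y) with hγ
  set δ : (Fin N → Y) → ℝ := fun y => Real.exp (-llrSum Λ D y) with hδ
  have mα : Measurable α := (h.measurable_llrSum _).neg.exp
  have mγ : Measurable γ := (h.measurable_llrSum _).neg.exp
  have mδ : Measurable δ := (h.measurable_llrSum _).neg.exp
  have pα : ∀ y, 0 < α y := fun y => Real.exp_pos _
  have pγ : ∀ y, 0 < γ y := fun y => Real.exp_pos _
  have pδ : ∀ y, 0 < δ y := fun y => Real.exp_pos _
  have sα : SupportedOn α {b} := fun y y' e => by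
    simp only [hα]; rw [supportedOn_llrSum Λ {b} y y' e]
  have sγ : SupportedOn γ {c} := fun y y' e => by
    simp only [hγ]; rw [supportedOn_llrSum Λ {c} y y' e]
  have sδ : SupportedOn δ D := fun y y' e => by
    simp only [hδ]; rw [supportedOn_llrSum Λ D y y' e]
  have sα' : SupportedOn α (insert b D) := sα.mono (by simp)
  have sδ' : SupportedOn δ (insert b D) := sδ.mono (by simp)
  have hdis : Disjoint ({c} : Finset (Fin N)) (insert b D) := by simp [hc, hbc]
  have eS : ∀ y, Real.exp (-llrSum Λ (insert b D) y) = δ y * α y := fun y => by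
    simp only [hα, hδ]; rw [llrSum_insert Λ hb, ← Real.exp_add]; ring_nf
  have eC : ∀ y, Real.exp (-llrSum Λ (insert c D) y) = δ y * γ y := fun y => by
    simp only [hγ, hδ]; rw [llrSum_insert Λ hc, ← Real.exp_add]; ring_nf
  have eP : ∀ y, Real.exp (-llrSum Λ {b, c} y) = α y * γ y := fun y => by
    simp only [hα, hγ]
    rw [llrSum_insert Λ (show b ∉ ({c} : Finset (Fin N)) by simpa using hbc.symm), ← Real.exp_add]
    ring_nf
  have mf' : Measurable fun y => 1 - f y := measurable_const.sub hf
  have bf : ∀ y, |f y| ≤ 1 := fun y => abs_le.2 ⟨by linarith [h0 y], h1 y⟩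
  have bf' : ∀ y, |1 - f y| ≤ 1 := fun y => abs_le.2 ⟨by linarith [h1 y], by linarith [h0 y]⟩
  -- four expressions of the error probability
  have i1 := h.integral_flipOn (insert b D) mf'
  have i2 := h.integral_flipOn (insert c D) mf'
  have i3 := h.integral_flipOn {b, c} hf
  have j0 := h.integrable_bdd hf bf
  have j1 := h.integrable_mul_exp (insert b D) mf' bf'
  have j2 := h.integrable_mul_exp (insert c D) mf' bf'
  have j3 := h.integrable_mul_exp {b, c} hf bf
  simp only [hfS, hfc, hfb, sub_sub_cancel, eS, eC, eP] at i1 i2 i3 j1 j2 j3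
  have four : 4 * ∫ y, f y ∂(zeroLaw ν N) = ∫ y, (f y * (1 + α y * γ y)
      + (1 - f y) * (δ y * α y + δ y * γ y)) ∂(zeroLaw ν N) := by
    have : ∀ y, f y * (1 + α y * γ y) + (1 - f y) * (δ y * α y + δ y * γ y)
        = f y + f y * (α y * γ y) + (1 - f y) * (δ y * α y) + (1 - f y) * (δ y * γ y) :=
      fun y => by ring
    simp only [this]
    have k1 := integral_add ((j0.add j3).add j1) j2
    have k2 := integral_add (j0.add j3) j1
    have k3 := integral_add j0 j3
    simp only [Pi.add_apply] at k1 k2 k3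
    rw [k1, k2, k3, ← i1, ← i2, ← i3]
    ring
  -- the one-sided bounds
  have mμ : Measurable fun y => min 1 (γ y) := measurable_const.min mγ
  have m1 : Measurable fun y => min 1 (δ y) := measurable_const.min mδ
  have m2 : Measurable fun y => min 1 (δ y * α y) := measurable_const.min (mδ.mul mα)
  have m3 : Measurable fun y => min (α y) (δ y) := mα.min mδ
  have bmin : ∀ x : ℝ, 0 < x → |min 1 x| ≤ 1 := fun x hx =>
    abs_le.2 ⟨by linarith [le_min zero_le_one hx.le], min_le_left _ _⟩
  have Iμ : ∫ y, min 1 (γ y) ∂(zeroLaw ν N) = 2 * pairError ν Λ {c} := h.integral_min_one {c}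
  have Iδ : ∫ y, min 1 (δ y) ∂(zeroLaw ν N) = 2 * pairError ν Λ D := h.integral_min_one D
  have IS : ∫ y, min 1 (δ y * α y) ∂(zeroLaw ν N) = 2 * pairError ν Λ (insert b D) := by
    rw [← h.integral_min_one (insert b D)]; simp only [eS]
  have Iγ : ∫ y, γ y ∂(zeroLaw ν N) = 1 := h.integral_exp_llrSum {c}
  have hDb : Disjoint D {b} := by simpa using hb
  have fδ : ∀ y, δ (flipOn ι {b} y) = δ y := fun y => by
    simp only [hδ]; rw [llrSum_flipOn_of_disjoint hDb]
  have fα : ∀ y, α (flipOn ι {b} y) = (α y)⁻¹ := fun y => by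
    simp only [hα]; rw [h.llrSum_flipOn, Real.exp_neg]
  have Iαδ : ∫ y, min 1 (δ y) * α y ∂(zeroLaw ν N) = 2 * pairError ν Λ D := by
    rw [← Iδ, ← h.integral_flipOn {b} m1]; simp only [fδ]
  have jαδ : Integrable (fun y => min 1 (δ y) * α y) (zeroLaw ν N) :=
    h.integrable_mul_exp {b} m1 fun y => bmin _ (pδ y)
  have m4 : Measurable fun y => min 1 (δ y * (α y)⁻¹) := measurable_const.min (mδ.mul mα.inv)
  have e4 : ∀ y, min 1 (δ y * (α y)⁻¹) * α y = min (α y) (δ y) := fun y => by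
    rw [min_mul_of_nonneg _ _ (pα y).le, one_mul, mul_assoc, inv_mul_cancel₀ (pα y).ne', mul_one]
  have I3 : ∫ y, min (α y) (δ y) ∂(zeroLaw ν N) = 2 * pairError ν Λ (insert b D) := by
    have := h.integral_flipOn {b} m4
    simp only [fδ, fα, inv_inv] at this
    rw [IS] at this
    rw [this]
    exact (integral_congr_ae (Filter.Eventually.of_forall fun y => e4 y)).symm
  have j3' : Integrable (fun y => min (α y) (δ y)) (zeroLaw ν N) := by
    have := h.integrable_mul_exp {b} m4 fun y => bmin _ (mul_pos (pδ y) (inv_pos.2 (pα y)))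
    exact this.congr (Filter.Eventually.of_forall e4)
  have jγ : Integrable γ (zeroLaw ν N) := h.integrable_exp_llrSum {c}
  have jμ := h.integrable_bdd mμ fun y => bmin _ (pγ y)
  have j1' := h.integrable_bdd m1 fun y => bmin _ (pδ y)
  have j2' := h.integrable_bdd m2 fun y => bmin _ (mul_pos (pδ y) (pα y))
  -- the three products of independent factors
  have sμ : SupportedOn (fun y => min 1 (γ y)) {c} := fun y y' e => by
    simp only; rw [sγ y y' e]
  have s1 : SupportedOn (fun y => (1 + α y) * min 1 (δ y)) (insert b D) := fun y y' e => by
    simp only; rw [sα' y y' e, sδ' y y' e]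
  have s2 : SupportedOn (fun y => min 1 (δ y * α y)) (insert b D) := fun y y' e => by
    simp only; rw [sα' y y' e, sδ' y y' e]
  have s3 : SupportedOn (fun y => min (α y) (δ y)) (insert b D) := fun y y' e => by
    simp only; rw [sα' y y' e, sδ' y y' e]
  have M1 : Measurable fun y => (1 + α y) * min 1 (δ y) := (measurable_const.add mα).mul m1
  have e1 : ∀ y, (1 + α y) * min 1 (δ y) = min 1 (δ y) + min 1 (δ y) * α y := fun y => by ring
  have J1 : Integrable (fun y => (1 + α y) * min 1 (δ y)) (zeroLaw ν N) := by
    simp only [e1]; exact j1'.add jαδ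
  have N2 : Measurable fun y => 1 - min 1 (γ y) := measurable_const.sub mμ
  have N3 : Measurable fun y => γ y - min 1 (γ y) := mγ.sub mμ
  have t2 : SupportedOn (fun y => 1 - min 1 (γ y)) {c} := fun y y' e => by
    simp only; rw [sγ y y' e]
  have t3 : SupportedOn (fun y => γ y - min 1 (γ y)) {c} := fun y y' e => by
    simp only; rw [sγ y y' e]
  have p1 := integral_mul_of_supportedOn (ν := ν) mμ M1 hdis sμ s1
  have p2 := integral_mul_of_supportedOn (ν := ν) N2 m2 hdis t2 s2
  have p3 := integral_mul_of_supportedOn (ν := ν) N3 m3 hdis t3 s3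
  have q1 := (indepFun_of_supportedOn (ν := ν) mμ M1 hdis sμ s1).integrable_mul jμ J1
  have q2 := (indepFun_of_supportedOn (ν := ν) N2 m2 hdis t2 s2).integrable_mul
    ((integrable_const 1).sub jμ) j2'
  have q3 := (indepFun_of_supportedOn (ν := ν) N3 m3 hdis t3 s3).integrable_mul (jγ.sub jμ) j3'
  rw [Iμ] at p1
  rw [integral_sub (integrable_const 1) jμ, Iμ, IS] at p2
  rw [integral_sub jγ jμ, Iμ, Iγ, I3] at p3
  simp only [integral_const, probReal_univ, smul_eq_mul, mul_one] at p2
  have v1 : ∫ y, (1 + α y) * min 1 (δ y) ∂(zeroLaw ν N) = 4 * pairError ν Λ D := by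
    simp only [e1]; rw [integral_add j1' jαδ, Iδ, Iαδ]; ring
  rw [v1] at p1
  have le : ∫ y, (min 1 (γ y) * ((1 + α y) * min 1 (δ y)) + (1 - min 1 (γ y)) *
      min 1 (δ y * α y) + (γ y - min 1 (γ y)) * min (α y) (δ y)) ∂(zeroLaw ν N)
      ≤ 4 * ∫ y, f y ∂(zeroLaw ν N) := by
    rw [four]
    refine integral_mono ((q1.add q2).add q3) ?_ fun y =>
      min_add_mul_ge (pα y) (pγ y) (h0 y) (h1 y)
    have : ∀ y, f y * (1 + α y * γ y) + (1 - f y) * (δ y * α y + δ y * γ y)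
        = f y + f y * (α y * γ y) + (1 - f y) * (δ y * α y) + (1 - f y) * (δ y * γ y) :=
      fun y => by ring
    simp only [this]
    exact ((j0.add j3).add j1).add j2
  have sum : ∫ y, (min 1 (γ y) * ((1 + α y) * min 1 (δ y)) + (1 - min 1 (γ y)) *
      min 1 (δ y * α y) + (γ y - min 1 (γ y)) * min (α y) (δ y)) ∂(zeroLaw ν N)
      = 2 * pairError ν Λ {c} * (4 * pairError ν Λ D)
        + (1 - 2 * pairError ν Λ {c}) * (2 * pairError ν Λ (insert b D))
        + (1 - 2 * pairError ν Λ {c}) * (2 * pairError ν Λ (insert b D)) := by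
    have a1 := integral_add (q1.add q2) q3
    have a2 := integral_add q1 q2
    simp only [Pi.add_apply, Pi.mul_apply] at a1 a2
    rw [a1, a2, p1, p2, p3]
  rw [sum] at le
  linarith

end

/-! ### From equivariant decision rules to the bit error rate -/

open MeasureTheory ProbabilityTheory

lemma zero_mem_code {M N : ℕ} (H : Matrix (Fin M) (Fin N) (ZMod 2)) : 0 ∈ code H := by
  simp [code]

/-- Bounds for the single bits and codewords, averaged. -/
lemma le_averageBER {Y : Type} [MeasurableSpace Y] (W : Channel Y) {τ : ℝ} {l N M J K : ℕ}
    (hN : 0 < N) (hne : (sockets N M J K).Nonempty) {B : ℝ}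
    (X : (Fin M × Fin K → Fin N) → Fin N → ℝ)
    (hX : ∀ g ∈ sockets N M J K, ∀ s ∈ code (matOf g), ∀ v,
      X g v ≤ bitError W τ l (matOf g) s v)
    (hB : ∀ v, B * (sockets N M J K).card ≤ ∑ g ∈ sockets N M J K, X g v) :
    B ≤ averageBER W τ l N M J K := by
  have hN' : (0 : ℝ) < N := by exact_mod_cast hN
  have hc : (0 : ℝ) < (sockets N M J K).card := by exact_mod_cast hne.card_pos
  rw [averageBER, average_eq, le_div_iff₀ hc]
  have h1 : ∀ g ∈ sockets N M J K, (∑ v, X g v) / N ≤ ber W τ l (matOf g) := by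
    intro g hg
    have hcode : (0 : ℝ) < (code (matOf g)).card := by
      exact_mod_cast Finset.card_pos.2 ⟨0, zero_mem_code _⟩
    rw [ber, le_div_iff₀ hcode, mul_comm, ← nsmul_eq_mul]
    refine Finset.card_nsmul_le_sum _ _ _ fun s hs => ?_
    gcongr
    exact hX g hg s hs _
  refine le_trans ?_ (Finset.sum_le_sum h1)
  rw [← Finset.sum_div, le_div_iff₀ hN', Finset.sum_comm]
  calc B * (sockets N M J K).card * N
      = ∑ _v : Fin N, B * (sockets N M J K).card := by simp [mul_comm]
    _ ≤ _ := Finset.sum_le_sum fun v _ => hB v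

/-- A word that satisfies all check nodes gives a sign change that satisfies all check nodes. -/
lemma prod_signOf_code {M K N J : ℕ} {g : Fin M × Fin K → Fin N} (hg : IsSocket J g)
    {s : Fin N → ZMod 2} (hs : s ∈ code (matOf g)) (c : Fin M) :
    ∏ i, signOf (Finset.univ.filter fun u => s u = 1) (g (c, i)) = 1 := by
  have h1 : ∀ u, signOf (Finset.univ.filter fun u => s u = 1) u = (-1 : ℝ) ^ (s u).val := by
    intro u
    unfold signOf
    have : ∀ x : ZMod 2, x = 1 ∨ x = 0 := by decide
    rcases this (s u) with h | h
    · simp [h, ZMod.val_one]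
    · simp [h]
  simp only [h1]
  rw [Finset.prod_pow_eq_pow_sum]
  refine Even.neg_one_pow ?_
  rw [← ZMod.natCast_eq_zero_iff_even, Nat.cast_sum]
  simp only [ZMod.natCast_val, ZMod.cast_id', id]
  simp only [code, Finset.mem_filter, Finset.mem_univ, true_and] at hs
  have h2 := congrFun hs c
  rw [Matrix.mulVec, dotProduct] at h2
  rw [Pi.zero_apply] at h2
  rw [← h2]
  have h3 : ∀ u, matOf g c u * s u = if u ∈ varsOf (matOf g) c then s u else 0 := by
    intro u
    have : ∀ x : ZMod 2, x ≠ 1 → x = 0 := by decide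
    by_cases h : matOf g c u = 1
    · simp [varsOf, h]
    · simp [varsOf, this _ h]
  simp only [h3]
  rw [Finset.sum_ite_mem, Finset.univ_inter, varsOf_matOf,
    Finset.sum_image fun a _ b _ h => hg.1 c h]

lemma measurable_artanh : Measurable Real.artanh := by
  unfold Real.artanh
  exact Real.measurable_log.comp (Real.continuous_sqrt.measurable.comp
    ((measurable_const.add measurable_id).div (measurable_const.sub measurable_id)))

lemma measurable_tanh : Measurable Real.tanh := by
  have : Real.tanh = fun x => Real.sinh x / Real.cosh x := by
    ext x; exact Real.tanh_eq_sinh_div_cosh x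
  rw [this]
  exact Real.measurable_sinh.div Real.measurable_cosh

lemma measurable_chkMsg {M N : ℕ} (H : Matrix (Fin M) (Fin N) (ZMod 2)) (l : ℕ) :
    ∀ c v, Measurable fun L : Fin N → ℝ => chkMsg H L l c v := by
  induction l with
  | zero => intro c v; simp only [chkMsg]; exact measurable_const
  | succ l ih =>
    intro c v
    simp only [chkMsg]
    refine (measurable_artanh.comp ?_).const_mul 2
    refine Finset.measurable_fun_prod _ fun β _ => measurable_tanh.comp ?_
    exact ((measurable_pi_apply β).add (Finset.measurable_fun_sum _ fun α _ => ih α β)).div_const 2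

lemma measurable_bpOut {M N : ℕ} (H : Matrix (Fin M) (Fin N) (ZMod 2)) (l : ℕ) (v : Fin N) :
    Measurable fun L : Fin N → ℝ => bpOut H L l v :=
  (measurable_pi_apply v).add (Finset.measurable_fun_sum _ fun α _ => measurable_chkMsg H l α v)

section
variable {Y : Type} [MeasurableSpace Y] {ν : Measure Y} {Λ : Y → ℝ} {ι : Y → Y} {N M K J : ℕ}
  {g : Fin M × Fin K → Fin N}

/-- The error indicator of the bit `v` when the word `0` is sent. -/
noncomputable def bitFault (Λ : Y → ℝ) (g : Fin M × Fin K → Fin N) (l : ℕ) (v : Fin N)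
    (y : Fin N → Y) : ℝ :=
  half (bpOut (matOf g) (fun i => Λ (y i)) l v)

/-- The error probability of the bit `v` when the word `0` is sent. -/
noncomputable def nodeError (ν : Measure Y) (Λ : Y → ℝ) (g : Fin M × Fin K → Fin N) (l : ℕ)
    (v : Fin N) : ℝ :=
  ∫ y, bitFault Λ g l v y ∂(zeroLaw ν N)

lemma measurable_bpOut_llr (hΛ : Measurable Λ) (l : ℕ) (v : Fin N) :
    Measurable fun y : Fin N → Y => bpOut (matOf g) (fun i => Λ (y i)) l v :=
  (measurable_bpOut _ l v).comp (measurable_pi_lambda _ fun i => hΛ.comp (measurable_pi_apply i))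

lemma measurable_bitFault (hΛ : Measurable Λ) (l : ℕ) (v : Fin N) :
    Measurable (bitFault Λ g l v) :=
  measurable_half.comp (measurable_bpOut_llr hΛ l v)

/-- A sign change on `S` that satisfies the check nodes of the computation tree of `v` changes the
output message of `v` by its sign at `v`. -/
lemma SymLLR.bpOut_flipOn (h : SymLLR ν Λ ι) (hg : IsSocket J g) {l : ℕ} {v : Fin N}
    {S : Finset (Fin N)} (hS : LocalSign g v l (signOf S)) (y : Fin N → Y) :
    bpOut (matOf g) (fun i => Λ (flipOn ι S y i)) l v
      = signOf S v * bpOut (matOf g) (fun i => Λ (y i)) l v := by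
  rw [← bpOut_sign hg (signOf_cases S) hS]
  congr 1
  ext i
  unfold flipOn signOf
  split_ifs
  · rw [h.odd]; ring
  · ring

lemma SymLLR.bitFault_flipOn_of_mem (h : SymLLR ν Λ ι) (hg : IsSocket J g) {l : ℕ} {v : Fin N}
    {S : Finset (Fin N)} (hS : LocalSign g v l (signOf S)) (hv : v ∈ S) (y : Fin N → Y) :
    bitFault Λ g l v (flipOn ι S y) = 1 - bitFault Λ g l v y := by
  rw [bitFault, h.bpOut_flipOn hg hS, signOf, if_pos hv, neg_one_mul, half_neg, bitFault]

lemma SymLLR.bitFault_flipOn_of_notMem (h : SymLLR ν Λ ι) (hg : IsSocket J g) {l : ℕ} {v : Fin N}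
    {S : Finset (Fin N)} (hS : LocalSign g v l (signOf S)) (hv : v ∉ S) (y : Fin N → Y) :
    bitFault Λ g l v (flipOn ι S y) = bitFault Λ g l v y := by
  rw [bitFault, h.bpOut_flipOn hg hS, signOf, if_neg hv, one_mul, bitFault]

/-- The error probability of `v` is at least that of the optimal decision between two words that
differ on `S`, if `S` contains `v` and satisfies the check nodes of the computation tree. -/
lemma SymLLR.pairError_le_nodeError (h : SymLLR ν Λ ι) (hg : IsSocket J g) {l : ℕ} {v : Fin N}
    {S : Finset (Fin N)} (hS : LocalSign g v l (signOf S)) (hv : v ∈ S) :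
    pairError ν Λ S ≤ nodeError ν Λ g l v :=
  h.pairError_le S (measurable_bitFault h.meas_llr l v) (fun _ => half_nonneg _)
    (fun _ => half_le_one _) (h.bitFault_flipOn_of_mem hg hS hv)

/-- `SymLLR.gain` for belief propagation. -/
lemma SymLLR.gain_nodeError (h : SymLLR ν Λ ι) (hg : IsSocket J g) {l : ℕ} {v : Fin N}
    {S : Finset (Fin N)} (hS : LocalSign g v l (signOf S)) (hv : v ∈ S) {b c : Fin N}
    (hbS : b ∈ S) (hcS : c ∉ S) (hbv : b ≠ v) (hbc : LocalSign g v l (signOf {b, c})) :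
    2 * pairError ν Λ {c} * pairError ν Λ (S.erase b) + (1 - 2 * pairError ν Λ {c}) *
      pairError ν Λ S ≤ nodeError ν Λ g l v := by
  have hcb : c ≠ b := fun e => hcS (e ▸ hbS)
  have hvc : v ≠ c := fun e => hcS (e ▸ hv)
  have key := h.gain (D := S.erase b) (b := b) (c := c) (Finset.notMem_erase b S)
    (fun hc => hcS (Finset.mem_of_mem_erase hc)) hcb (f := bitFault Λ g l v)
    (measurable_bitFault h.meas_llr l v) (fun _ => half_nonneg _) (fun _ => half_le_one _)
    (by rw [Finset.insert_erase hbS]; exact h.bitFault_flipOn_of_mem hg hS hv)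
    (h.bitFault_flipOn_of_notMem hg hbc (by simp [hbv.symm, hvc]))
  rwa [Finset.insert_erase hbS] at key

lemma integral_half [IsProbabilityMeasure ν] {B : (Fin N → Y) → ℝ} (hB : Measurable B) :
    ∫ y, half (B y) ∂(zeroLaw ν N) = (zeroLaw ν N).real {y | B y < 0}
      + 1 / 2 * (zeroLaw ν N).real {y | B y = 0} := by
  have m1 : MeasurableSet {y | B y < 0} := hB measurableSet_Iio
  have m2 : MeasurableSet {y | B y = 0} := hB (measurableSet_singleton 0)
  have : ∀ y, half (B y) = Set.indicator {y | B y < 0} (fun _ => (1 : ℝ)) y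
      + 1 / 2 * Set.indicator {y | B y = 0} (fun _ => (1 : ℝ)) y := by
    intro y
    unfold half
    rcases lt_trichotomy (B y) 0 with hl | hl | hl
    · simp [hl, hl.ne]
    · simp [hl]
    · simp [hl.ne', not_lt.2 hl.le]
  simp only [this]
  rw [integral_add ((integrable_const _).indicator m1)
    (((integrable_const _).indicator m2).const_mul _), integral_const_mul,
    integral_indicator_const _ m1, integral_indicator_const _ m2]
  simp

/-- The error probability is the same for all codewords. -/
lemma SymLLR.nodeError_le_bitError (h : SymLLR ν Λ ι) {W : Channel Y} (h0 : W.law 0 = ν)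
    (h1 : W.law 1 = ν.map ι) (hW : ∀ y, W.llr y = (Λ y : EReal)) (hg : IsSocket J g) (hK : 2 ≤ K)
    {τ : ℝ} (hτ : 1 / 2 ≤ τ) (l : ℕ) (v : Fin N) {s : Fin N → ZMod 2} (hs : s ∈ code (matOf g)) :
    nodeError ν Λ g l v ≤ bitError W τ l (matOf g) s v := by
  have hpr := h.prob
  set S := Finset.univ.filter fun u => s u = 1 with hSdef
  have hloc : LocalSign g v l (signOf S) := fun q _ _ _ _ => prod_signOf_code hg hs q.1
  have hB := measurable_bpOut_llr (g := g) h.meas_llr l v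
  have hlaw : W.wordLaw s = (zeroLaw ν N).map (flipOn ι S) := by
    have e1 : flipOn ι S = fun (y : Fin N → Y) i => (if i ∈ S then ι else id) (y i) := by
      ext y i; unfold flipOn; split_ifs <;> rfl
    have hm : ∀ i : Fin N, Measurable (if i ∈ S then ι else id) := fun i => by
      split_ifs
      · exact h.meas_flip
      · exact measurable_id
    have : ∀ i : Fin N, IsProbabilityMeasure (ν.map (if i ∈ S then ι else id)) := fun i =>
      Measure.isProbabilityMeasure_map (hm i).aemeasurable
    rw [e1, Measure.pi_map_pi fun i => (hm i).aemeasurable, Channel.wordLaw]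
    congr 1
    ext1 i
    have : ∀ x : ZMod 2, x = 1 ∨ x = 0 := by decide
    rcases this (s i) with hi | hi
    · simp [hSdef, hi, h1]
    · simp [hSdef, hi, h0]
  have hH : ∀ c, 2 ≤ (varsOf (matOf g) c).card := fun c => by rwa [card_varsOf_matOf hg]
  rw [bitError]
  simp only [hW, bpOutput_coe _ hH]
  have hmS := h.measurable_flipOn S
  have e2 : ∀ A : Set ℝ, MeasurableSet A →
      (W.wordLaw s).real {y | bpOut (matOf g) (fun i => Λ (y i)) l v ∈ A}
        = (zeroLaw ν N).real {y | signOf S v * bpOut (matOf g) (fun i => Λ (y i)) l v ∈ A} := by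
    intro A hA
    have hA' : MeasurableSet {y : Fin N → Y | bpOut (matOf g) (fun i => Λ (y i)) l v ∈ A} := hB hA
    rw [hlaw, measureReal_def, Measure.map_apply hmS hA', measureReal_def]
    congr 2
    ext y
    simp only [Set.mem_preimage, Set.mem_ofPred_eq]
    rw [h.bpOut_flipOn hg hloc]
  have e3 : (W.wordLaw s).real
      {y | ((bpOut (matOf g) (fun i => Λ (y i)) l v : ℝ) : EReal) = 0}
        = (zeroLaw ν N).real {y | bpOut (matOf g) (fun i => Λ (y i)) l v = 0} := by
    have := e2 {0} (measurableSet_singleton 0)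
    simp only [Set.mem_singleton_iff, mul_eq_zero] at this
    have hne : ¬ signOf S v = 0 := by rcases signOf_cases S v with e | e <;> rw [e] <;> norm_num
    simpa only [hne, false_or, EReal.coe_eq_zero] using this
  have e4 : (W.wordLaw s).real
      {y | WrongDecision (s v) ((bpOut (matOf g) (fun i => Λ (y i)) l v : ℝ) : EReal)}
        = (zeroLaw ν N).real {y | bpOut (matOf g) (fun i => Λ (y i)) l v < 0} := by
    have : ∀ x : ZMod 2, x = 1 ∨ x = 0 := by decide
    rcases this (s v) with hi | hi
    · have hS : signOf S v = -1 := by simp [signOf, hSdef, hi]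
      have := e2 (Set.Ioi 0) measurableSet_Ioi
      simp only [hS, Set.mem_Ioi, neg_one_mul, neg_pos] at this
      simpa [WrongDecision, hi] using this
    · have hS : signOf S v = 1 := by simp [signOf, hSdef, hi]
      have := e2 (Set.Iio 0) measurableSet_Iio
      simp only [hS, Set.mem_Iio, one_mul] at this
      simpa [WrongDecision, hi] using this
  rw [e3, e4, nodeError]
  simp only [bitFault]
  rw [integral_half hB]
  gcongr

end

/-! ### The binary symmetric and the Gaussian channel -/

open MeasureTheory ProbabilityTheory

/-- The law of a box. -/
lemma pi_real_forall_mem {Y : Type} [MeasurableSpace Y] {N : ℕ} (μ : Fin N → Measure Y)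
    [∀ i, IsProbabilityMeasure (μ i)] (S : Finset (Fin N)) (A : Set Y) :
    (Measure.pi μ).real {y | ∀ i ∈ S, y i ∈ A} = ∏ i ∈ S, (μ i).real A := by
  have h1 : {y : Fin N → Y | ∀ i ∈ S, y i ∈ A}
      = Set.univ.pi fun i => if i ∈ S then A else Set.univ := by
    ext y
    simp only [Set.mem_ofPred_eq, Set.mem_pi, Set.mem_univ, forall_const]
    refine forall_congr' fun i => ?_
    split_ifs with h <;> simp [h]
  have h2 : ∀ i, (μ i) (if i ∈ S then A else Set.univ) = if i ∈ S then μ i A else 1 := fun i => by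
    split_ifs <;> simp
  rw [measureReal_def, h1, Measure.pi_pi]
  simp only [h2, Finset.prod_ite_mem, Finset.univ_inter]
  rw [ENNReal.toReal_prod]
  rfl

/-- A channel with positive densities and an involution of the outputs that exchanges the inputs. -/
lemma symLLR_of_channel {Y : Type} [MeasurableSpace Y] (W : Channel Y) {Λ : Y → ℝ} {ι : Y → Y}
    (hpr : IsProbabilityMeasure (W.law 0)) (h0 : Measurable (W.density 0))
    (h1 : Measurable (W.density 1)) (hΛ : Measurable Λ) (hodd : ∀ y, Λ (ι y) = -Λ y)
    (hinv : ∀ y, ι (ι y) = y) (hι : MeasurePreserving ι W.ref W.ref)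
    (hd : ∀ y, W.density 1 (ι y) = W.density 0 y)
    (hexp : ∀ y, W.density 1 y = W.density 0 y * ENNReal.ofReal (Real.exp (-Λ y))) :
    SymLLR (W.law 0) Λ ι ∧ W.law 1 = (W.law 0).map ι := by
  have hmap : W.law 1 = (W.law 0).map ι := by
    ext A hA
    rw [Channel.law, Channel.law, Measure.map_apply hι.measurable hA, withDensity_apply _ hA,
      withDensity_apply _ (hι.measurable hA), ← hι.setLIntegral_comp_preimage hA h1]
    simp only [hd]
  refine ⟨⟨hpr, hΛ, hι.measurable, hodd, hinv, ?_⟩, hmap⟩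
  rw [← hmap, Channel.law, Channel.law, ← withDensity_mul _ h0
    (show Measurable fun y => ENNReal.ofReal (Real.exp (-Λ y)) from
      ENNReal.measurable_ofReal.comp hΛ.neg.exp)]
  congr 1
  ext y
  exact hexp y

lemma llr_eq_coe {Y : Type} [MeasurableSpace Y] {W : Channel Y} {y : Y} {r : ℝ}
    (h0 : W.density 0 y ≠ 0) (ht : W.density 0 y ≠ ∞)
    (hexp : W.density 1 y = W.density 0 y * ENNReal.ofReal (Real.exp (-r))) :
    W.llr y = (r : EReal) := by
  have hne : ENNReal.ofReal (Real.exp (-r)) ≠ 0 := by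
    rw [Ne, ENNReal.ofReal_eq_zero, not_le]; exact Real.exp_pos _
  rw [Channel.llr, hexp, ← one_mul (W.density 0 y), mul_comm 1, mul_assoc, one_mul,
    ENNReal.mul_div_mul_left _ _ h0 ht, one_div, ENNReal.log_inv,
    ENNReal.log_ofReal_of_pos (Real.exp_pos _), Real.log_exp]
  simp

/-! #### The binary symmetric channel -/

/-- The log-likelihood ratio of the binary symmetric channel. -/
noncomputable def bscLLR (q : ℝ) (y : ZMod 2) : ℝ :=
  if y = 0 then Real.log ((1 - q) / q) else -Real.log ((1 - q) / q)

lemma bsc_law_real (q : ℝ) (hq0 : 0 ≤ q) (x y : ZMod 2) (hxy : y ≠ x) :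
    ((bsc q).law x).real {y} = q := by
  rw [measureReal_def, Channel.law, withDensity_apply _ (measurableSet_singleton y)]
  simp [bsc, hxy, hq0]

lemma bsc_isProbabilityMeasure {q : ℝ} (hq0 : 0 ≤ q) (hq : q ≤ 1 / 2) (x : ZMod 2) :
    IsProbabilityMeasure ((bsc q).law x) := by
  refine ⟨?_⟩
  rw [Channel.law, withDensity_apply _ MeasurableSet.univ, Measure.restrict_univ]
  have h : ∀ x : ZMod 2, (bsc q).density x 0 + (bsc q).density x 1 = 1 := by
    intro x
    have : ∀ x : ZMod 2, x = 1 ∨ x = 0 := by decide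
    rcases this x with rfl | rfl <;> simp only [bsc] <;> norm_num
    · rw [← ENNReal.ofReal_add hq0 (by linarith)]; simp
    · rw [← ENNReal.ofReal_add (by linarith) hq0]; simp
  rw [show (bsc q).ref = Measure.count from rfl, lintegral_count, tsum_fintype, ← h x]
  exact Fin.sum_univ_two _

lemma bsc_density_one {q : ℝ} (hq0 : 0 < q) (hq : q ≤ 1 / 2) (y : ZMod 2) :
    (bsc q).density 1 y
      = (bsc q).density 0 y * ENNReal.ofReal (Real.exp (-bscLLR q y)) := by
  have hpos : 0 < (1 - q) / q := div_pos (by linarith) hq0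
  have : ∀ x : ZMod 2, x = 1 ∨ x = 0 := by decide
  rcases this y with rfl | rfl
  · simp only [bsc, bscLLR]
    norm_num
    rw [← ENNReal.ofReal_mul hq0.le, Real.exp_log hpos, mul_div_cancel₀ _ hq0.ne']
  · simp only [bsc, bscLLR]
    norm_num
    rw [← ENNReal.ofReal_mul (by linarith), Real.exp_neg, Real.exp_log hpos, inv_div,
      mul_div_cancel₀ _ (by linarith)]

lemma bsc_symLLR {q : ℝ} (hq0 : 0 < q) (hq : q ≤ 1 / 2) :
    SymLLR ((bsc q).law 0) (bscLLR q) (fun y => y + 1) ∧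
      (bsc q).law 1 = ((bsc q).law 0).map fun y => y + 1 := by
  have hinv : ∀ y : ZMod 2, y + 1 + 1 = y := by decide
  refine symLLR_of_channel (bsc q) (bsc_isProbabilityMeasure hq0.le hq 0)
    (measurable_of_finite _) (measurable_of_finite _) (measurable_of_finite _) ?_
    hinv ?_ ?_ (bsc_density_one hq0 hq)
  · intro y
    have : ∀ x : ZMod 2, x = 1 ∨ x = 0 := by decide
    rcases this y with rfl | rfl
    · simp [bscLLR, show (1 : ZMod 2) + 1 = 0 by decide]
    · simp [bscLLR]
  · exact measurePreserving_add_right (Measure.count : Measure (ZMod 2)) 1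
  · intro y
    have : ∀ x : ZMod 2, x = 1 ∨ x = 0 := by decide
    rcases this y with rfl | rfl
    · simp [bsc, show (1 : ZMod 2) + 1 = 0 by decide]
    · simp [bsc]

lemma bsc_llr {q : ℝ} (hq0 : 0 < q) (hq : q ≤ 1 / 2) (y : ZMod 2) :
    (bsc q).llr y = (bscLLR q y : EReal) := by
  refine llr_eq_coe ?_ ?_ (bsc_density_one hq0 hq y)
  · simp only [bsc]
    split_ifs
    · rw [Ne, ENNReal.ofReal_eq_zero, not_le]; linarith
    · rw [Ne, ENNReal.ofReal_eq_zero, not_le]; linarith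
  · simp only [bsc]; split_ifs <;> exact ENNReal.ofReal_ne_top

/-! #### The Gaussian channel -/

/-- The log-likelihood ratio of the Gaussian channel. -/
noncomputable def awgnLLR (σ : ℝ) (y : ℝ) : ℝ := 2 / σ ^ 2 * y

lemma awgn_var_ne_zero {σ : ℝ} (hσ : 0 < σ) : Real.toNNReal (σ ^ 2) ≠ 0 := by
  rw [Ne, Real.toNNReal_eq_zero, not_le]; positivity

lemma awgn_law_zero {σ : ℝ} (hσ : 0 < σ) :
    (biAWGN σ).law 0 = gaussianReal 1 (Real.toNNReal (σ ^ 2)) := by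
  rw [gaussianReal_of_var_ne_zero _ (awgn_var_ne_zero hσ)]
  simp [Channel.law, biAWGN]

lemma awgn_density_one {σ : ℝ} (hσ : 0 < σ) (y : ℝ) :
    (biAWGN σ).density 1 y
      = (biAWGN σ).density 0 y * ENNReal.ofReal (Real.exp (-awgnLLR σ y)) := by
  simp only [biAWGN, one_ne_zero, if_true, if_false, gaussianPDF]
  rw [← ENNReal.ofReal_mul (gaussianPDFReal_nonneg _ _ _)]
  congr 1
  rw [gaussianPDFReal, gaussianPDFReal, mul_assoc (Real.sqrt _)⁻¹, ← Real.exp_add, awgnLLR,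
    Real.coe_toNNReal _ (by positivity)]
  congr 2
  field_simp
  ring

lemma awgn_symLLR {σ : ℝ} (hσ : 0 < σ) :
    SymLLR ((biAWGN σ).law 0) (awgnLLR σ) (fun y => -y) ∧
      (biAWGN σ).law 1 = ((biAWGN σ).law 0).map fun y => -y := by
  refine symLLR_of_channel (biAWGN σ) ?_ (measurable_gaussianPDF _ _) (measurable_gaussianPDF _ _)
    (measurable_id.const_mul _) ?_ (fun y => neg_neg y) ?_ ?_ (awgn_density_one hσ)
  · rw [awgn_law_zero hσ]; infer_instance
  · intro y; simp [awgnLLR]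
  · exact Measure.measurePreserving_neg (volume : Measure ℝ)
  · intro y
    simp only [biAWGN, one_ne_zero, if_true, if_false, gaussianPDF, gaussianPDFReal]
    congr 4
    ring

lemma awgn_llr {σ : ℝ} (hσ : 0 < σ) (y : ℝ) : (biAWGN σ).llr y = (awgnLLR σ y : EReal) :=
  llr_eq_coe (gaussianPDF_pos _ (awgn_var_ne_zero hσ) y).ne' gaussianPDF_ne_top
    (awgn_density_one hσ y)

lemma gaussQ_eq_gaussianReal (x : ℝ) : gaussQ x = (gaussianReal 0 1).real (Set.Ioi x) := by
  rw [measureReal_def, gaussianReal_apply_eq_integral _ one_ne_zero, ENNReal.toReal_ofReal]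
  · simp [gaussQ, gaussianPDFReal]
  · exact integral_nonneg fun y => gaussianPDFReal_nonneg _ _ _

lemma gaussianReal_Iio (m x : ℝ) {s : ℝ} (hs : 0 < s) :
    (gaussianReal m (Real.toNNReal (s ^ 2))).real (Set.Iio x) = gaussQ ((m - x) / s) := by
  have h1 : gaussianReal m (Real.toNNReal (s ^ 2))
      = ((gaussianReal 0 1).map fun t => (-s) * t).map fun t => m + t := by
    rw [gaussianReal_map_const_mul, gaussianReal_map_const_add]
    congr 1
    · simp
    · ext; simp [Real.coe_toNNReal _ (sq_nonneg s)]
  rw [h1, Measure.map_map (by fun_prop) (by fun_prop), measureReal_def,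
    Measure.map_apply (by fun_prop) measurableSet_Iio, gaussQ_eq_gaussianReal, measureReal_def]
  congr 2
  ext t
  simp only [Set.mem_preimage, Function.comp, Set.mem_Iio, Set.mem_Ioi]
  rw [div_lt_iff₀ hs]
  constructor <;> intro h <;> linarith

lemma gaussianReal_Ioi (m x : ℝ) {s : ℝ} (hs : 0 < s) :
    (gaussianReal m (Real.toNNReal (s ^ 2))).real (Set.Ioi x) = gaussQ ((x - m) / s) := by
  have h1 : (gaussianReal m (Real.toNNReal (s ^ 2)))
      = (gaussianReal (-m) (Real.toNNReal (s ^ 2))).map fun t => -t := by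
    rw [gaussianReal_map_neg, neg_neg]
  rw [h1, measureReal_def, Measure.map_apply (by fun_prop) measurableSet_Ioi,
    show (fun t : ℝ => -t) ⁻¹' Set.Ioi x = Set.Iio (-x) by ext t; simp, ← measureReal_def,
    gaussianReal_Iio _ _ hs]
  congr 2
  ring

/-- The sum of independent Gaussian outputs. -/
lemma map_sum_gaussianReal {N : ℕ} (m : ℝ) (v : NNReal) (S : Finset (Fin N)) :
    (zeroLaw (gaussianReal m v) N).map (fun y => ∑ i ∈ S, y i)
      = gaussianReal (S.card * m) (S.card * v) := by
  induction S using Finset.induction_on with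
  | empty => simp
  | insert a S ha ih =>
    have hind : IndepFun (fun y : Fin N → ℝ => y a) (fun y => ∑ i ∈ S, y i)
        (zeroLaw (gaussianReal m v) N) :=
      indepFun_of_supportedOn (A := {a}) (B := S) (measurable_pi_apply a)
        (Finset.measurable_fun_sum _ fun i _ => measurable_pi_apply i) (by simpa using ha)
        (fun y y' h => h a (by simp)) (fun y y' h => Finset.sum_congr rfl h)
    have hX : (zeroLaw (gaussianReal m v) N).map (fun y => y a) = gaussianReal m v :=
      (measurePreserving_eval (fun _ : Fin N => gaussianReal m v) a).map_eq
    have := gaussianReal_add_gaussianReal_of_indepFun hind hX ih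
    simp only [Finset.sum_insert ha, Finset.card_insert_of_notMem ha]
    rw [show (fun y : Fin N → ℝ => y a + ∑ i ∈ S, y i)
      = (fun y => y a) + fun y => ∑ i ∈ S, y i from rfl, this]
    congr 1 <;> push_cast <;> ring

lemma half_mul {c : ℝ} (hc : 0 < c) (x : ℝ) : half (c * x) = half x := by
  unfold half
  rcases lt_trichotomy x 0 with h | h | h
  · rw [if_pos h, if_pos (mul_neg_of_pos_of_neg hc h)]
  · simp [h]
  · have := mul_pos hc h
    rw [if_neg (by linarith), if_neg (by linarith), if_neg (by linarith), if_neg (by linarith)]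

/-- For the Gaussian channel the optimal decision between two words at distance `n` errs with
probability `Q (√n / σ)`. -/
lemma awgn_pairError {σ : ℝ} (hσ : 0 < σ) {N : ℕ} {S : Finset (Fin N)} (hS : S.Nonempty) :
    pairError ((biAWGN σ).law 0) (awgnLLR σ) S = gaussQ (Real.sqrt (S.card / σ ^ 2)) := by
  have hn : (0 : ℝ) < S.card := by exact_mod_cast hS.card_pos
  have hv : (S.card * Real.toNNReal (σ ^ 2) : NNReal)
      = Real.toNNReal ((Real.sqrt S.card * σ) ^ 2) := by
    ext
    rw [NNReal.coe_mul, Real.coe_toNNReal _ (by positivity), Real.coe_toNNReal _ (by positivity),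
      mul_pow, Real.sq_sqrt hn.le]
    simp
  have hs : 0 < Real.sqrt S.card * σ := mul_pos (Real.sqrt_pos.2 hn) hσ
  have h1 : ∀ y : Fin N → ℝ, half (llrSum (awgnLLR σ) S y) = half (∑ i ∈ S, y i) := by
    intro y
    have : llrSum (awgnLLR σ) S y = 2 / σ ^ 2 * ∑ i ∈ S, y i := by
      simp only [llrSum, awgnLLR, Finset.mul_sum]
    rw [this, half_mul (by positivity)]
  rw [pairError, awgn_law_zero hσ]
  simp only [h1]
  have hm : Measurable fun y : Fin N → ℝ => ∑ i ∈ S, y i :=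
    Finset.measurable_fun_sum _ fun i _ => measurable_pi_apply i
  rw [integral_half hm]
  have h2 : ∀ A : Set ℝ, MeasurableSet A →
      (zeroLaw (gaussianReal 1 (Real.toNNReal (σ ^ 2))) N).real {y | ∑ i ∈ S, y i ∈ A}
        = (gaussianReal S.card (Real.toNNReal ((Real.sqrt S.card * σ) ^ 2))).real A := by
    intro A hA
    rw [← hv, show (S.card : ℝ) = S.card * 1 by ring, ← map_sum_gaussianReal, measureReal_def,
      measureReal_def, Measure.map_apply hm hA]
    rfl
  have h3 := h2 (Set.Iio 0) measurableSet_Iio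
  have h4 := h2 {0} (measurableSet_singleton 0)
  simp only [Set.mem_Iio, Set.mem_singleton_iff] at h3 h4
  have hz : (gaussianReal S.card (Real.toNNReal ((Real.sqrt S.card * σ) ^ 2))).real {0} = 0 := by
    have := nullSingletonClass_gaussianReal (μ := (S.card : ℝ)) (awgn_var_ne_zero hs)
    simp [measureReal_def]
  rw [h3, h4, hz, gaussianReal_Iio _ _ hs, sub_zero]
  rw [mul_zero, add_zero]
  congr 1
  rw [Real.sqrt_div hn.le, Real.sqrt_sq hσ.le, div_eq_div_iff hs.ne' hσ.ne', ← mul_assoc,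
    Real.mul_self_sqrt hn.le]

/-! ### Two words over the binary symmetric channel -/

open MeasureTheory ProbabilityTheory

section
variable {N : ℕ} {q : ℝ}

/-- The indicator of the event that all outputs on `A` are `1`. -/
noncomputable def allOnes (A : Finset (Fin N)) : (Fin N → ZMod 2) → ℝ :=
  Set.indicator {y | ∀ i ∈ A, y i ∈ ({1} : Set (ZMod 2))} fun _ => 1

lemma integral_allOnes (hq0 : 0 ≤ q) (hq : q ≤ 1 / 2) (A : Finset (Fin N)) :
    ∫ y, allOnes A y ∂(zeroLaw ((bsc q).law 0) N) = q ^ A.card := by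
  have := bsc_isProbabilityMeasure hq0 hq 0
  simp only [allOnes]
  rw [integral_indicator_const _ (Set.toFinite _).measurableSet, smul_eq_mul, mul_one,
    pi_real_forall_mem (fun _ => (bsc q).law 0) A {1}, Finset.prod_const,
    bsc_law_real q hq0 0 1 (by decide)]

lemma allOnes_eq (A : Finset (Fin N)) (y : Fin N → ZMod 2) :
    allOnes A y = if ∀ i ∈ A, y i = 1 then 1 else 0 := by
  simp [allOnes, Set.indicator_apply]

lemma log_odds_nonneg (hq0 : 0 < q) (hq : q ≤ 1 / 2) : 0 ≤ Real.log ((1 - q) / q) :=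
  Real.log_nonneg (by rw [le_div_iff₀ hq0]; linarith)

lemma llrSum_bsc_le (hq0 : 0 < q) (hq : q ≤ 1 / 2) {A S : Finset (Fin N)} (hAS : A ⊆ S)
    {y : Fin N → ZMod 2} (hy : ∀ i ∈ A, y i = 1) :
    llrSum (bscLLR q) S y ≤ Real.log ((1 - q) / q) * (S.card - 2 * A.card) := by
  have hL := log_odds_nonneg hq0 hq
  have h1 : ∀ i ∈ A, bscLLR q (y i) = -Real.log ((1 - q) / q) := fun i hi => by
    rw [bscLLR, hy i hi, if_neg (by decide)]
  have h2 : ∀ i ∈ S \ A, bscLLR q (y i) ≤ Real.log ((1 - q) / q) := fun i _ => by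
    unfold bscLLR; split_ifs <;> linarith
  have h3 := Finset.sum_le_card_nsmul _ _ _ h2
  have h4 : ((S \ A).card : ℝ) = S.card - A.card := by
    rw [Finset.card_sdiff_of_subset hAS, Nat.cast_sub (Finset.card_le_card hAS)]
  rw [nsmul_eq_mul, h4] at h3
  rw [llrSum, ← Finset.sum_sdiff hAS, Finset.sum_congr rfl h1, Finset.sum_const, nsmul_eq_mul]
  linarith

lemma bsc_integrable (hq0 : 0 ≤ q) (hq : q ≤ 1 / 2) (F : (Fin N → ZMod 2) → ℝ) :
    Integrable F (zeroLaw ((bsc q).law 0) N) := by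
  have := bsc_isProbabilityMeasure hq0 hq 0
  exact Integrable.of_finite

/-- For `q = 1 / 2` the outputs carry no information. -/
lemma bsc_pairError_half (S : Finset (Fin N)) :
    pairError ((bsc (1 / 2)).law 0) (bscLLR (1 / 2)) S = 1 / 2 := by
  have := bsc_isProbabilityMeasure (q := 1 / 2) (by norm_num) le_rfl 0
  have h : ∀ y : Fin N → ZMod 2, half (llrSum (bscLLR (1 / 2)) S y) = 1 / 2 := by
    intro y
    have : llrSum (bscLLR (1 / 2)) S y = 0 := by
      refine Finset.sum_eq_zero fun i _ => ?_
      norm_num [bscLLR]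
    rw [this]; norm_num [half]
  simp only [pairError, h]
  rw [integral_const, probReal_univ, one_smul]

lemma half_eq_one_of_ones (hq0 : 0 < q) (hq : q < 1 / 2) {A S : Finset (Fin N)} (hAS : A ⊆ S)
    (hc : S.card < 2 * A.card) {y : Fin N → ZMod 2} (hy : ∀ i ∈ A, y i = 1) :
    half (llrSum (bscLLR q) S y) = 1 := by
  have hL : 0 < Real.log ((1 - q) / q) := Real.log_pos (by rw [lt_div_iff₀ hq0]; linarith)
  have h1 := llrSum_bsc_le hq0 hq.le hAS hy
  have h2 : (S.card : ℝ) < 2 * A.card := by exact_mod_cast hc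
  rw [half, if_pos (by nlinarith)]

/-- An even number of positions: the two halves of `S` give two events, each of which makes at
least a tie. -/
lemma bsc_pairError_even (hq0 : 0 < q) (hq : q ≤ 1 / 2) {S : Finset (Fin N)} {k : ℕ} (hk : 1 ≤ k)
    (hS : S.card = 2 * k) : q ^ k ≤ pairError ((bsc q).law 0) (bscLLR q) S := by
  rcases hq.lt_or_eq with hq' | rfl
  swap
  · rw [bsc_pairError_half]
    calc (1 / 2 : ℝ) ^ k ≤ (1 / 2) ^ 1 := pow_le_pow_of_le_one (by norm_num) (by norm_num) hk
      _ = 1 / 2 := pow_one _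
  obtain ⟨A, hAS, hA⟩ := Finset.exists_subset_card_eq (s := S) (n := k) (by omega)
  have hB : (S \ A).card = k := by rw [Finset.card_sdiff_of_subset hAS]; omega
  have key : ∀ y : Fin N → ZMod 2, (allOnes A y + allOnes (S \ A) y) / 2
      ≤ half (llrSum (bscLLR q) S y) := by
    intro y
    have tie : ∀ C ⊆ S, C.card = k → (∀ i ∈ C, y i = 1) →
        1 / 2 ≤ half (llrSum (bscLLR q) S y) := by
      intro C hC hc hy
      have := llrSum_bsc_le hq0 hq hC hy
      rw [hS, hc] at this
      push_cast at this
      rw [sub_self, mul_zero] at this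
      unfold half
      rcases this.lt_or_eq with h | h
      · rw [if_pos h]; norm_num
      · simp [h]
    rw [allOnes_eq, allOnes_eq]
    by_cases hy : ∀ i ∈ A, y i = 1 <;> by_cases hy' : ∀ i ∈ S \ A, y i = 1
    · have hSS : ∀ i ∈ S, y i = 1 := fun i hi => by
        by_cases h : i ∈ A
        · exact hy i h
        · exact hy' i (Finset.mem_sdiff.2 ⟨hi, h⟩)
      rw [if_pos hy, if_pos hy',
        half_eq_one_of_ones hq0 hq' (Finset.Subset.refl S) (by omega) hSS]
      norm_num
    · rw [if_pos hy, if_neg hy']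
      linarith [tie A hAS hA hy]
    · rw [if_neg hy, if_pos hy']
      linarith [tie _ Finset.sdiff_subset hB hy']
    · rw [if_neg hy, if_neg hy']
      simpa using half_nonneg _
  have h := integral_mono (bsc_integrable hq0.le hq _) (bsc_integrable hq0.le hq _) key
  rw [integral_div, integral_add (bsc_integrable hq0.le hq _) (bsc_integrable hq0.le hq _),
    integral_allOnes hq0.le hq, integral_allOnes hq0.le hq, hA, hB] at h
  rw [pairError]
  linarith

/-- An odd number of positions: two overlapping majorities and inclusion-exclusion. -/
lemma bsc_pairError_odd (hq0 : 0 < q) (hq : q < 1 / 2) {S : Finset (Fin N)} {k : ℕ}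
    (hS : S.card = 2 * k + 1) :
    2 * q ^ (k + 1) - q ^ (2 * k + 1) ≤ pairError ((bsc q).law 0) (bscLLR q) S := by
  obtain ⟨A, hAS, hA⟩ := Finset.exists_subset_card_eq (s := S) (n := k + 1) (by omega)
  obtain ⟨C, hCA, hC⟩ := Finset.exists_subset_card_eq (s := A) (n := k) (by omega)
  have hCS := hCA.trans hAS
  have hB : (S \ C).card = k + 1 := by rw [Finset.card_sdiff_of_subset hCS]; omega
  have key : ∀ y : Fin N → ZMod 2, allOnes A y + allOnes (S \ C) y - allOnes S y
      ≤ half (llrSum (bscLLR q) S y) := by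
    intro y
    rw [allOnes_eq, allOnes_eq, allOnes_eq]
    by_cases hy : ∀ i ∈ A, y i = 1
    · rw [if_pos hy, half_eq_one_of_ones hq0 hq hAS (by omega) hy]
      by_cases hy' : ∀ i ∈ S \ C, y i = 1
      · have hSS : ∀ i ∈ S, y i = 1 := fun i hi => by
          by_cases h : i ∈ C
          · exact hy i (hCA h)
          · exact hy' i (Finset.mem_sdiff.2 ⟨hi, h⟩)
        rw [if_pos hy', if_pos hSS]; norm_num
      · rw [if_neg hy']; split_ifs <;> norm_num
    · rw [if_neg hy]
      by_cases hy' : ∀ i ∈ S \ C, y i = 1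
      · rw [if_pos hy', half_eq_one_of_ones hq0 hq Finset.sdiff_subset (by omega) hy']
        split_ifs <;> norm_num
      · rw [if_neg hy']
        have := half_nonneg (llrSum (bscLLR q) S y)
        split_ifs <;> linarith
  have h := integral_mono (bsc_integrable hq0.le hq.le _) (bsc_integrable hq0.le hq.le _) key
  rw [integral_sub (bsc_integrable hq0.le hq.le _) (bsc_integrable hq0.le hq.le _),
    integral_add (bsc_integrable hq0.le hq.le _) (bsc_integrable hq0.le hq.le _),
    integral_allOnes hq0.le hq.le, integral_allOnes hq0.le hq.le, integral_allOnes hq0.le hq.le,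
    hA, hB, hS] at h
  rw [pairError]
  linarith

lemma sqrt_two_mul_rpow_half (hq : q ≤ 1 / 2) :
    Real.sqrt 2 * q ^ (1 / 2 : ℝ) ≤ 1 := by
  rw [← Real.sqrt_eq_rpow, ← Real.sqrt_mul (by norm_num)]
  exact Real.sqrt_le_one.2 (by linarith)

lemma sqrt_two_le : Real.sqrt 2 ≤ 3 / 2 := by
  rw [Real.sqrt_le_left (by norm_num)]; norm_num

lemma rpow_le_of_le_one (hq0 : 0 < q) (hq : q ≤ 1 / 2) {x y : ℝ} (h : y ≤ x) : q ^ x ≤ q ^ y :=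
  Real.rpow_le_rpow_of_exponent_ge hq0 (by linarith) h

/-- The factor `√2` leaves room for the graphs that are not covered. -/
lemma bsc_pairError_ge_sqrt_two (hq0 : 0 < q) (hq : q ≤ 1 / 2) {S : Finset (Fin N)}
    (hS : S.Nonempty) {w : ℝ} (hw : 2 ≤ w) (hSw : S.card ≤ w) :
    Real.sqrt 2 * q ^ ((w + 1) / 2) ≤ pairError ((bsc q).law 0) (bscLLR q) S := by
  have h2 : (0 : ℝ) ≤ Real.sqrt 2 := Real.sqrt_nonneg 2
  have hs := sqrt_two_mul_rpow_half hq
  have shift : ∀ k : ℕ, (k : ℝ) + 1 / 2 ≤ (w + 1) / 2 → Real.sqrt 2 * q ^ ((w + 1) / 2) ≤ q ^ k := by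
    intro k hk
    calc Real.sqrt 2 * q ^ ((w + 1) / 2) ≤ Real.sqrt 2 * q ^ ((k : ℝ) + 1 / 2) :=
          mul_le_mul_of_nonneg_left (rpow_le_of_le_one hq0 hq hk) h2
      _ = q ^ k * (Real.sqrt 2 * q ^ (1 / 2 : ℝ)) := by
          rw [Real.rpow_add hq0, Real.rpow_natCast]; ring
      _ ≤ q ^ k * 1 := by gcongr
      _ = q ^ k := mul_one _
  rcases Nat.even_or_odd' S.card with ⟨k, hk | hk⟩
  · have hpos := hS.card_pos
    refine (shift k ?_).trans (bsc_pairError_even hq0 hq (by omega) hk)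
    rw [hk] at hSw; push_cast at hSw; linarith
  · rcases hq.lt_or_eq with hq' | rfl
    · refine le_trans ?_ (bsc_pairError_odd hq0 hq' hk)
      rcases Nat.eq_zero_or_pos k with rfl | hk0
      · have := shift 1 (by push_cast; linarith)
        norm_num at this ⊢
        linarith
      · have h3 : q ^ ((w + 1) / 2) ≤ q ^ (k + 1) := by
          rw [← Real.rpow_natCast q (k + 1)]
          refine rpow_le_of_le_one hq0 hq ?_
          rw [hk] at hSw; push_cast at hSw ⊢; linarith
        have h4 : q ^ (2 * k + 1) ≤ q ^ (k + 1) * (1 / 2) := by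
          calc q ^ (2 * k + 1) ≤ q ^ (k + 1 + 1) :=
                pow_le_pow_of_le_one hq0.le (by linarith) (by omega)
            _ = q ^ (k + 1) * q := pow_succ _ _
            _ ≤ q ^ (k + 1) * (1 / 2) := by gcongr
        have h5 : 0 ≤ q ^ ((w + 1) / 2) := Real.rpow_nonneg hq0.le _
        nlinarith [sqrt_two_le]
    · rw [bsc_pairError_half]
      have := shift 1 (by push_cast; linarith)
      simpa using this

lemma bsc_pairError_ge (hq0 : 0 < q) (hq : q ≤ 1 / 2) {S : Finset (Fin N)}
    (hS : S.Nonempty) {w : ℝ} (hSw : S.card ≤ w) :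
    q ^ ((w + 1) / 2) ≤ pairError ((bsc q).law 0) (bscLLR q) S := by
  have hpos := hS.card_pos
  rcases (Nat.succ_le_of_lt hpos).lt_or_eq with h | h
  · have h2 : (2 : ℝ) ≤ w := le_trans (by exact_mod_cast h) hSw
    refine le_trans ?_ (bsc_pairError_ge_sqrt_two hq0 hq hS h2 hSw)
    have := Real.rpow_nonneg hq0.le ((w + 1) / 2)
    have h3 : 1 ≤ Real.sqrt 2 := Real.one_le_sqrt.2 (by norm_num)
    nlinarith
  · have h1 : q ^ ((w + 1) / 2) ≤ q := by
      rw [← h] at hSw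
      push_cast at hSw
      calc q ^ ((w + 1) / 2) ≤ q ^ (1 : ℝ) := rpow_le_of_le_one hq0 hq (by linarith)
        _ = q := Real.rpow_one q
    refine h1.trans ?_
    rcases hq.lt_or_eq with hq' | rfl
    · have := bsc_pairError_odd hq0 hq' (S := S) (k := 0) (by omega)
      norm_num at this
      linarith
    · rw [bsc_pairError_half]

end

/-! ### Bounds for the Gaussian tail -/

open MeasureTheory ProbabilityTheory

/-- The standard normal density. -/
noncomputable def gaussDensity (t : ℝ) : ℝ := (1 / Real.sqrt (2 * Real.pi)) * Real.exp (-t ^ 2 / 2)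

lemma gaussDensity_pos (t : ℝ) : 0 < gaussDensity t := by unfold gaussDensity; positivity

lemma continuous_gaussDensity : Continuous gaussDensity := by unfold gaussDensity; fun_prop

lemma integrable_gaussDensity : Integrable gaussDensity := by
  have := integrable_gaussianPDFReal 0 1
  refine this.congr (Filter.Eventually.of_forall fun t => ?_)
  simp [gaussianPDFReal, gaussDensity]

lemma gaussQ_pos (x : ℝ) : 0 < gaussQ x := by
  rw [gaussQ, setIntegral_pos_iff_support_of_nonneg_ae]
  · have : Function.support (fun t : ℝ => 1 / Real.sqrt (2 * Real.pi) * Real.exp (-t ^ 2 / 2))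
        = Set.univ := by
      ext t; simpa using (by positivity : Real.sqrt 2 * Real.sqrt Real.pi ≠ 0)
    rw [this, Set.univ_inter]; simp
  · exact Filter.Eventually.of_forall fun t => (gaussDensity_pos t).le
  · exact integrable_gaussDensity.integrableOn

lemma gaussQ_zero : gaussQ 0 = 1 / 2 := by
  have h := integral_gaussian_Ioi (1 / 2)
  have h2 : ∀ t : ℝ, -t ^ 2 / 2 = -(1 / 2) * t ^ 2 := fun t => by ring
  simp only [gaussQ, h2]
  rw [integral_const_mul, h]
  rw [show Real.pi / (1 / 2) = 2 * Real.pi by ring]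
  have : Real.sqrt (2 * Real.pi) ≠ 0 := by positivity
  field_simp

lemma gaussQ_sub (a b : ℝ) : gaussQ a - gaussQ b = ∫ t in a..b, gaussDensity t :=
  intervalIntegral.integral_Ioi_sub_Ioi' integrable_gaussDensity.integrableOn
    integrable_gaussDensity.integrableOn

lemma hasDerivAt_gaussQ (x : ℝ) : HasDerivAt gaussQ (-gaussDensity x) x := by
  have h1 : gaussQ = fun x => gaussQ 0 - ∫ t in (0 : ℝ)..x, gaussDensity t := by
    ext x; rw [← gaussQ_sub]; ring
  rw [h1]
  refine HasDerivAt.const_sub _ ?_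
  exact intervalIntegral.integral_hasDerivAt_right (continuous_gaussDensity.intervalIntegrable _ _)
    (continuous_gaussDensity.stronglyMeasurableAtFilter _ _) continuous_gaussDensity.continuousAt

lemma gaussQ_antitone : Antitone gaussQ :=
  antitone_of_deriv_nonpos (fun x => (hasDerivAt_gaussQ x).differentiableAt) fun x => by
    rw [(hasDerivAt_gaussQ x).deriv]; linarith [gaussDensity_pos x]

lemma gaussQ_le_half {x : ℝ} (hx : 0 ≤ x) : gaussQ x ≤ 1 / 2 := by
  rw [← gaussQ_zero]; exact gaussQ_antitone hx

lemma gaussQ_shift (a : ℝ) : gaussQ a = ∫ t in Set.Ioi 0, gaussDensity (t + a) := by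
  have h1 : (fun t : ℝ => t + a) ⁻¹' Set.Ioi a = Set.Ioi 0 := by
    ext t; simp
  have h2 := (measurePreserving_add_right (volume : Measure ℝ) a).setIntegral_preimage_emb
    (measurableEmbedding_addRight a) gaussDensity (Set.Ioi a)
  rw [h1] at h2
  rw [h2]
  rfl

/-- Mills' ratio, which is `gaussQ a * exp (a ^ 2 / 2)` up to a constant, is decreasing. -/
lemma gaussQ_mul_exp_antitone : Antitone fun a => gaussQ a * Real.exp (a ^ 2 / 2) := by
  intro a b hab
  simp only
  rw [gaussQ_shift a, gaussQ_shift b, ← integral_mul_const, ← integral_mul_const]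
  have hi : ∀ c : ℝ, IntegrableOn (fun t => gaussDensity (t + c) * Real.exp (c ^ 2 / 2))
      (Set.Ioi 0) := fun c =>
    ((integrable_gaussDensity.comp_add_right c).mul_const _).integrableOn
  refine setIntegral_mono_on (hi b) (hi a) measurableSet_Ioi fun t ht => ?_
  simp only [gaussDensity, mul_assoc, ← Real.exp_add]
  have ht' : (0 : ℝ) < t := ht
  refine mul_le_mul_of_nonneg_left (Real.exp_le_exp.2 ?_) (by positivity)
  nlinarith

lemma gaussQ_le_exp {a : ℝ} (ha : 0 ≤ a) : gaussQ a ≤ 1 / 2 * Real.exp (-(a ^ 2 / 2)) := by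
  have := gaussQ_mul_exp_antitone ha
  simp only [gaussQ_zero] at this
  norm_num at this
  rw [Real.exp_neg, ← div_eq_mul_inv, le_div_iff₀ (Real.exp_pos _)]
  linarith

lemma sqrt_two_pi_le : Real.sqrt (2 * Real.pi) ≤ 13 / 5 := by
  rw [Real.sqrt_le_left (by norm_num)]
  linarith [Real.pi_lt_d2]

lemma le_gaussDensity {t : ℝ} (h0 : 0 ≤ t) (h1 : t ≤ 1) : 19 / 100 ≤ gaussDensity t := by
  have h2 : (5 / 13 : ℝ) ≤ 1 / Real.sqrt (2 * Real.pi) := by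
    rw [le_div_iff₀ (by positivity)]; linarith [sqrt_two_pi_le]
  have h3 : (1 / 2 : ℝ) ≤ Real.exp (-t ^ 2 / 2) := by
    have := Real.add_one_le_exp (-t ^ 2 / 2)
    nlinarith
  calc (19 / 100 : ℝ) ≤ 5 / 13 * (1 / 2) := by norm_num
    _ ≤ _ := mul_le_mul h2 h3 (by norm_num) (by positivity)

lemma gaussQ_sub_ge {a b : ℝ} (h0 : 0 ≤ a) (hab : a ≤ b) (h1 : b ≤ 1) :
    19 / 100 * (b - a) ≤ gaussQ a - gaussQ b := by
  rw [gaussQ_sub]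
  have := intervalIntegral.integral_mono_on (μ := volume) (a := a) (b := b) (f := fun _ => (19 / 100 : ℝ))
    (g := gaussDensity) hab intervalIntegrable_const
    (continuous_gaussDensity.intervalIntegrable _ _)
    fun t ht => le_gaussDensity (h0.trans ht.1) (ht.2.trans h1)
  rw [intervalIntegral.integral_const, smul_eq_mul] at this
  linarith

lemma gaussDensity_le (t : ℝ) : gaussDensity t ≤ 1 / 2 := by
  have h2 : 1 / Real.sqrt (2 * Real.pi) ≤ 1 / 2 := by
    refine one_div_le_one_div_of_le (by norm_num) (Real.le_sqrt_of_sq_le ?_)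
    linarith [Real.pi_gt_three]
  have h3 : Real.exp (-t ^ 2 / 2) ≤ 1 := Real.exp_le_one_iff.2 (by nlinarith [sq_nonneg t])
  calc gaussDensity t ≤ 1 / 2 * 1 := mul_le_mul h2 h3 (Real.exp_pos _).le (by norm_num)
    _ = 1 / 2 := by norm_num

lemma gaussQ_ge_half_sub {a : ℝ} (ha : 0 ≤ a) : 1 / 2 - a / 2 ≤ gaussQ a := by
  have h := gaussQ_sub 0 a
  have := intervalIntegral.integral_mono_on (μ := volume) (a := 0) (b := a) (g := fun _ => (1 / 2 : ℝ))
    (f := gaussDensity) ha (continuous_gaussDensity.intervalIntegrable _ _) intervalIntegrable_const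
    fun t _ => gaussDensity_le t
  rw [intervalIntegral.integral_const, smul_eq_mul] at this
  rw [gaussQ_zero] at h
  linarith

lemma hasDerivAt_gaussDensity (x : ℝ) : HasDerivAt gaussDensity (-x * gaussDensity x) x := by
  have h1 : HasDerivAt (fun t : ℝ => -t ^ 2 / 2) (-x) x := by
    exact (((hasDerivAt_pow 2 x).neg).div_const 2).congr_deriv (by norm_num; ring)
  exact ((h1.exp).const_mul (1 / Real.sqrt (2 * Real.pi))).congr_deriv (by
    unfold gaussDensity; ring)

lemma tendsto_gaussQ : Filter.Tendsto gaussQ Filter.atTop (nhds 0) := by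
  have h1 : Filter.Tendsto (fun a : ℝ => Real.exp (-a)) Filter.atTop (nhds 0) :=
    Real.tendsto_exp_neg_atTop_nhds_zero
  refine tendsto_of_tendsto_of_tendsto_of_le_of_le' tendsto_const_nhds h1
    (Filter.Eventually.of_forall fun x => (gaussQ_pos x).le) ?_
  filter_upwards [Filter.eventually_ge_atTop 2] with a ha
  refine (gaussQ_le_exp (by linarith)).trans ?_
  have : Real.exp (-(a ^ 2 / 2)) ≤ Real.exp (-a) := Real.exp_le_exp.2 (by nlinarith)
  linarith [Real.exp_pos (-(a ^ 2 / 2))]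

lemma hasDerivAt_millsGap {x : ℝ} (hx : 0 < x) :
    HasDerivAt (fun t => gaussQ t - gaussDensity t / (2 * t))
      (gaussDensity x * (1 - x ^ 2) / (2 * x ^ 2)) x := by
  have h1 : HasDerivAt (fun t : ℝ => 2 * t) 2 x := by
    simpa using (hasDerivAt_id x).const_mul 2
  refine ((hasDerivAt_gaussQ x).sub
    ((hasDerivAt_gaussDensity x).div h1 (by positivity))).congr_deriv ?_
  field_simp
  ring

/-- Beyond `1` the difference of the two sides decreases, and it tends to zero. -/
lemma gaussQ_ge_mills_of_one_le {x : ℝ} (hx : 1 ≤ x) : gaussDensity x / (2 * x) ≤ gaussQ x := by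
  have anti : AntitoneOn (fun t => gaussQ t - gaussDensity t / (2 * t)) (Set.Ici 1) := by
    refine antitoneOn_of_deriv_nonpos (convex_Ici 1) ?_ ?_ ?_
    · exact fun t ht => (hasDerivAt_millsGap
        (zero_lt_one.trans_le ht)).continuousAt.continuousWithinAt
    · intro t ht
      rw [interior_Ici] at ht
      exact (hasDerivAt_millsGap (zero_lt_one.trans ht)).differentiableAt.differentiableWithinAt
    · intro t ht
      rw [interior_Ici] at ht
      have ht' : (1 : ℝ) < t := ht
      rw [(hasDerivAt_millsGap (zero_lt_one.trans ht')).deriv]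
      refine div_nonpos_of_nonpos_of_nonneg ?_ (by positivity)
      exact mul_nonpos_of_nonneg_of_nonpos (gaussDensity_pos t).le (by nlinarith)
  have hlim : Filter.Tendsto (fun t => gaussQ t - gaussDensity t / (2 * t)) Filter.atTop
      (nhds 0) := by
    have h2 : Filter.Tendsto (fun t => gaussDensity t / (2 * t)) Filter.atTop (nhds 0) := by
      have h3 : Filter.Tendsto (fun t : ℝ => 1 / 2 * t⁻¹) Filter.atTop (nhds 0) := by
        simpa using tendsto_inv_atTop_zero.const_mul (1 / 2 : ℝ)
      refine tendsto_of_tendsto_of_tendsto_of_le_of_le' tendsto_const_nhds h3 ?_ ?_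
      · filter_upwards [Filter.eventually_gt_atTop 0] with t ht
        exact div_nonneg (gaussDensity_pos t).le (by positivity)
      · filter_upwards [Filter.eventually_gt_atTop 0] with t ht
        rw [div_le_iff₀ (by positivity)]
        have := gaussDensity_le t
        field_simp
        linarith
    simpa using tendsto_gaussQ.sub h2
  have : 0 ≤ gaussQ x - gaussDensity x / (2 * x) := by
    refine le_of_tendsto hlim ?_
    filter_upwards [Filter.eventually_ge_atTop x] with y hy
    exact anti hx (hx.trans hy : (1 : ℝ) ≤ y) hy
  linarith

/-- A point at which `exp (x ^ 2) * gaussDensity x / (2 * x)` takes the value `chernoffConst`. -/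
noncomputable def chernoffPoint : ℝ := Real.sqrt (2 / (Real.pi + 2))

lemma chernoffPoint_sq : chernoffPoint ^ 2 = 2 / (Real.pi + 2) :=
  Real.sq_sqrt (by positivity)

lemma chernoffPoint_pos : 0 < chernoffPoint := Real.sqrt_pos.2 (by positivity)

lemma chernoffPoint_sq_mem : 388 / 1000 ≤ chernoffPoint ^ 2 ∧ chernoffPoint ^ 2 ≤ 390 / 1000 := by
  have h1 := Real.pi_gt_d2
  have h2 := Real.pi_lt_d2
  rw [chernoffPoint_sq]
  constructor
  · rw [le_div_iff₀ (by positivity)]; linarith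
  · rw [div_le_iff₀ (by positivity)]; linarith

lemma chernoffPoint_le_one : chernoffPoint ≤ 1 := by
  have := chernoffPoint_sq_mem.2
  nlinarith [chernoffPoint_pos]

lemma exp_neg_le_quadratic {u : ℝ} (hu : 0 ≤ u) : Real.exp (-u) ≤ 1 - u + u ^ 2 / 2 := by
  have anti : MonotoneOn (fun u : ℝ => 1 - u + u ^ 2 / 2 - Real.exp (-u)) (Set.Ici 0) := by
    have hd : ∀ t : ℝ, HasDerivAt (fun u : ℝ => 1 - u + u ^ 2 / 2 - Real.exp (-u))
        (-1 + t + Real.exp (-t)) t := by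
      intro t
      exact ((((hasDerivAt_id t).const_sub 1).add ((hasDerivAt_pow 2 t).div_const 2)).sub
        ((hasDerivAt_neg t).exp)).congr_deriv (by norm_num)
    refine monotoneOn_of_deriv_nonneg (convex_Ici 0)
      (fun t _ => (hd t).continuousAt.continuousWithinAt)
      (fun t _ => (hd t).differentiableAt.differentiableWithinAt) fun t _ => ?_
    rw [(hd t).deriv]
    linarith [Real.add_one_le_exp (-t)]
  have := anti (Set.self_mem_Ici) hu hu
  simp only at this
  norm_num at this
  linarith

lemma integral_gaussDensity_le {x : ℝ} (hx : 0 ≤ x) :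
    ∫ t in (0 : ℝ)..x, gaussDensity t
      ≤ 1 / Real.sqrt (2 * Real.pi) * (x - x ^ 3 / 6 + x ^ 5 / 40) := by
  have h1 : ∫ t in (0 : ℝ)..x, gaussDensity t ≤ ∫ t in (0 : ℝ)..x,
      1 / Real.sqrt (2 * Real.pi) * (1 - t ^ 2 / 2 + t ^ 4 / 8) := by
    refine intervalIntegral.integral_mono_on hx (continuous_gaussDensity.intervalIntegrable _ _)
      (Continuous.intervalIntegrable (by fun_prop) _ _) fun t _ => ?_
    unfold gaussDensity
    have := exp_neg_le_quadratic (u := t ^ 2 / 2) (by positivity)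
    gcongr
    calc Real.exp (-t ^ 2 / 2) = Real.exp (-(t ^ 2 / 2)) := by ring_nf
      _ ≤ _ := this
      _ = _ := by ring
  refine h1.trans (le_of_eq ?_)
  rw [intervalIntegral.integral_const_mul]
  congr 1
  rw [intervalIntegral.integral_add (Continuous.intervalIntegrable (by fun_prop) _ _)
    (Continuous.intervalIntegrable (by fun_prop) _ _),
    intervalIntegral.integral_sub (Continuous.intervalIntegrable (by fun_prop) _ _)
    (Continuous.intervalIntegrable (by fun_prop) _ _), intervalIntegral.integral_div,
    intervalIntegral.integral_div, integral_pow, integral_pow]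
  norm_num
  ring

/-- The root in the density at `chernoffPoint` simplifies, by the choice of this point. -/
lemma chernoffPoint_mul_sqrt :
    chernoffPoint * Real.sqrt (2 * Real.pi) = 2 * Real.sqrt (1 - chernoffPoint ^ 2) := by
  have e : (2 : ℝ) * Real.sqrt (1 - chernoffPoint ^ 2)
      = Real.sqrt (4 * (1 - chernoffPoint ^ 2)) := by
    rw [Real.sqrt_mul (by norm_num), show (4 : ℝ) = 2 ^ 2 by norm_num, Real.sqrt_sq (by norm_num)]
  rw [e, chernoffPoint_sq, chernoffPoint, ← Real.sqrt_mul (by positivity)]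
  congr 1
  field_simp
  ring

/-- A numerical estimate, by Taylor expansion with `s = chernoffPoint ^ 2 ≈ 0.389`. -/
lemma gaussQ_chernoffPoint : gaussDensity chernoffPoint / (2 * chernoffPoint)
    ≤ gaussQ chernoffPoint := by
  have hx := chernoffPoint_pos
  obtain ⟨s1, s2⟩ := chernoffPoint_sq_mem
  set x := chernoffPoint with hxdef
  set s := x ^ 2 with hs
  have hroot := chernoffPoint_mul_sqrt
  rw [← hxdef, ← hs] at hroot
  have hsq : 1 / 2 + 3 / 4 * s - 5 / 48 * s ^ 2 + s ^ 3 / 40 ≤ Real.sqrt (1 - s) := by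
    refine (show _ ≤ (781 / 1000 : ℝ) by nlinarith).trans (Real.le_sqrt_of_sq_le ?_)
    norm_num; linarith
  have hq := gaussQ_sub 0 x
  rw [gaussQ_zero] at hq
  have hi := integral_gaussDensity_le hx.le
  have he : gaussDensity x ≤ 1 / Real.sqrt (2 * Real.pi) * (1 - s / 2 + s ^ 2 / 8) := by
    unfold gaussDensity
    gcongr
    calc Real.exp (-x ^ 2 / 2) = Real.exp (-(s / 2)) := by rw [hs]; ring_nf
      _ ≤ _ := exp_neg_le_quadratic (by positivity)
      _ = _ := by ring
  have hpos : 0 < Real.sqrt (2 * Real.pi) := by positivity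
  have h1 : gaussDensity x / (2 * x)
      ≤ 1 / Real.sqrt (2 * Real.pi) * (1 - s / 2 + s ^ 2 / 8) / (2 * x) := by gcongr
  have h2 : 1 / Real.sqrt (2 * Real.pi) * (1 - s / 2 + s ^ 2 / 8) / (2 * x)
      ≤ 1 / 2 - 1 / Real.sqrt (2 * Real.pi) * (x - x ^ 3 / 6 + x ^ 5 / 40) := by
    rw [div_le_iff₀ (by positivity), ← mul_le_mul_iff_right₀ hpos]
    have e1 : Real.sqrt (2 * Real.pi) * (1 / Real.sqrt (2 * Real.pi) * (1 - s / 2 + s ^ 2 / 8))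
        = 1 - s / 2 + s ^ 2 / 8 := by field_simp
    have e2 : Real.sqrt (2 * Real.pi) * ((1 / 2 - 1 / Real.sqrt (2 * Real.pi) *
        (x - x ^ 3 / 6 + x ^ 5 / 40)) * (2 * x))
        = x * Real.sqrt (2 * Real.pi) - 2 * (s - s ^ 2 / 6 + s ^ 3 / 40) := by
      rw [hs]; field_simp
    rw [e1, e2, hroot]
    linarith
  linarith

/-- On `[chernoffPoint, 1]` the difference of the two sides increases. -/
lemma gaussQ_ge_mills {x : ℝ} (hx : chernoffPoint ≤ x) : gaussDensity x / (2 * x) ≤ gaussQ x := by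
  rcases le_total 1 x with h1 | h1
  · exact gaussQ_ge_mills_of_one_le h1
  have hp := chernoffPoint_pos
  have mono : MonotoneOn (fun t => gaussQ t - gaussDensity t / (2 * t))
      (Set.Icc chernoffPoint 1) := by
    refine monotoneOn_of_deriv_nonneg (convex_Icc _ _) ?_ ?_ ?_
    · exact fun t ht => (hasDerivAt_millsGap (hp.trans_le ht.1)).continuousAt.continuousWithinAt
    · intro t ht
      rw [interior_Icc] at ht
      exact (hasDerivAt_millsGap (hp.trans ht.1)).differentiableAt.differentiableWithinAt
    · intro t ht
      rw [interior_Icc] at ht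
      have ht' := hp.trans ht.1
      rw [(hasDerivAt_millsGap ht').deriv]
      refine div_nonneg (mul_nonneg (gaussDensity_pos t).le ?_) (by positivity)
      nlinarith [ht.2]
  have := mono ⟨le_rfl, chernoffPoint_le_one⟩ ⟨hx, h1⟩ hx
  have h2 := gaussQ_chernoffPoint
  simp only at this
  linarith

/-- The constant is the value at `chernoffPoint` of `exp (x ^ 2)` times the bound in
`gaussQ_ge_mills`. -/
lemma chernoffConst_eq : chernoffConst = Real.exp (chernoffPoint ^ 2 / 2) /
    (2 * chernoffPoint * Real.sqrt (2 * Real.pi)) := by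
  have h1 : 1 - chernoffPoint ^ 2 = Real.pi / (Real.pi + 2) := by
    rw [chernoffPoint_sq]; field_simp; ring
  rw [mul_assoc, chernoffPoint_mul_sqrt, h1, chernoffPoint_sq, chernoffConst,
    ← inv_div Real.pi, Real.sqrt_inv]
  have h2 : Real.sqrt (Real.pi / (Real.pi + 2)) ≠ 0 := by positivity
  have h3 : 2 / (Real.pi + 2) / 2 = 1 / (Real.pi + 2) := by ring
  rw [h3]
  field_simp
  norm_num

lemma chernoffConst_le_half : chernoffConst ≤ 1 / 2 := by
  have hpi := Real.pi_gt_three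
  have h1 : Real.exp (1 / (Real.pi + 2)) ≤ 5 / 4 := by
    have h2 : 1 / (Real.pi + 2) ≤ 1 / 5 := one_div_le_one_div_of_le (by norm_num) (by linarith)
    have h3 := Real.add_one_le_exp (-(1 / 5) : ℝ)
    have h4 : Real.exp (1 / 5 : ℝ) ≤ 5 / 4 := by
      rw [Real.exp_neg] at h3
      have h5 := Real.exp_pos (1 / 5 : ℝ)
      rw [show (-(1 / 5) + 1 : ℝ) = 4 / 5 by norm_num, ← one_div, le_div_iff₀ h5] at h3
      linarith
    exact (Real.exp_le_exp.2 h2).trans h4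
  have h2 : Real.sqrt ((Real.pi + 2) / Real.pi) ≤ 13 / 10 := by
    rw [Real.sqrt_le_left (by norm_num), div_le_iff₀ (by positivity)]
    linarith
  have h3 : 0 ≤ Real.sqrt ((Real.pi + 2) / Real.pi) := Real.sqrt_nonneg _
  unfold chernoffConst
  nlinarith [Real.exp_pos (1 / (Real.pi + 2))]

/-- The right-hand side decreases on `(0, chernoffPoint]`. -/
lemma chernoffConst_le_of_mem {z : ℝ} (hz : 0 < z) (hz1 : z ≤ chernoffPoint) :
    chernoffConst ≤ Real.exp (z ^ 2 / 2) / (2 * z * Real.sqrt (2 * Real.pi)) := by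
  have hp := chernoffPoint_pos
  have hp1 := chernoffPoint_le_one
  rw [chernoffConst_eq]
  set x := chernoffPoint
  have h1 : 1 - z / x ≤ Real.log (x / z) := by
    have := Real.log_le_sub_one_of_pos (div_pos hz hp)
    have e : Real.log (x / z) = -Real.log (z / x) := by rw [← Real.log_inv, inv_div]
    rw [e]; linarith
  have h2 : (x ^ 2 - z ^ 2) / 2 ≤ 1 - z / x := by
    have : 1 - z / x = (x - z) / x := by field_simp
    rw [this, le_div_iff₀ hp]
    nlinarith [mul_nonneg (sub_nonneg.2 hz1) (sub_nonneg.2 (show (x + z) / 2 * x ≤ 1 by nlinarith))]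
  have h3 : Real.exp ((x ^ 2 - z ^ 2) / 2) ≤ x / z := by
    rw [← Real.log_le_log_iff (Real.exp_pos _) (by positivity), Real.log_exp]
    exact h2.trans h1
  have h4 : Real.exp (x ^ 2 / 2) = Real.exp (z ^ 2 / 2) * Real.exp ((x ^ 2 - z ^ 2) / 2) := by
    rw [← Real.exp_add]; ring_nf
  rw [div_le_div_iff₀ (by positivity) (by positivity), h4]
  rw [le_div_iff₀ hz] at h3
  have : 0 < Real.exp (z ^ 2 / 2) * (2 * Real.sqrt (2 * Real.pi)) := by positivity
  nlinarith

lemma gaussDensity_mul_exp {z : ℝ} (hz : 0 < z) : gaussDensity z / (2 * z) * Real.exp (z ^ 2)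
    = Real.exp (z ^ 2 / 2) / (2 * z * Real.sqrt (2 * Real.pi)) := by
  have : Real.exp (z ^ 2 / 2) = Real.exp (-z ^ 2 / 2) * Real.exp (z ^ 2) := by
    rw [← Real.exp_add]; ring_nf
  rw [this, gaussDensity]
  field_simp

lemma hasDerivAt_gaussQ_mul_exp (x : ℝ) : HasDerivAt (fun t => gaussQ t * Real.exp (t ^ 2))
    (Real.exp (x ^ 2) * (2 * x * gaussQ x - gaussDensity x)) x := by
  refine ((hasDerivAt_gaussQ x).mul (hasDerivAt_pow 2 x).exp).congr_deriv ?_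
  norm_num
  ring

/-- The lower bound of Chernoff type for the Gaussian tail. The function `Q(x) exp(x²)` increases
beyond `chernoffPoint`, and at a critical point `x` it has the value `exp(x²/2) / (2 √(2π) x)`. -/
lemma chernoffConst_le {x : ℝ} (hx : 0 ≤ x) : chernoffConst ≤ gaussQ x * Real.exp (x ^ 2) := by
  have hp := chernoffPoint_pos
  have hcrit : ∀ z, 0 < z → z ≤ chernoffPoint → gaussDensity z / (2 * z) ≤ gaussQ z →
      chernoffConst ≤ gaussQ z * Real.exp (z ^ 2) := fun z h0 h1 h2 => by
    refine (chernoffConst_le_of_mem h0 h1).trans ?_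
    rw [← gaussDensity_mul_exp h0]
    gcongr
  rcases le_total x chernoffPoint with h | h
  · obtain ⟨z, hz, hmin⟩ := isCompact_Icc.exists_isMinOn (Set.nonempty_Icc.2 hp.le)
      (f := fun t => gaussQ t * Real.exp (t ^ 2))
      fun t _ => (hasDerivAt_gaussQ_mul_exp t).continuousAt.continuousWithinAt
    refine le_trans ?_ (hmin (Set.mem_Icc.2 ⟨hx, h⟩))
    rcases hz.1.eq_or_lt with h0 | h0
    · simp only [← h0, gaussQ_zero]
      simpa using chernoffConst_le_half
    · refine hcrit z h0 hz.2 ?_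
      rcases hz.2.eq_or_lt with h1 | h1
      · rw [h1]; exact gaussQ_chernoffPoint
      · have hloc : IsLocalMin (fun t => gaussQ t * Real.exp (t ^ 2)) z :=
          hmin.isLocalMin (Icc_mem_nhds h0 h1)
        have hd := hloc.hasDerivAt_eq_zero (hasDerivAt_gaussQ_mul_exp z)
        have := (mul_eq_zero.1 hd).resolve_left (Real.exp_pos _).ne'
        rw [div_le_iff₀ (by positivity)]
        linarith
  · have mono : MonotoneOn (fun t => gaussQ t * Real.exp (t ^ 2)) (Set.Ici chernoffPoint) := by
      refine monotoneOn_of_deriv_nonneg (convex_Ici _)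
        (fun t _ => (hasDerivAt_gaussQ_mul_exp t).continuousAt.continuousWithinAt)
        (fun t _ => (hasDerivAt_gaussQ_mul_exp t).differentiableAt.differentiableWithinAt) ?_
      intro t ht
      rw [interior_Ici] at ht
      have ht' : chernoffPoint < t := ht
      rw [(hasDerivAt_gaussQ_mul_exp t).deriv]
      have := gaussQ_ge_mills ht'.le
      rw [div_le_iff₀ (by linarith)] at this
      exact mul_nonneg (Real.exp_pos _).le (by linarith)
    exact (hcrit _ hp le_rfl gaussQ_chernoffPoint).trans (mono (Set.self_mem_Ici) h h)

lemma chernoffConst_pos : 0 < chernoffConst := by unfold chernoffConst; positivity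

/-! ### The binary erasure channel -/

open MeasureTheory ProbabilityTheory

section
variable {M N : ℕ} (H : Matrix (Fin M) (Fin N) (ZMod 2))

/-- A set of variable nodes whose erasure erases the message from `c` to `v` after `l` iterations:
one further neighbour of `c`, together with sets that erase all its other incoming messages. -/
noncomputable def stallSet : ℕ → Fin M → Fin N → Finset (Fin N)
  | 0, _, _ => ∅
  | l + 1, c, v =>
      if h : ((varsOf H c).erase v).Nonempty then
        insert h.choose (((checksOf H h.choose).erase c).biUnion fun α => stallSet l α h.choose)
      else ∅

lemma twoArtanh_zero : twoArtanh 0 = 0 := by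
  rw [twoArtanh, if_neg (by norm_num), if_neg (by norm_num)]; simp

lemma tanhHalf_zero : tanhHalf 0 = 0 := by
  simp [tanhHalf]

/-- Erasures on `stallSet` erase the message: one vanishing factor makes the product vanish. -/
lemma checkToVar_eq_zero (hH : ∀ c, 2 ≤ (varsOf H c).card) {L : Fin N → EReal} (l : ℕ) :
    ∀ c v, (∀ u ∈ stallSet H l c v, L u = 0) → checkToVar H L l c v = 0 := by
  induction l with
  | zero => intro c v _; rfl
  | succ l ih =>
    intro c v hL
    have h : ((varsOf H c).erase v).Nonempty := by
      rw [← Finset.card_pos]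
      have := Finset.pred_card_le_card_erase (s := varsOf H c) (a := v)
      have := hH c
      omega
    rw [stallSet, dif_pos h] at hL
    rw [checkToVar, Finset.prod_eq_zero h.choose_spec, twoArtanh_zero]
    rw [varToCheck, hL _ (Finset.mem_insert_self _ _), Finset.sum_eq_zero, add_zero, tanhHalf_zero]
    intro α hα
    exact ih α _ fun u hu => hL u (Finset.mem_insert_of_mem (Finset.mem_biUnion.2 ⟨α, hα, hu⟩))

lemma mem_checksOf {c : Fin M} {v : Fin N} : c ∈ checksOf H v ↔ v ∈ varsOf H c := by
  simp [checksOf, varsOf]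

lemma card_stallSet_le {J : ℕ} (hJ : ∀ v, (checksOf H v).card = J) (l : ℕ) :
    ∀ c v, (stallSet H l c v).card ≤ ∑ k ∈ Finset.range l, (J - 1) ^ k := by
  induction l with
  | zero => intro c v; simp [stallSet]
  | succ l ih =>
    intro c v
    rw [stallSet]
    split_ifs with h
    · refine (Finset.card_insert_le _ _).trans ?_
      have hc : c ∈ checksOf H h.choose :=
        (mem_checksOf H).2 (Finset.mem_of_mem_erase h.choose_spec)
      have h2 := Finset.card_biUnion_le_card_mul ((checksOf H h.choose).erase c)
        (fun α => stallSet H l α h.choose) _ fun α _ => ih α _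
      rw [Finset.card_erase_of_mem hc, hJ] at h2
      rw [Finset.sum_range_succ']
      simp only [pow_succ', ← Finset.mul_sum, pow_zero]
      omega
    · simp

/-- If the outputs on a suitable set of at most `devSize J l` variable nodes are erased, then the
output message of `v` vanishes. -/
lemma exists_stallSet {J : ℕ} (hJ : ∀ v, (checksOf H v).card = J)
    (hH : ∀ c, 2 ≤ (varsOf H c).card) (l : ℕ) (v : Fin N) :
    ∃ S : Finset (Fin N), S.card ≤ devSize J l ∧
      ∀ L : Fin N → EReal, (∀ u ∈ S, L u = 0) → bpOutput H L l v = 0 := by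
  refine ⟨insert v ((checksOf H v).biUnion fun α => stallSet H l α v), ?_, fun L hL => ?_⟩
  · refine (Finset.card_insert_le _ _).trans ?_
    have h2 := Finset.card_biUnion_le_card_mul (checksOf H v)
      (fun α => stallSet H l α v) _ fun α _ => card_stallSet_le H hJ l α _
    rw [hJ] at h2
    rw [devSize, ← Finset.mul_sum]
    omega
  · rw [bpOutput, hL _ (Finset.mem_insert_self _ _), Finset.sum_eq_zero, add_zero]
    intro α hα
    exact checkToVar_eq_zero H hH l α v fun u hu =>
      hL u (Finset.mem_insert_of_mem (Finset.mem_biUnion.2 ⟨α, hα, hu⟩))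

end

instance : MeasurableSingletonClass (ZMod 2 ⊕ Unit) where
  measurableSet_singleton _ :=
    measurableSet_sum_iff.2 ⟨(Set.toFinite _).measurableSet, (Set.toFinite _).measurableSet⟩

lemma bec_law_real {ε : ℝ} (h0 : 0 ≤ ε) (x : ZMod 2) :
    ((bec ε).law x).real {Sum.inr ()} = ε := by
  rw [measureReal_def, Channel.law, withDensity_apply _ (measurableSet_singleton _)]
  simp [bec, h0]

lemma bec_isProbabilityMeasure {ε : ℝ} (h0 : 0 ≤ ε) (h1 : ε ≤ 1) (x : ZMod 2) :
    IsProbabilityMeasure ((bec ε).law x) := by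
  refine ⟨?_⟩
  rw [Channel.law, withDensity_apply _ MeasurableSet.univ, Measure.restrict_univ,
    show (bec ε).ref = Measure.count from rfl, lintegral_count, tsum_fintype, Fintype.sum_sum_type]
  simp only [bec, Finset.univ_unique, Finset.sum_singleton]
  rw [Finset.sum_ite_eq' Finset.univ x, if_pos (Finset.mem_univ x),
    ← ENNReal.ofReal_add (by linarith) h0]
  simp

lemma bec_llr_erasure {ε : ℝ} (h0 : 0 < ε) : (bec ε).llr (Sum.inr ()) = 0 := by
  simp only [Channel.llr, bec]
  rw [ENNReal.div_self (by simpa using h0) ENNReal.ofReal_ne_top, ENNReal.log_one]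

lemma bitError_nonneg {Y : Type} [MeasurableSpace Y] (W : Channel Y) {τ : ℝ} (hτ : 0 ≤ τ) (l : ℕ)
    {M N : ℕ} (H : Matrix (Fin M) (Fin N) (ZMod 2)) (s : Fin N → ZMod 2) (v : Fin N) :
    0 ≤ bitError W τ l H s v := by
  unfold bitError; positivity

lemma averageBER_nonneg {Y : Type} [MeasurableSpace Y] (W : Channel Y) {τ : ℝ} (hτ : 0 ≤ τ)
    (l N M J K : ℕ) : 0 ≤ averageBER W τ l N M J K := by
  unfold averageBER ber
  refine div_nonneg (Finset.sum_nonneg fun H _ => div_nonneg (Finset.sum_nonneg fun s _ =>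
    div_nonneg (Finset.sum_nonneg fun v _ => bitError_nonneg W hτ l H s v) ?_) ?_) ?_ <;> positivity

/-- The lower bound for the erasure channel holds for each graph, each codeword and each bit. -/
lemma bec_bitError_ge {ε : ℝ} (h0 : 0 < ε) (h1 : ε ≤ 1) {M N J : ℕ}
    {H : Matrix (Fin M) (Fin N) (ZMod 2)} (hJ : ∀ v, (checksOf H v).card = J)
    (hH : ∀ c, 2 ≤ (varsOf H c).card) {l n : ℕ} (hn : min (devSize J l) N ≤ n)
    (s : Fin N → ZMod 2) (v : Fin N) : ε ^ n ≤ bitError (bec ε) 1 l H s v := by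
  obtain ⟨S, hS, hB⟩ := exists_stallSet H hJ hH l v
  have hpr : ∀ i, IsProbabilityMeasure ((bec ε).law (s i)) := fun i =>
    bec_isProbabilityMeasure h0.le h1 _
  have hSn : S.card ≤ n := by
    have := Finset.card_le_univ S
    rw [Fintype.card_fin] at this
    omega
  calc ε ^ n ≤ ε ^ S.card := pow_le_pow_of_le_one h0.le h1 hSn
    _ = ((bec ε).wordLaw s).real {y | ∀ i ∈ S, y i ∈ ({Sum.inr ()} : Set (ZMod 2 ⊕ Unit))} := by
      rw [Channel.wordLaw, pi_real_forall_mem]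
      simp only [bec_law_real h0.le, Finset.prod_const]
    _ ≤ ((bec ε).wordLaw s).real {y | bpOutput H (fun i => (bec ε).llr (y i)) l v = 0} := by
      have : IsProbabilityMeasure ((bec ε).wordLaw s) := by unfold Channel.wordLaw; infer_instance
      refine measureReal_mono (fun y hy => hB _ fun u hu => ?_)
      have := hy u hu
      rw [Set.mem_singleton_iff] at this
      simp only [this, bec_llr_erasure h0]
    _ ≤ bitError (bec ε) 1 l H s v := by
      unfold bitError
      rw [one_mul]
      exact le_add_of_nonneg_left measureReal_nonneg

/-! ### The Gaussian channel with strong noise -/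

open MeasureTheory ProbabilityTheory

lemma sinh_le_mul_cosh {x : ℝ} (hx : 0 ≤ x) : Real.sinh x ≤ x * Real.cosh x := by
  have hd : ∀ t : ℝ, HasDerivAt (fun x => x * Real.cosh x - Real.sinh x) (t * Real.sinh t) t :=
    fun t => (((hasDerivAt_id t).mul (Real.hasDerivAt_cosh t)).sub
      (Real.hasDerivAt_sinh t)).congr_deriv (by simp)
  have mono : MonotoneOn (fun x => x * Real.cosh x - Real.sinh x) (Set.Ici 0) := by
    refine monotoneOn_of_deriv_nonneg (convex_Ici 0)
      (fun t _ => (hd t).continuousAt.continuousWithinAt)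
      (fun t _ => (hd t).differentiableAt.differentiableWithinAt) fun t ht => ?_
    rw [interior_Ici] at ht
    rw [(hd t).deriv]
    exact mul_nonneg (le_of_lt ht) (Real.sinh_nonneg_iff.2 (le_of_lt ht))
  have := mono Set.self_mem_Ici hx hx
  simp at this
  linarith

lemma abs_tanh_le (x : ℝ) : |Real.tanh x| ≤ |x| := by
  have h : ∀ x : ℝ, 0 ≤ x → |Real.tanh x| ≤ x := fun x hx => by
    have hc := Real.cosh_pos x
    rw [Real.tanh_eq_sinh_div_cosh, abs_of_nonneg (div_nonneg (Real.sinh_nonneg_iff.2 hx) hc.le),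
      div_le_iff₀ hc]
    exact sinh_le_mul_cosh hx
  rcases le_total 0 x with hx | hx
  · rw [abs_of_nonneg hx]; exact h x hx
  · have := h (-x) (by linarith)
    rwa [Real.tanh_neg, abs_neg, ← abs_of_nonpos hx] at this

lemma abs_artanh_le {t : ℝ} (ht : |t| ≤ 1 / 2) : |Real.artanh t| ≤ 2 * |t| := by
  have h : ∀ t : ℝ, 0 ≤ t → t ≤ 1 / 2 → |Real.artanh t| ≤ 2 * t := fun t h0 h1 => by
    rw [Real.artanh_eq_half_log ⟨by linarith, by linarith⟩]
    have hpos : 0 < 1 - t := by linarith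
    have hge : 1 ≤ (1 + t) / (1 - t) := by rw [le_div_iff₀ hpos]; linarith
    have hlog := Real.log_le_sub_one_of_pos (zero_lt_one.trans_le hge)
    have h4 : (1 + t) / (1 - t) ≤ 1 + 4 * t := by rw [div_le_iff₀ hpos]; nlinarith
    rw [abs_of_nonneg (mul_nonneg (by norm_num) (Real.log_nonneg hge))]
    linarith
  rcases le_total 0 t with h0 | h0
  · rw [abs_of_nonneg h0] at ht ⊢; exact h t h0 ht
  · rw [abs_of_nonpos h0] at ht ⊢
    have := h (-t) (by linarith) ht
    rwa [artanh_neg_eq, abs_neg] at this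

/-- A product of at least two factors of modulus at most one is bounded by two of them. -/
lemma exists_pair_abs_prod_le {ι : Type*} {s : Finset ι} (hs : 2 ≤ s.card) {f : ι → ℝ}
    (hf : ∀ i ∈ s, |f i| ≤ 1) : ∃ a ∈ s, ∃ b ∈ s, a ≠ b ∧ |∏ i ∈ s, f i| ≤ |f a| * |f b| := by
  classical
  obtain ⟨a, ha, b, hb, hab⟩ := Finset.one_lt_card.1 (show 1 < s.card by omega)
  refine ⟨a, ha, b, hb, hab, ?_⟩
  have hb' : b ∈ s.erase a := Finset.mem_erase.2 ⟨hab.symm, hb⟩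
  rw [← Finset.mul_prod_erase s _ ha, ← Finset.mul_prod_erase _ _ hb', abs_mul, abs_mul,
    Finset.abs_prod, ← mul_assoc]
  refine mul_le_of_le_one_right (by positivity) (Finset.prod_le_one (fun _ _ => abs_nonneg _) ?_)
  exact fun i hi => hf i (Finset.mem_of_mem_erase (Finset.mem_of_mem_erase hi))

section
variable {M N J : ℕ} {H : Matrix (Fin M) (Fin N) (ZMod 2)} {L : Fin N → ℝ} {δ : ℝ}

/-- The check node update is quadratic: two of the at least two factors `tanh` are bounded by `δ`.
The second bound involves only the channel messages of the neighbours of `c` other than `v`. -/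
lemma abs_check_update_le (hH : ∀ c, 3 ≤ (varsOf H c).card) (hJ : ∀ v, (checksOf H v).card = J)
    (hδ0 : 0 ≤ δ) (hδ : 4 * J * δ ≤ 1) (hδ1 : δ ≤ 1 / 2) (hL : ∀ u, |L u| ≤ δ) (l : ℕ)
    (hmsg : ∀ c v, |chkMsg H L l c v| ≤ 4 * δ ^ 2) (c : Fin M) (v : Fin N) :
    |chkMsg H L (l + 1) c v| ≤ 4 * δ ^ 2 ∧ |chkMsg H L (l + 1) c v|
      ≤ ∑ β ∈ (varsOf H c).erase v, (L β ^ 2 + 16 * J ^ 2 * δ ^ 4) := by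
  set x : Fin N → ℝ := fun β => L β + ∑ α ∈ (checksOf H β).erase c, chkMsg H L l α β with hx
  have hsum : ∀ β, |∑ α ∈ (checksOf H β).erase c, chkMsg H L l α β| ≤ 4 * J * δ ^ 2 := fun β => by
    refine (Finset.abs_sum_le_sum_abs _ _).trans
      ((Finset.sum_le_card_nsmul _ _ (4 * δ ^ 2) fun α _ => hmsg α β).trans ?_)
    have h1 : (((checksOf H β).erase c).card : ℝ) ≤ J := by
      have := Finset.card_erase_le (s := checksOf H β) (a := c)
      rw [hJ] at this
      exact_mod_cast this
    rw [nsmul_eq_mul]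
    nlinarith [sq_nonneg δ]
  have hxb : ∀ β, |x β| ≤ |L β| + 4 * J * δ ^ 2 := fun β =>
    (abs_add_le _ _).trans (by linarith [hsum β])
  have hxd : ∀ β, |x β| ≤ 2 * δ := fun β => by
    have := hxb β
    have := hL β
    nlinarith
  have hcard : 2 ≤ ((varsOf H c).erase v).card := by
    have := Finset.pred_card_le_card_erase (s := varsOf H c) (a := v)
    have := hH c
    omega
  obtain ⟨a, ha, b, hb, hab, hle⟩ := exists_pair_abs_prod_le hcard
    (f := fun β => Real.tanh (x β / 2)) fun β _ => (abs_tanh_lt_one _).le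
  have ht : ∀ β, |Real.tanh (x β / 2)| ≤ |x β| / 2 := fun β => by
    have := abs_tanh_le (x β / 2)
    rwa [abs_div, abs_two] at this
  have hprod : |∏ β ∈ (varsOf H c).erase v, Real.tanh (x β / 2)| ≤ (|x a| / 2) * (|x b| / 2) :=
    hle.trans (mul_le_mul (ht a) (ht b) (abs_nonneg _) (by positivity))
  have hsmall : (|x a| / 2) * (|x b| / 2) ≤ δ ^ 2 := by
    have h1 := hxd a
    have h2 := hxd b
    calc (|x a| / 2) * (|x b| / 2) ≤ δ * δ := mul_le_mul (by linarith) (by linarith)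
          (by positivity) hδ0
      _ = δ ^ 2 := by ring
  have hart := abs_artanh_le (hprod.trans (hsmall.trans (by nlinarith)))
  have hc : |chkMsg H L (l + 1) c v| ≤ |x a| * |x b| := by
    rw [chkMsg, abs_mul, abs_two]
    linarith
  refine ⟨hc.trans (by linarith), hc.trans ?_⟩
  have hpair : ({a, b} : Finset (Fin N)) ⊆ (varsOf H c).erase v := by
    intro u hu
    rw [Finset.mem_insert, Finset.mem_singleton] at hu
    rcases hu with rfl | rfl
    exacts [ha, hb]
  refine le_trans ?_ (Finset.sum_le_sum_of_subset_of_nonneg hpair fun β _ _ => by positivity)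
  rw [Finset.sum_pair hab]
  have sq : ∀ β, |x β| ^ 2 ≤ 2 * (L β ^ 2 + 16 * J ^ 2 * δ ^ 4) := fun β => by
    have h1 := hxb β
    have h2 : |x β| ^ 2 ≤ (|L β| + 4 * J * δ ^ 2) ^ 2 := by gcongr
    have h3 := sq_nonneg (|L β| - 4 * J * δ ^ 2)
    have h4 := sq_abs (L β)
    nlinarith
  have := sq a
  have := sq b
  nlinarith [sq_nonneg (|x a| - |x b|)]

/-- If all check nodes have degree at least three, then small messages are contracted. -/
lemma abs_chkMsg_le (hH : ∀ c, 3 ≤ (varsOf H c).card) (hJ : ∀ v, (checksOf H v).card = J)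
    (hδ0 : 0 ≤ δ) (hδ : 4 * J * δ ≤ 1) (hδ1 : δ ≤ 1 / 2) (hL : ∀ u, |L u| ≤ δ) (l : ℕ) :
    ∀ c v, |chkMsg H L l c v| ≤ 4 * δ ^ 2 := by
  induction l with
  | zero => intro c v; simp only [chkMsg, abs_zero]; positivity
  | succ l ih => exact fun c v => (abs_check_update_le hH hJ hδ0 hδ hδ1 hL l ih c v).1

/-- The bound of the messages to `v` in terms of the channel messages of the other nodes. -/
noncomputable def msgBound (H : Matrix (Fin M) (Fin N) (ZMod 2)) (J : ℕ) (δ : ℝ) (v : Fin N)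
    (L : Fin N → ℝ) : ℝ :=
  ∑ c ∈ checksOf H v, ∑ β ∈ (varsOf H c).erase v, (L β ^ 2 + 16 * J ^ 2 * δ ^ 4)

lemma msgBound_nonneg (v : Fin N) : 0 ≤ msgBound H J δ v L :=
  Finset.sum_nonneg fun _ _ => Finset.sum_nonneg fun _ _ => by positivity

/-- The correction to the channel message of `v` is bounded by a function of the other channel messages,
hence it is independent of the channel message of `v`. -/
lemma bpOut_le (hH : ∀ c, 3 ≤ (varsOf H c).card) (hJ : ∀ v, (checksOf H v).card = J)
    (hδ0 : 0 ≤ δ) (hδ : 4 * J * δ ≤ 1) (hδ1 : δ ≤ 1 / 2) (hL : ∀ u, |L u| ≤ δ) (l : ℕ)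
    (v : Fin N) : bpOut H L l v ≤ L v + msgBound H J δ v L := by
  rw [bpOut, msgBound]
  gcongr with c hc
  cases l with
  | zero => simp only [chkMsg]; exact Finset.sum_nonneg fun _ _ => by positivity
  | succ l => exact (le_abs_self _).trans (abs_check_update_le hH hJ hδ0 hδ hδ1 hL l
      (abs_chkMsg_le hH hJ hδ0 hδ hδ1 hL l) c v).2

end

open MeasureTheory ProbabilityTheory

/-- A comparison of independent random variables, where the distribution function of the first one
has an affine lower bound. -/
lemma real_lt_neg_ge {Ω : Type*} [MeasurableSpace Ω] {P : Measure Ω} [IsProbabilityMeasure P]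
    {X R : Ω → ℝ} (hX : Measurable X) (hR : Measurable R) (hXR : IndepFun X R P)
    (hint : Integrable R P) (hR0 : ∀ ω, 0 ≤ R ω) {a b : ℝ}
    (h : ∀ r, 0 ≤ r → a - b * r ≤ (P.map X).real (Set.Iio (-r))) :
    a - b * ∫ ω, R ω ∂P ≤ P.real {ω | X ω < -R ω} := by
  have hp := (indepFun_iff_map_prod_eq_prod_map_map hX.aemeasurable hR.aemeasurable).1 hXR
  have : IsProbabilityMeasure (P.map X) := Measure.isProbabilityMeasure_map hX.aemeasurable
  have : IsProbabilityMeasure (P.map R) := Measure.isProbabilityMeasure_map hR.aemeasurable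
  have hms : MeasurableSet {p : ℝ × ℝ | p.1 < -p.2} :=
    measurableSet_lt measurable_fst measurable_snd.neg
  have h1 : P {ω | X ω < -R ω} = ∫⁻ r, (P.map X) (Set.Iio (-r)) ∂(P.map R) := by
    have h2 : P {ω | X ω < -R ω} = (P.map fun ω => (X ω, R ω)) {p : ℝ × ℝ | p.1 < -p.2} := by
      rw [Measure.map_apply (hX.prodMk hR) hms]; rfl
    rw [h2, hp, Measure.prod_apply_symm hms]
    rfl
  have hmeas : Measurable fun r : ℝ => (P.map X) (Set.Iio (-r)) := by
    have := measurable_measure_prodMk_right (μ := P.map X) hms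
    exact this
  rw [measureReal_def, h1, ← integral_toReal hmeas.aemeasurable
    (Filter.Eventually.of_forall fun _ => measure_lt_top _ _), integral_map hR.aemeasurable
    hmeas.ennreal_toReal.aestronglyMeasurable]
  have h3 : a - b * ∫ ω, R ω ∂P = ∫ ω, (a - b * R ω) ∂P := by
    rw [integral_sub (integrable_const _) (hint.const_mul _), integral_const_mul]
    simp
  rw [h3]
  refine integral_mono ((integrable_const _).sub (hint.const_mul _)) ?_ fun ω => h _ (hR0 ω)
  refine Integrable.of_bound (hmeas.ennreal_toReal.comp hR).aestronglyMeasurable 1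
    (Filter.Eventually.of_forall fun ω => ?_)
  rw [Real.norm_eq_abs, abs_of_nonneg ENNReal.toReal_nonneg]
  exact measureReal_le_one

lemma gaussianReal_abs_gt_le {σ : ℝ} (hσ : 4 ≤ σ) :
    (gaussianReal 1 (Real.toNNReal (σ ^ 2))).real {y | 1 / Real.sqrt σ < |awgnLLR σ y|}
      ≤ Real.exp (-(σ / 32)) := by
  have hσ0 : 0 < σ := by linarith
  have hs : 0 < Real.sqrt σ := Real.sqrt_pos.2 hσ0
  have hss : Real.sqrt σ * Real.sqrt σ = σ := Real.mul_self_sqrt hσ0.le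
  have hs2 : 2 ≤ Real.sqrt σ := Real.le_sqrt_of_sq_le (by linarith)
  set a := σ * Real.sqrt σ / 2 with ha
  have hsub : {y | 1 / Real.sqrt σ < |awgnLLR σ y|} ⊆ Set.Iio (-a) ∪ Set.Ioi a := by
    intro y hy
    have hy' : 1 / Real.sqrt σ < |awgnLLR σ y| := hy
    rw [awgnLLR, abs_mul, abs_of_pos (by positivity : 0 < 2 / σ ^ 2)] at hy'
    have h1 : a < |y| := by
      have e : a = σ ^ 2 / 2 * (1 / Real.sqrt σ) := by
        rw [ha]; field_simp; rw [Real.sq_sqrt hσ0.le]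
      rw [e]
      calc σ ^ 2 / 2 * (1 / Real.sqrt σ) < σ ^ 2 / 2 * (2 / σ ^ 2 * |y|) := by gcongr
        _ = |y| := by field_simp
    rcases lt_abs.1 h1 with h | h
    · exact Or.inr h
    · exact Or.inl (by simp only [Set.mem_Iio]; linarith)
  have hq : Real.sqrt σ / 4 ≤ (a - 1) / σ := by
    rw [le_div_iff₀ hσ0, ha]
    nlinarith
  have hq2 : (a - 1) / σ ≤ (1 - -a) / σ :=
    div_le_div_of_nonneg_right (by linarith) hσ0.le
  calc _ ≤ (gaussianReal 1 (Real.toNNReal (σ ^ 2))).real (Set.Iio (-a) ∪ Set.Ioi a) :=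
        measureReal_mono hsub
    _ ≤ gaussQ ((1 - -a) / σ) + gaussQ ((a - 1) / σ) := by
        rw [← gaussianReal_Iio _ _ hσ0, ← gaussianReal_Ioi _ _ hσ0]
        exact measureReal_union_le _ _
    _ ≤ gaussQ (Real.sqrt σ / 4) + gaussQ (Real.sqrt σ / 4) :=
        add_le_add (gaussQ_antitone (hq.trans hq2)) (gaussQ_antitone hq)
    _ ≤ Real.exp (-((Real.sqrt σ / 4) ^ 2 / 2)) := by
        have := gaussQ_le_exp (a := Real.sqrt σ / 4) (by positivity)
        linarith
    _ = Real.exp (-(σ / 32)) := by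
        congr 1
        rw [div_pow, Real.sq_sqrt hσ0.le]; ring

lemma integral_sq_gaussianReal (m : ℝ) (v : NNReal) :
    Integrable (fun y => y ^ 2) (gaussianReal m v) ∧ ∫ y, y ^ 2 ∂(gaussianReal m v) = m ^ 2 + v := by
  have hL : MemLp id 2 (gaussianReal m v) := memLp_id_gaussianReal 2
  have h1 := variance_eq_sub hL
  rw [variance_id_gaussianReal] at h1
  have h2 : ∫ y, id y ∂(gaussianReal m v) = m := integral_id_gaussianReal
  have h3 : ∫ y, (id ^ 2 : ℝ → ℝ) y ∂(gaussianReal m v) = ∫ y, y ^ 2 ∂(gaussianReal m v) := rfl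
  rw [h2, h3] at h1
  exact ⟨hL.integrable_sq, by linarith⟩

section
variable {M N K J : ℕ} {g : Fin M × Fin K → Fin N} {σ : ℝ}

/-- The channel messages have second moments of order `σ ^ (-2)`. -/
lemma integral_llr_sq (hσ : 1 ≤ σ) (β : Fin N) :
    Integrable (fun y : Fin N → ℝ => awgnLLR σ (y β) ^ 2)
      (zeroLaw (gaussianReal 1 (Real.toNNReal (σ ^ 2))) N) ∧
    ∫ y : Fin N → ℝ, awgnLLR σ (y β) ^ 2
      ∂(zeroLaw (gaussianReal 1 (Real.toNNReal (σ ^ 2))) N) ≤ 8 / σ ^ 2 := by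
  have hσ0 : 0 < σ := by linarith
  obtain ⟨h1, h2⟩ := integral_sq_gaussianReal 1 (Real.toNNReal (σ ^ 2))
  have hmp := measurePreserving_eval (fun _ : Fin N => gaussianReal 1 (Real.toNNReal (σ ^ 2))) β
  have h3 : Integrable (fun y => awgnLLR σ y ^ 2) (gaussianReal 1 (Real.toNNReal (σ ^ 2))) := by
    simp only [awgnLLR, mul_pow]
    exact h1.const_mul _
  have h4 : ∫ y, awgnLLR σ y ^ 2 ∂(gaussianReal 1 (Real.toNNReal (σ ^ 2)))
      = (2 / σ ^ 2) ^ 2 * (1 + σ ^ 2) := by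
    simp only [awgnLLR, mul_pow]
    rw [integral_const_mul, h2, Real.coe_toNNReal _ (by positivity)]
    ring
  refine ⟨(hmp.integrable_comp h3.aestronglyMeasurable).2 h3, ?_⟩
  have h5 : ∫ y : Fin N → ℝ, awgnLLR σ (y β) ^ 2
      ∂(zeroLaw (gaussianReal 1 (Real.toNNReal (σ ^ 2))) N)
      = ∫ y, awgnLLR σ y ^ 2 ∂(gaussianReal 1 (Real.toNNReal (σ ^ 2))) := by
    have := integral_map hmp.aemeasurable (f := fun y => awgnLLR σ y ^ 2)
      (by rw [hmp.map_eq]; exact h3.aestronglyMeasurable)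
    rw [hmp.map_eq] at this
    exact this.symm
  rw [h5, h4, div_pow, div_mul_eq_mul_div, div_le_div_iff₀ (by positivity) (by positivity)]
  have : 1 ≤ σ ^ 2 := one_le_pow₀ hσ
  nlinarith [sq_nonneg σ, mul_pos (pow_pos hσ0 2) (pow_pos hσ0 2)]

/-- With strong noise, belief propagation improves the channel decision by `O(1 / σ)` at most:
all messages are smaller than the channel message by a factor of order `σ`. This holds for each
graph and each number of iterations. -/
lemma nodeError_ge_of_strong_noise (hg : IsSocket J g) (hJ : 1 ≤ J) (hK : 3 ≤ K)
    (hσ : 16 * (J : ℝ) ^ 2 ≤ σ) (l : ℕ) (v : Fin N) :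
    1 / 2 - (1 + J * K * (4 + 8 * (J : ℝ) ^ 2)) / (2 * σ) - N * Real.exp (-(σ / 32))
      ≤ nodeError ((biAWGN σ).law 0) (awgnLLR σ) g l v := by
  have hJ' : (1 : ℝ) ≤ J := by exact_mod_cast hJ
  have hσ16 : 16 ≤ σ := by nlinarith
  have hσ0 : 0 < σ := by linarith
  have hs : 0 < Real.sqrt σ := Real.sqrt_pos.2 hσ0
  have hs4 : 4 * J ≤ Real.sqrt σ := Real.le_sqrt_of_sq_le (by nlinarith)
  set H := matOf g with hH
  have hH3 : ∀ c, 3 ≤ (varsOf H c).card := fun c => by rwa [hH, card_varsOf_matOf hg]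
  have hHJ : ∀ v, (checksOf H v).card = J := card_checksOf_matOf hg
  -- The channel messages are of order `1 / σ`, so that all of them are below `δ` most likely.
  set δ := 1 / Real.sqrt σ with hδ
  have hδ0 : 0 ≤ δ := by positivity
  have hδJ : 4 * J * δ ≤ 1 := by rw [hδ, mul_one_div, div_le_one hs]; exact hs4
  have hδ1 : δ ≤ 1 / 2 := by nlinarith
  have hδ4 : δ ^ 4 = 1 / σ ^ 2 := by
    rw [hδ, div_pow, one_pow, show Real.sqrt σ ^ 4 = (Real.sqrt σ ^ 2) ^ 2 by ring,
      Real.sq_sqrt hσ0.le]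
  set ν := gaussianReal 1 (Real.toNNReal (σ ^ 2)) with hν
  rw [nodeError, awgn_law_zero hσ0, ← hν]
  have mΛ : Measurable (awgnLLR σ) := (awgn_symLLR hσ0).1.meas_llr
  -- The bound of the correction, on the scale of the channel output, is independent of the output
  -- at `v`.
  set R : (Fin N → ℝ) → ℝ := fun y =>
    σ ^ 2 / 2 * msgBound H J δ v (fun i => awgnLLR σ (y i)) with hR
  have mR : Measurable R := by
    refine Measurable.const_mul (Finset.measurable_fun_sum _ fun c _ =>
      Finset.measurable_fun_sum _ fun β _ => ?_) _
    exact ((mΛ.comp (measurable_pi_apply β)).pow_const 2).add_const _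
  have hsupp : SupportedOn R (Finset.univ.erase v) := by
    intro y y' h
    simp only [hR, msgBound]
    congr 1
    refine Finset.sum_congr rfl fun c _ => Finset.sum_congr rfl fun β hβ => ?_
    rw [h β (Finset.mem_erase.2 ⟨Finset.ne_of_mem_erase hβ, Finset.mem_univ _⟩)]
  have hind : IndepFun (fun y : Fin N → ℝ => y v) R (zeroLaw ν N) :=
    indepFun_of_supportedOn (A := {v}) (measurable_pi_apply v) mR (by simp)
      (fun y y' h => h v (by simp)) hsupp
  have iterm : ∀ β : Fin N, Integrable (fun y : Fin N → ℝ => awgnLLR σ (y β) ^ 2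
      + 16 * (J : ℝ) ^ 2 * δ ^ 4) (zeroLaw ν N) := fun β =>
    (integral_llr_sq (by linarith) β).1.add (integrable_const _)
  have iR : Integrable R (zeroLaw ν N) :=
    (integrable_finsetSum _ fun c _ => integrable_finsetSum _ fun β _ => iterm β).const_mul _
  have ER : ∫ y, R y ∂(zeroLaw ν N) ≤ J * K * (4 + 8 * (J : ℝ) ^ 2) := by
    have h1 : ∀ β : Fin N, ∫ y : Fin N → ℝ, (awgnLLR σ (y β) ^ 2
        + 16 * (J : ℝ) ^ 2 * δ ^ 4) ∂(zeroLaw ν N) ≤ (8 + 16 * (J : ℝ) ^ 2) / σ ^ 2 := fun β => by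
      rw [integral_add (integral_llr_sq (by linarith) β).1 (integrable_const _), integral_const,
        probReal_univ, one_smul, hδ4, add_div]
      have := (integral_llr_sq (N := N) (σ := σ) (by linarith) β).2
      rw [mul_one_div]
      linarith
    have h2 : ∫ y, R y ∂(zeroLaw ν N) = σ ^ 2 / 2 * ∑ c ∈ checksOf H v,
        ∑ β ∈ (varsOf H c).erase v, ∫ y : Fin N → ℝ, (awgnLLR σ (y β) ^ 2
          + 16 * (J : ℝ) ^ 2 * δ ^ 4) ∂(zeroLaw ν N) := by
      simp only [hR, msgBound]
      rw [integral_const_mul, integral_finsetSum _ fun c _ =>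
        integrable_finsetSum _ fun β _ => iterm β]
      congr 1
      exact Finset.sum_congr rfl fun c _ => integral_finsetSum _ fun β _ => iterm β
    have hB0 : 0 ≤ (8 + 16 * (J : ℝ) ^ 2) / σ ^ 2 := by positivity
    have h3 : ∀ c ∈ checksOf H v, ∑ β ∈ (varsOf H c).erase v, ∫ y : Fin N → ℝ,
        (awgnLLR σ (y β) ^ 2 + 16 * (J : ℝ) ^ 2 * δ ^ 4) ∂(zeroLaw ν N)
        ≤ K * ((8 + 16 * (J : ℝ) ^ 2) / σ ^ 2) := fun c _ => by
      refine (Finset.sum_le_card_nsmul _ _ _ fun β _ => h1 β).trans ?_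
      rw [nsmul_eq_mul]
      have hc : (((varsOf H c).erase v).card : ℝ) ≤ K := by
        have := Finset.card_erase_le (s := varsOf H c) (a := v)
        rw [hH, card_varsOf_matOf hg] at this
        exact_mod_cast this
      gcongr
    have h4 := Finset.sum_le_card_nsmul _ _ _ h3
    rw [hHJ, nsmul_eq_mul] at h4
    rw [h2]
    calc _ ≤ σ ^ 2 / 2 * (J * (K * ((8 + 16 * (J : ℝ) ^ 2) / σ ^ 2))) := by gcongr
      _ = _ := by field_simp; ring
  have hcdf : ∀ r, 0 ≤ r → (1 / 2 - 1 / (2 * σ)) - 1 / (2 * σ) * r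
      ≤ ((zeroLaw ν N).map fun y => y v).real (Set.Iio (-r)) := fun r hr => by
    rw [(measurePreserving_eval (fun _ : Fin N => ν) v).map_eq, hν, gaussianReal_Iio _ _ hσ0]
    refine le_trans (le_of_eq ?_) (gaussQ_ge_half_sub (div_nonneg (by linarith) hσ0.le))
    field_simp
    ring
  have hE := real_lt_neg_ge (measurable_pi_apply v) mR hind iR
    (fun y => mul_nonneg (by positivity) (msgBound_nonneg v)) hcdf
  -- On `E`, the output at `v` is so negative that no correction can repair it, unless one of the
  -- channel messages is large (the events `G u`).
  set E : Set (Fin N → ℝ) := {y | y v < -R y} with hEdef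
  have mE : MeasurableSet E := measurableSet_lt (measurable_pi_apply v) mR.neg
  set G : Fin N → Set (Fin N → ℝ) := fun u => {y | δ < |awgnLLR σ (y u)|} with hG
  have mG0 : MeasurableSet {y | δ < |awgnLLR σ y|} :=
    measurableSet_lt measurable_const (measurable_abs.comp mΛ)
  have mG : ∀ u, MeasurableSet (G u) := fun u => by
    have hu : Measurable fun y : Fin N → ℝ => y u := measurable_pi_apply u
    exact hu mG0
  have hGr : ∀ u, (zeroLaw ν N).real (G u) ≤ Real.exp (-(σ / 32)) := fun u => by
    have hmp := measurePreserving_eval (fun _ : Fin N => ν) u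
    have : (zeroLaw ν N).real (G u) = ν.real {y | δ < |awgnLLR σ y|} := by
      rw [measureReal_def, measureReal_def, ← hmp.measure_preimage mG0.nullMeasurableSet]
      rfl
    rw [this]
    exact gaussianReal_abs_gt_le (by linarith)
  have point : ∀ y, E.indicator (fun _ => (1 : ℝ)) y - ∑ u, (G u).indicator (fun _ => (1 : ℝ)) y
      ≤ bitFault (awgnLLR σ) g l v y := by
    intro y
    have hsum0 : ∀ u, 0 ≤ (G u).indicator (fun _ => (1 : ℝ)) y := fun u =>
      Set.indicator_nonneg (fun _ _ => zero_le_one) _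
    have hbf : 0 ≤ bitFault (awgnLLR σ) g l v y := half_nonneg _
    by_cases hy : y ∈ E
    · rw [Set.indicator_of_mem hy]
      by_cases hu : ∃ u, y ∈ G u
      · obtain ⟨u, hu⟩ := hu
        have := Finset.single_le_sum (fun u _ => hsum0 u) (Finset.mem_univ u)
        rw [Set.indicator_of_mem hu] at this
        linarith
      · push Not at hu
        have hL : ∀ u, |awgnLLR σ (y u)| ≤ δ := fun u => not_lt.1 (hu u)
        have hB := bpOut_le (L := fun i => awgnLLR σ (y i)) hH3 hHJ hδ0 hδJ hδ1 hL l v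
        have hneg : bpOut H (fun i => awgnLLR σ (y i)) l v < 0 := by
          refine hB.trans_lt ?_
          have hy' : y v < -(σ ^ 2 / 2 * msgBound H J δ v (fun i => awgnLLR σ (y i))) := hy
          have : awgnLLR σ (y v) < 2 / σ ^ 2 *
              -(σ ^ 2 / 2 * msgBound H J δ v (fun i => awgnLLR σ (y i))) := by
            rw [awgnLLR]; gcongr
          have e : 2 / σ ^ 2 * -(σ ^ 2 / 2 * msgBound H J δ v (fun i => awgnLLR σ (y i)))
              = -msgBound H J δ v (fun i => awgnLLR σ (y i)) := by field_simp
          linarith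
        have : bitFault (awgnLLR σ) g l v y = 1 := by rw [bitFault, half, if_pos hneg]
        rw [this]
        linarith [Finset.sum_nonneg fun u (_ : u ∈ Finset.univ) => hsum0 u]
    · rw [Set.indicator_of_notMem hy]
      linarith [Finset.sum_nonneg fun u (_ : u ∈ Finset.univ) => hsum0 u]
  have iG : ∀ u, Integrable ((G u).indicator fun _ => (1 : ℝ)) (zeroLaw ν N) := fun u =>
    (integrable_const _).indicator (mG u)
  have iE : Integrable (E.indicator fun _ => (1 : ℝ)) (zeroLaw ν N) :=
    (integrable_const _).indicator mE
  have ibf : Integrable (bitFault (awgnLLR σ) g l v) (zeroLaw ν N) :=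
    Integrable.of_bound (measurable_bitFault mΛ l v).aestronglyMeasurable 1
      (Filter.Eventually.of_forall fun y => by
        rw [Real.norm_eq_abs, bitFault, abs_of_nonneg (half_nonneg _)]; exact half_le_one _)
  have hI := integral_mono (iE.sub (integrable_finsetSum _ fun u _ => iG u)) ibf (fun y => by
    simpa using point y)
  refine le_trans ?_ hI
  have hI2 : ∫ y, (E.indicator (fun _ => (1 : ℝ)) - fun a => ∑ u, (G u).indicator
      (fun _ => (1 : ℝ)) a) y ∂(zeroLaw ν N)
      = (zeroLaw ν N).real E - ∑ u, (zeroLaw ν N).real (G u) := by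
    simp only [Pi.sub_apply]
    rw [integral_sub iE (integrable_finsetSum _ fun u _ => iG u),
      integral_finsetSum _ fun u _ => iG u, integral_indicator_const _ mE]
    simp only [smul_eq_mul, mul_one, integral_indicator_const _ (mG _)]
  rw [hI2]
  have hsumG : ∑ u, (zeroLaw ν N).real (G u) ≤ N * Real.exp (-(σ / 32)) := by
    refine (Finset.sum_le_card_nsmul _ _ _ fun u _ => hGr u).trans (le_of_eq ?_)
    simp
  have hfin : 1 / (2 * σ) * ∫ y, R y ∂(zeroLaw ν N)
      ≤ 1 / (2 * σ) * (J * K * (4 + 8 * (J : ℝ) ^ 2)) := by gcongr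
  have e : (1 + J * K * (4 + 8 * (J : ℝ) ^ 2)) / (2 * σ)
      = 1 / (2 * σ) + 1 / (2 * σ) * (J * K * (4 + 8 * (J : ℝ) ^ 2)) := by ring
  rw [e]
  linarith

end

/-! ### Lower bounds for single graphs and their averages -/

open MeasureTheory ProbabilityTheory

section
variable {Y : Type} [MeasurableSpace Y] {ν : Measure Y} {Λ : Y → ℝ} {ι : Y → Y} {N M K J : ℕ}
  {g : Fin M × Fin K → Fin N} {nx : Fin M × Fin K → Fin M × Fin K} {v : Fin N} {l : ℕ}

/-- On a good graph, belief propagation has to decide between the transmitted word and the one that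
differs from it on the selected set. -/
lemma SymLLR.exists_pairError_le (h : SymLLR ν Λ ι) (hg : IsSocket J g) (hn : IsSelection nx)
    (hG : Good nx g v l ∨ K = 2 ∨ l = 0) :
    ∃ S : Finset (Fin N), v ∈ S ∧ S.card ≤ devSize J l ∧
      pairError ν Λ S ≤ nodeError ν Λ g l v := by
  refine ⟨selSet nx g v l, mem_selSet_self, card_selSet_le hg,
    h.pairError_le_nodeError hg ?_ mem_selSet_self⟩
  rcases hG with hG | hG
  · exact hG.localSign_selSet hn
  · exact localSign_selSet_of_two hn hG

/-- The last node of a selected walk differs from `v`, as the walk is a shortest path. -/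
lemma Good.next_ne (hn : IsSelection nx) (hG : Good nx g v l)
    {p : Fin M × Fin K} {w : List (Fin M × Fin K)} (hw : Follows (selSteps nx g v) (p :: w))
    (hlen : w.length + 2 = 2 * l) : g (nx p) ≠ v := by
  have he : Even w.length := by
    rcases Nat.even_or_odd w.length with h | ⟨k, hk⟩
    · exact h
    · omega
  have hX : IsSelX nx g v (nx p :: p :: w) := ⟨by simp [steps, he, hn.row, hn.ne], hw⟩
  have hgeo := (hG.isGeo hn _ hX (by simp only [List.length_cons]; omega)).1
  rcases hgeo with h | h
  · exact absurd ((reach_parity _).1 _ h.1.1) (by simp [Nat.even_add_one, he])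
  · intro hv
    exact h.2.2 0 (by simp) (by rw [hv]; rfl)

/-- On a good graph with `K ≥ 3`, the bound of two words on `selSet` can be improved. -/
lemma SymLLR.exists_gain_le (h : SymLLR ν Λ ι) (hg : IsSocket J g) (hJ : 2 ≤ J)
    (hn : IsSelection nx) (hn3 : ∀ q, nx (nx q) ≠ q) (hG : Good nx g v l) (hl : 1 ≤ l) :
    ∃ (S : Finset (Fin N)) (b c : Fin N), b ∈ S ∧ v ∈ S.erase b ∧ S.card ≤ devSize J l ∧
      2 * pairError ν Λ {c} * pairError ν Λ (S.erase b) + (1 - 2 * pairError ν Λ {c}) *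
        pairError ν Λ S ≤ nodeError ν Λ g l v := by
  obtain ⟨w', hw', hlen⟩ := exists_selWalk (nx := nx) (v := v) hg hJ (2 * l - 1)
  cases w' with
  | nil => simp only [List.length_nil] at hlen; omega
  | cons p w =>
    simp only [List.length_cons] at hlen
    obtain ⟨h1, h2, h3⟩ := hG.localSign_pair hn hn3 hw' (by omega)
    have h4 := hG.next_ne hn hw' (by omega)
    exact ⟨selSet nx g v l, g (nx p), g (nx (nx p)), h2,
      Finset.mem_erase.2 ⟨h4.symm, mem_selSet_self⟩, card_selSet_le hg,
      h.gain_nodeError hg (hG.localSign_selSet hn) mem_selSet_self h2 h3 h4 h1⟩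

/-- If `v` has a twin `u`, then belief propagation has to decide between two words at distance two. -/
lemma SymLLR.exists_twin_le (h : SymLLR ν Λ ι) (hgm : g ∈ twinSockets nx J v J) :
    ∃ u, u ≠ v ∧ pairError ν Λ {v, u} ≤ nodeError ν Λ g l v := by
  obtain ⟨u, hu, hS⟩ := exists_twin hgm
  have hg : IsSocket J g := by
    simp only [twinSockets, Finset.mem_filter, mem_sockets] at hgm
    exact hgm.1
  exact ⟨u, hu, h.pairError_le_nodeError hg (fun q _ _ _ _ => hS q.1) (by simp)⟩

lemma nodeError_nonneg (l : ℕ) : 0 ≤ nodeError ν Λ g l v :=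
  integral_nonneg fun _ => half_nonneg _

/-- Graphs with a pair of twins alone give a bound, with a polynomial loss. -/
lemma SymLLR.twin_sum_ge (h : SymLLR ν Λ ι) (hn : IsSelection nx) (hMK : M * K = N * J)
    (hN : J * (K * (J * K)) + 1 < N) (l : ℕ) (v : Fin N) {B : ℝ} (hB0 : 0 ≤ B)
    (hB : ∀ u : Fin N, u ≠ v → B * (((N * J : ℕ) : ℝ) ^ 2) ^ J ≤ pairError ν Λ {v, u}) :
    B * (sockets N M J K).card ≤ ∑ g ∈ sockets N M J K, nodeError ν Λ g l v := by
  have h1 : ((sockets N M J K).card : ℝ)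
      ≤ (twinSockets nx J v J).card * (((N * J : ℕ) : ℝ) ^ 2) ^ J := by
    have := card_sockets_le_twin (J := J) hn v hN
    rw [hMK] at this
    exact_mod_cast this
  calc B * (sockets N M J K).card
      ≤ B * ((twinSockets nx J v J).card * (((N * J : ℕ) : ℝ) ^ 2) ^ J) := by gcongr
    _ = (twinSockets nx J v J).card • (B * (((N * J : ℕ) : ℝ) ^ 2) ^ J) := by
        rw [nsmul_eq_mul]; ring
    _ ≤ ∑ g ∈ twinSockets nx J v J, nodeError ν Λ g l v :=
        Finset.card_nsmul_le_sum _ _ _ fun g hg => by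
          obtain ⟨u, hu, hle⟩ := h.exists_twin_le (l := l) hg
          exact (hB u hu).trans hle
    _ ≤ _ := Finset.sum_le_sum_of_subset_of_nonneg (Finset.filter_subset _ _)
        fun g _ _ => nodeError_nonneg l

/-- Splitting the average into good and bad graphs. -/
lemma good_bad_sum_ge (nx : Fin M × Fin K → Fin M × Fin K) (v : Fin N) (l : ℕ)
    {F : (Fin M × Fin K → Fin N) → ℝ} {x y B p : ℝ}
    (hp : ((badSockets nx J v l).card : ℝ) ≤ p * (sockets N M J K).card) (hyx : y ≤ x)
    (hx : ∀ g ∈ sockets N M J K, Good nx g v l → x ≤ F g)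
    (hy : ∀ g ∈ sockets N M J K, y ≤ F g) (hB : B ≤ (1 - p) * x + p * y) :
    B * (sockets N M J K).card ≤ ∑ g ∈ sockets N M J K, F g := by
  classical
  have h1 := Finset.sum_filter_add_sum_filter_not (sockets N M J K)
    (fun g => ¬ Good nx g v l) F
  have hbad : (sockets N M J K).filter (fun g => ¬ Good nx g v l) = badSockets nx J v l := by
    unfold badSockets; congr
  have hcard := Finset.card_filter_add_card_filter_not (s := sockets N M J K)
    (fun g => ¬ Good nx g v l)
  rw [hbad] at h1 hcard
  have h2 : ((badSockets nx J v l).card : ℝ) * y ≤ ∑ g ∈ badSockets nx J v l, F g := by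
    rw [← nsmul_eq_mul]
    exact Finset.card_nsmul_le_sum _ _ _ fun g hg => hy g (Finset.mem_of_mem_filter g hg)
  have h3 : (((sockets N M J K).filter (fun g => ¬¬ Good nx g v l)).card : ℝ) * x
      ≤ ∑ g ∈ (sockets N M J K).filter (fun g => ¬¬ Good nx g v l), F g := by
    rw [← nsmul_eq_mul]
    refine Finset.card_nsmul_le_sum _ _ _ fun g hg => ?_
    rw [Finset.mem_filter, not_not] at hg
    exact hx g hg.1 hg.2
  have hcard' : ((sockets N M J K).card : ℝ) = (badSockets nx J v l).card
      + ((sockets N M J K).filter (fun g => ¬¬ Good nx g v l)).card := by exact_mod_cast hcard.symm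
  have hc0 : (0 : ℝ) ≤ (sockets N M J K).card := Nat.cast_nonneg _
  calc B * (sockets N M J K).card ≤ ((1 - p) * x + p * y) * (sockets N M J K).card := by gcongr
    _ = (sockets N M J K).card * x - (p * (sockets N M J K).card) * (x - y) := by ring
    _ ≤ (sockets N M J K).card * x - (badSockets nx J v l).card * (x - y) := by
        have := mul_le_mul_of_nonneg_right hp (sub_nonneg.2 hyx)
        linarith
    _ = (badSockets nx J v l).card * y
        + ((sockets N M J K).filter (fun g => ¬¬ Good nx g v l)).card * x := by
        rw [hcard']; ring
    _ ≤ _ := by rw [← h1]; linarith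

end

/-! ### The Gaussian channel on good graphs -/

/-- The error probability of the optimal decision between two words at distance `x`. -/
noncomputable def gaussTail (σ x : ℝ) : ℝ := gaussQ (Real.sqrt (x / σ ^ 2))

lemma gaussTail_antitone {σ x y : ℝ} (h : x ≤ y) : gaussTail σ y ≤ gaussTail σ x :=
  gaussQ_antitone (Real.sqrt_le_sqrt (by gcongr))

lemma gaussTail_pos (σ x : ℝ) : 0 < gaussTail σ x := gaussQ_pos _

lemma gaussTail_le_half (σ x : ℝ) : gaussTail σ x ≤ 1 / 2 := gaussQ_le_half (Real.sqrt_nonneg _)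

/-- The exponential decay of the tail in the distance. -/
lemma gaussTail_mul_exp_le {σ x y : ℝ} (hx : 0 ≤ x) (hxy : x ≤ y) :
    gaussTail σ y * Real.exp ((y - x) / (2 * σ ^ 2)) ≤ gaussTail σ x := by
  have h := gaussQ_mul_exp_antitone (Real.sqrt_le_sqrt (show x / σ ^ 2 ≤ y / σ ^ 2 by gcongr))
  simp only at h
  rw [Real.sq_sqrt (div_nonneg (hx.trans hxy) (sq_nonneg σ)), Real.sq_sqrt (by positivity)] at h
  have e : Real.exp (y / σ ^ 2 / 2)
      = Real.exp ((y - x) / (2 * σ ^ 2)) * Real.exp (x / σ ^ 2 / 2) := by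
    rw [← Real.exp_add]; congr 1; field_simp; ring
  rw [e, ← mul_assoc] at h
  exact le_of_mul_le_mul_right h (Real.exp_pos _)

section
variable {N M K J : ℕ} {g : Fin M × Fin K → Fin N} {nx : Fin M × Fin K → Fin M × Fin K}
  {v : Fin N} {l : ℕ} {σ : ℝ}

/-- The gain of `SymLLR.gain` for the Gaussian channel. -/
lemma awgn_gain (hσ : 0 < σ) (hg : IsSocket J g) (hJ : 2 ≤ J)
    (hn : IsSelection nx) (hn3 : ∀ q, nx (nx q) ≠ q) (hG : Good nx g v l) (hl : 1 ≤ l) {D : ℝ}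
    (hD : (devSize J l : ℝ) ≤ D) :
    gaussTail σ D + 2 * gaussTail σ 1 * (gaussTail σ (D - 1) - gaussTail σ D)
      ≤ nodeError ((biAWGN σ).law 0) (awgnLLR σ) g l v := by
  obtain ⟨S, b, c, hb, hv, hS, hle⟩ :=
    (awgn_symLLR hσ).1.exists_gain_le hg hJ hn hn3 hG hl
  rw [awgn_pairError hσ ⟨c, by simp⟩, awgn_pairError hσ ⟨v, hv⟩, awgn_pairError hσ ⟨b, hb⟩,
    Finset.card_erase_of_mem hb, Finset.card_singleton, Nat.cast_one,
    Nat.cast_sub (Finset.card_pos.2 ⟨b, hb⟩), Nat.cast_one] at hle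
  change 2 * gaussTail σ 1 * gaussTail σ (S.card - 1) + (1 - 2 * gaussTail σ 1) *
    gaussTail σ S.card ≤ _ at hle
  refine le_trans ?_ hle
  have hSD : (S.card : ℝ) ≤ D := le_trans (by exact_mod_cast hS) hD
  have h1 := gaussTail_antitone (σ := σ) (sub_le_sub_right hSD 1)
  have h2 := gaussTail_antitone (σ := σ) hSD
  have h3 := gaussTail_le_half σ 1
  have h4 := gaussTail_pos σ 1
  have h5 := mul_le_mul_of_nonneg_left h1 h4.le
  have h6 := mul_le_mul_of_nonneg_left h2 (show 0 ≤ 1 - 2 * gaussTail σ 1 by linarith)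
  linarith

end

open MeasureTheory ProbabilityTheory

section
variable {σ : ℝ}

lemma gaussTail_one_ge (hσ : 1 ≤ σ) : 19 / 200 ≤ gaussTail σ 1 := by
  have h1 : gaussDensity 1 / (2 * 1) ≤ gaussQ 1 := gaussQ_ge_mills_of_one_le le_rfl
  have h2 := le_gaussDensity (t := 1) zero_le_one le_rfl
  have h3 : gaussQ 1 ≤ gaussTail σ 1 := by
    refine gaussQ_antitone (Real.sqrt_le_one.2 ?_)
    rw [div_le_one (by positivity)]
    exact one_le_pow₀ hσ
  linarith

/-- The relative gain for moderate noise, up to `σ = 1`. -/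
lemma gain_factor_ge_of_le_one (h0 : 0 < σ) (h1 : σ ≤ 1) :
    σ / 8 ≤ 2 * gaussTail σ 1 * (Real.exp (1 / (2 * σ ^ 2)) - 1) := by
  have hsq : Real.sqrt (1 / σ ^ 2) = 1 / σ := by
    rw [Real.sqrt_div zero_le_one, Real.sqrt_one, Real.sqrt_sq h0.le]
  have ha : 1 ≤ 1 / σ := by rw [le_div_iff₀ h0]; linarith
  have hQ : gaussDensity (1 / σ) / (2 * (1 / σ)) ≤ gaussTail σ 1 := by
    rw [gaussTail, hsq]; exact gaussQ_ge_mills_of_one_le ha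
  set u := 1 / (2 * σ ^ 2) with hu
  have hu2 : 1 / 2 ≤ u := by
    rw [hu]
    exact one_div_le_one_div_of_le (by positivity) (by nlinarith)
  have hφ : 5 / 13 * Real.exp (-u) ≤ gaussDensity (1 / σ) := by
    unfold gaussDensity
    have e : -(1 / σ) ^ 2 / 2 = -u := by rw [hu]; field_simp
    rw [e]
    have h2 : (5 / 13 : ℝ) ≤ 1 / Real.sqrt (2 * Real.pi) := by
      rw [le_div_iff₀ (by positivity)]; linarith [sqrt_two_pi_le]
    gcongr
  have hexp : Real.exp (-u) ≤ 5 / 8 := by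
    have h3 := exp_neg_le_quadratic (u := 1 / 2) (by norm_num)
    have h4 : Real.exp (-u) ≤ Real.exp (-(1 / 2)) := Real.exp_le_exp.2 (by linarith)
    linarith
  have hprod : Real.exp (-u) * Real.exp u = 1 := by rw [← Real.exp_add]; simp
  have hge : 0 ≤ Real.exp u - 1 := by linarith [Real.add_one_le_exp u]
  have hQ2 : 5 / 13 * Real.exp (-u) * (σ / 2) ≤ gaussTail σ 1 := by
    refine le_trans ?_ hQ
    rw [show gaussDensity (1 / σ) / (2 * (1 / σ)) = gaussDensity (1 / σ) * (σ / 2) by field_simp]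
    gcongr
  calc σ / 8 ≤ 5 / 13 * σ * (1 - Real.exp (-u)) := by nlinarith
    _ = 2 * (5 / 13 * Real.exp (-u) * (σ / 2)) * (Real.exp u - 1) := by
        linear_combination (-(5 / 13 * σ)) * hprod
    _ ≤ _ := by gcongr

/-- The relative gain for moderate noise, beyond `σ = 1`. -/
lemma gain_factor_ge_of_one_le (h1 : 1 ≤ σ) :
    1 / (12 * σ ^ 2) ≤ 2 * gaussTail σ 1 * (Real.exp (1 / (2 * σ ^ 2)) - 1) := by
  have h2 := gaussTail_one_ge h1
  have h3 := Real.add_one_le_exp (1 / (2 * σ ^ 2))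
  have h4 : (0 : ℝ) < 1 / (2 * σ ^ 2) := by positivity
  calc 1 / (12 * σ ^ 2) = 2 * (1 / 12) * (1 / (2 * σ ^ 2)) := by field_simp
    _ ≤ 2 * gaussTail σ 1 * (Real.exp (1 / (2 * σ ^ 2)) - 1) := by
        gcongr
        · linarith
        · linarith

/-- The density is at least `19 / 100` on `[0, 1]`. -/
lemma gaussTail_sub_ge {D : ℝ} (hσ : 0 < σ) (hD : 1 ≤ D) (hDσ : D ≤ σ ^ 2) :
    19 / 200 / (Real.sqrt D * σ) ≤ gaussTail σ (D - 1) - gaussTail σ D := by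
  have hD0 : 0 < D := by linarith
  have hs : 0 < Real.sqrt D := Real.sqrt_pos.2 hD0
  have e : ∀ x, Real.sqrt (x / σ ^ 2) = Real.sqrt x / σ := fun x => by
    rw [Real.sqrt_div' _ (sq_nonneg σ), Real.sqrt_sq hσ.le]
  have hle : Real.sqrt (D - 1) ≤ Real.sqrt D := Real.sqrt_le_sqrt (by linarith)
  have h1 := gaussQ_sub_ge (a := Real.sqrt (D - 1) / σ) (b := Real.sqrt D / σ) (by positivity)
    (by gcongr) (by rw [div_le_one hσ, Real.sqrt_le_left hσ.le]; exact hDσ)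
  rw [gaussTail, gaussTail, e, e]
  refine le_trans ?_ h1
  have h2 : 1 / (2 * Real.sqrt D) ≤ Real.sqrt D - Real.sqrt (D - 1) := by
    rw [div_le_iff₀ (by positivity)]
    have h3 := Real.mul_self_sqrt hD0.le
    have h4 := Real.mul_self_sqrt (show 0 ≤ D - 1 by linarith)
    nlinarith [Real.sqrt_nonneg (D - 1)]
  calc 19 / 200 / (Real.sqrt D * σ) = 19 / 100 * (1 / (2 * Real.sqrt D) / σ) := by
        field_simp; norm_num
    _ ≤ 19 / 100 * ((Real.sqrt D - Real.sqrt (D - 1)) / σ) := by gcongr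
    _ = _ := by ring

lemma gaussTail_le_of_le {D : ℝ} (hσ : 0 < σ) (hDσ : σ ^ 2 ≤ D) :
    gaussTail σ D ≤ 1 / 2 - 19 / 100 := by
  have h1 : gaussTail σ D ≤ gaussQ 1 := by
    refine gaussQ_antitone (Real.one_le_sqrt.2 ?_)
    rw [le_div_iff₀ (by positivity)]; linarith
  have h2 := gaussQ_sub_ge (a := 0) (b := 1) le_rfl zero_le_one le_rfl
  rw [gaussQ_zero] at h2
  linarith

lemma gaussTail_le_of_ge {w : ℝ} (hσ : 0 < σ) (hwσ : w ≤ σ ^ 2) :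
    gaussTail σ w ≤ 1 / 2 - 19 / 100 * (Real.sqrt w / σ) := by
  have h2 := gaussQ_sub_ge (a := 0) (b := Real.sqrt w / σ) le_rfl (by positivity)
    (by rw [div_le_one hσ, Real.sqrt_le_left hσ.le]; exact hwσ)
  rw [gaussQ_zero] at h2
  rw [gaussTail, Real.sqrt_div' _ (sq_nonneg σ), Real.sqrt_sq hσ.le]
  linarith

variable {N M K J : ℕ} {nx : Fin M × Fin K → Fin M × Fin K} {v : Fin N} {l : ℕ}

/-- Weak noise: the twins alone beat a larger distance. -/
lemma awgn_twin_sum_ge (hσ : 0 < σ) (hn : IsSelection nx) (hMK : M * K = N * J)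
    (hN : J * (K * (J * K)) + 1 < N) (l : ℕ) (v : Fin N) {w : ℝ} (hw : 2 ≤ w)
    (hexp : (((N * J : ℕ) : ℝ) ^ 2) ^ J ≤ Real.exp ((w - 2) / (2 * σ ^ 2))) :
    gaussTail σ w * (sockets N M J K).card
      ≤ ∑ g ∈ sockets N M J K, nodeError ((biAWGN σ).law 0) (awgnLLR σ) g l v := by
  refine (awgn_symLLR hσ).1.twin_sum_ge hn hMK hN l v (gaussTail_pos _ _).le fun u hu => ?_
  rw [awgn_pairError hσ ⟨v, by simp⟩, Finset.card_pair hu.symm]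
  change _ ≤ gaussTail σ ((2 : ℕ) : ℝ)
  have h := gaussTail_mul_exp_le (σ := σ) (x := 2) (y := w) (by norm_num) hw
  refine le_trans ?_ (h.trans (by norm_num))
  exact mul_le_mul_of_nonneg_left hexp (gaussTail_pos _ _).le

/-- Moderate noise: the gain on good graphs outweighs the bad graphs. -/
lemma awgn_moderate_sum_ge (hσ : 0 < σ) (hJ : 2 ≤ J) (hn : IsSelection nx)
    (hn3 : ∀ q, nx (nx q) ≠ q) (hl : 1 ≤ l) {D p : ℝ} (hD : (devSize J l : ℝ) ≤ D) (hD1 : 1 ≤ D)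
    (hp : ((badSockets nx J v l).card : ℝ) ≤ p * (sockets N M J K).card) (hp0 : 0 ≤ p)
    (hp2 : p ≤ 1 / 2) (hgain : 2 * p ≤ 2 * gaussTail σ 1 * (Real.exp (1 / (2 * σ ^ 2)) - 1)) :
    gaussTail σ D * (sockets N M J K).card
      ≤ ∑ g ∈ sockets N M J K, nodeError ((biAWGN σ).law 0) (awgnLLR σ) g l v := by
  set t := gaussTail σ D with ht
  have ht0 : 0 < t := gaussTail_pos _ _
  have h1 : t * Real.exp (1 / (2 * σ ^ 2)) ≤ gaussTail σ (D - 1) := by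
    have := gaussTail_mul_exp_le (σ := σ) (x := D - 1) (y := D) (by linarith) (by linarith)
    rwa [sub_sub_cancel] at this
  have h2 : t * (2 * p) ≤ 2 * gaussTail σ 1 * (gaussTail σ (D - 1) - t) := by
    calc t * (2 * p) ≤ t * (2 * gaussTail σ 1 * (Real.exp (1 / (2 * σ ^ 2)) - 1)) := by gcongr
      _ = 2 * gaussTail σ 1 * (t * Real.exp (1 / (2 * σ ^ 2)) - t) := by ring
      _ ≤ _ := by
        have := gaussTail_pos σ 1
        gcongr
  refine good_bad_sum_ge nx v l (x := t * (1 + 2 * p)) (y := 0) hp (by positivity)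
    (fun g hg hG => ?_) (fun g _ => nodeError_nonneg l) ?_
  · refine le_trans ?_ (awgn_gain hσ (mem_sockets.1 hg) hJ hn hn3 hG hl hD)
    linarith
  · nlinarith [mul_nonneg ht0.le hp0]

/-- Strong noise: on bad graphs the loss is of order `1 / σ`. -/
lemma awgn_strong_sum_ge (hσ : 1 ≤ σ) (hJ : 2 ≤ J) (hn : IsSelection nx)
    (hn3 : ∀ q, nx (nx q) ≠ q) (hl : 1 ≤ l) {D p E : ℝ} (hD : (devSize J l : ℝ) ≤ D) (hD1 : 1 ≤ D)
    (hp : ((badSockets nx J v l).card : ℝ) ≤ p * (sockets N M J K).card)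
    (hp2 : p ≤ 1 / 2) (hE0 : 0 ≤ E) (hE : E / σ ≤ 19 / 100) (hpD : p * Real.sqrt D * E ≤ 9 / 1000)
    (hall : ∀ g ∈ sockets N M J K,
      1 / 2 - E / σ ≤ nodeError ((biAWGN σ).law 0) (awgnLLR σ) g l v) :
    gaussTail σ D * (sockets N M J K).card
      ≤ ∑ g ∈ sockets N M J K, nodeError ((biAWGN σ).law 0) (awgnLLR σ) g l v := by
  have hσ0 : 0 < σ := by linarith
  rcases le_total (σ ^ 2) D with h | h
  · have h1 := gaussTail_le_of_le hσ0 h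
    rw [mul_comm, ← nsmul_eq_mul]
    exact Finset.card_nsmul_le_sum _ _ _ fun g hg => by linarith [hall g hg]
  · have hs : 0 < Real.sqrt D := Real.sqrt_pos.2 (by linarith)
    have h1 := gaussTail_sub_ge hσ0 hD1 h
    have h2 := gaussTail_one_ge hσ
    have h3 : 18 / 1000 / (Real.sqrt D * σ)
        ≤ 2 * gaussTail σ 1 * (gaussTail σ (D - 1) - gaussTail σ D) := by
      calc 18 / 1000 / (Real.sqrt D * σ) ≤ 2 * (19 / 200) * (19 / 200 / (Real.sqrt D * σ)) := by
            rw [← mul_div_assoc]; gcongr; norm_num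
        _ ≤ _ := by
          have : 0 ≤ 19 / 200 / (Real.sqrt D * σ) := by positivity
          gcongr
    have h4 : 0 ≤ E / σ := by positivity
    have h5 : 0 ≤ 18 / 1000 / (Real.sqrt D * σ) := by positivity
    refine good_bad_sum_ge nx v l (x := gaussTail σ D + 18 / 1000 / (Real.sqrt D * σ))
      (y := gaussTail σ D - E / σ) hp (by linarith) (fun g hg hG => ?_) (fun g hg => ?_) ?_
    · exact le_trans (by linarith) (awgn_gain hσ0 (mem_sockets.1 hg) hJ hn hn3 hG hl hD)
    · linarith [hall g hg, gaussTail_le_half σ D]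
    · have h6 : p * (E / σ) ≤ 9 / 1000 / (Real.sqrt D * σ) := by
        rw [le_div_iff₀ (by positivity)]
        calc p * (E / σ) * (Real.sqrt D * σ) = p * Real.sqrt D * E := by field_simp
          _ ≤ _ := hpD
      have h7 : 18 / 1000 / (Real.sqrt D * σ) = 2 * (9 / 1000 / (Real.sqrt D * σ)) := by ring
      nlinarith

/-- Strong noise and a large distance. -/
lemma awgn_strong_sum_ge_of_large (hσ : 1 ≤ σ) {w E : ℝ} (hE : E / σ ≤ 19 / 100)
    (hw : E ≤ 19 / 100 * Real.sqrt w)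
    (hall : ∀ g ∈ sockets N M J K,
      1 / 2 - E / σ ≤ nodeError ((biAWGN σ).law 0) (awgnLLR σ) g l v) :
    gaussTail σ w * (sockets N M J K).card
      ≤ ∑ g ∈ sockets N M J K, nodeError ((biAWGN σ).law 0) (awgnLLR σ) g l v := by
  have hσ0 : 0 < σ := by linarith
  have key : gaussTail σ w ≤ 1 / 2 - E / σ := by
    rcases le_total (σ ^ 2) w with h | h
    · linarith [gaussTail_le_of_le hσ0 h]
    · refine (gaussTail_le_of_ge hσ0 h).trans ?_
      rw [mul_div_assoc']
      gcongr
  rw [mul_comm, ← nsmul_eq_mul]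
  exact Finset.card_nsmul_le_sum _ _ _ fun g hg => key.trans (hall g hg)

end

/-! ### The sizes in the bounds -/

section
variable {J K N l : ℕ} {θ : ℝ}

lemma cast_pred_eq {n : ℕ} (h : 1 ≤ n) : ((n - 1 : ℕ) : ℝ) = (n : ℝ) - 1 := by
  rw [Nat.cast_sub h, Nat.cast_one]

lemma devSize_eq (hJ : 3 ≤ J) (l : ℕ) :
    (devSize J l : ℝ) = ((J : ℝ) * ((J : ℝ) - 1) ^ l - 2) / ((J : ℝ) - 2) := by
  have hJ' : (3 : ℝ) ≤ J := by exact_mod_cast hJ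
  rw [eq_div_iff (by linarith), devSize]
  push_cast
  rw [cast_pred_eq (by omega), ← Finset.mul_sum]
  have := geom_sum_mul ((J : ℝ) - 1) l
  linear_combination (J : ℝ) * this

/-- The number of variable nodes in the computation tree. -/
noncomputable def treeSize (J K l : ℕ) : ℝ :=
  ((J : ℝ) * ((K : ℝ) - 1) ^ (l + 1) * ((J : ℝ) - 1) ^ l - K) / (((J : ℝ) - 1) * ((K : ℝ) - 1) - 1)

lemma treeSize_eq (hJ : 3 ≤ J) (hK : 2 ≤ K) (l : ℕ) : treeSize J K l
    = 1 + ∑ k ∈ Finset.range l, (J : ℝ) * ((K : ℝ) - 1) * (((J : ℝ) - 1) * ((K : ℝ) - 1)) ^ k := by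
  have hJ' : (3 : ℝ) ≤ J := by exact_mod_cast hJ
  have hK' : (2 : ℝ) ≤ K := by exact_mod_cast hK
  rw [treeSize, div_eq_iff (by nlinarith), ← Finset.mul_sum]
  have := geom_sum_mul (((J : ℝ) - 1) * ((K : ℝ) - 1)) l
  rw [mul_pow] at this
  linear_combination (-(J : ℝ) * ((K : ℝ) - 1)) * this

lemma devSize_le_treeSize (hJ : 3 ≤ J) (hK : 2 ≤ K) (l : ℕ) :
    (devSize J l : ℝ) ≤ treeSize J K l := by
  have hJ' : (3 : ℝ) ≤ J := by exact_mod_cast hJ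
  have hK' : (2 : ℝ) ≤ K := by exact_mod_cast hK
  rw [treeSize_eq hJ hK, devSize]
  push_cast
  rw [cast_pred_eq (by omega)]
  have hx : (0 : ℝ) ≤ (J : ℝ) - 1 := by linarith
  have h1 : (J : ℝ) ≤ J * ((K : ℝ) - 1) := by nlinarith
  have h2 : (J : ℝ) - 1 ≤ ((J : ℝ) - 1) * ((K : ℝ) - 1) := by nlinarith
  have h3 : ∀ k ∈ Finset.range l, (J : ℝ) * ((J : ℝ) - 1) ^ k
      ≤ (J : ℝ) * ((K : ℝ) - 1) * (((J : ℝ) - 1) * ((K : ℝ) - 1)) ^ k := fun k _ =>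
    mul_le_mul h1 (pow_le_pow_left₀ hx h2 k) (pow_nonneg hx k) (by linarith)
  linarith [Finset.sum_le_sum h3]

lemma pow_le_treeSize (hJ : 3 ≤ J) (hK : 2 ≤ K) (l : ℕ) :
    (((J : ℝ) - 1) * ((K : ℝ) - 1)) ^ l ≤ treeSize J K l := by
  have hJ' : (3 : ℝ) ≤ J := by exact_mod_cast hJ
  have hK' : (2 : ℝ) ≤ K := by exact_mod_cast hK
  have hx : 0 ≤ ((J : ℝ) - 1) * ((K : ℝ) - 1) := mul_nonneg (by linarith) (by linarith)
  have h0 : ∀ k, 0 ≤ (J : ℝ) * ((K : ℝ) - 1) * (((J : ℝ) - 1) * ((K : ℝ) - 1)) ^ k := fun k =>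
    mul_nonneg (mul_nonneg (by linarith) (by linarith)) (pow_nonneg hx k)
  rw [treeSize_eq hJ hK]
  cases l with
  | zero => simp
  | succ l =>
    rw [Finset.sum_range_succ, pow_succ']
    have h1 := Finset.sum_nonneg fun k (_ : k ∈ Finset.range l) => h0 k
    have h2 : ((J : ℝ) - 1) * ((K : ℝ) - 1) * (((J : ℝ) - 1) * ((K : ℝ) - 1)) ^ l
        ≤ (J : ℝ) * ((K : ℝ) - 1) * (((J : ℝ) - 1) * ((K : ℝ) - 1)) ^ l :=
      mul_le_mul_of_nonneg_right (by nlinarith) (pow_nonneg hx l)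
    linarith

lemma devSize_le_mul_pow (hJ : 3 ≤ J) (l : ℕ) : devSize J l ≤ J * (J - 1) ^ l := by
  induction l with
  | zero => simp [devSize]; omega
  | succ l ih =>
    obtain ⟨n, rfl⟩ : ∃ n, J = n + 3 := ⟨J - 3, by omega⟩
    have e : n + 3 - 1 = n + 2 := rfl
    rw [devSize, Finset.sum_range_succ, ← add_assoc]
    rw [devSize] at ih
    rw [e] at ih ⊢
    rw [pow_succ]
    nlinarith [Nat.zero_le ((n + 3) * (n + 2) ^ l * n)]

lemma one_le_devSize : 1 ≤ devSize J l := by unfold devSize; omega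

lemma four_le_devSize (hJ : 3 ≤ J) (hl : 1 ≤ l) : 4 ≤ devSize J l := by
  have h : J * (J - 1) ^ 0 ≤ ∑ k ∈ Finset.range l, J * (J - 1) ^ k :=
    Finset.single_le_sum (f := fun k => J * (J - 1) ^ k) (fun _ _ => Nat.zero_le _)
      (Finset.mem_range.2 hl)
  rw [pow_zero, mul_one] at h
  unfold devSize
  omega

lemma wUB_of_low (h : (l : ℝ) ≤ lowThreshold θ N J K) :
    wUB θ l N J K = ((J : ℝ) * ((J : ℝ) - 1) ^ l - 2) / ((J : ℝ) - 2) := if_pos h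

lemma wUB_cases (hJ : 3 ≤ J) :
    wUB θ l N J K = devSize J l ∨ wUB θ l N J K = N ∨ wUB θ l N J K = treeSize J K l := by
  unfold wUB
  split_ifs
  · exact Or.inl (devSize_eq hJ l).symm
  · exact Or.inr (Or.inl rfl)
  · exact Or.inr (Or.inr rfl)

/-- Whichever case applies, the bound is at least the size of a local codeword. -/
lemma min_devSize_le_wUB (hJ : 3 ≤ J) (hK : 2 ≤ K) :
    ((min (devSize J l) N : ℕ) : ℝ) ≤ wUB θ l N J K := by
  rcases wUB_cases (θ := θ) (l := l) (N := N) (K := K) hJ with h | h | h <;> rw [h]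
  · exact_mod_cast min_le_left _ _
  · exact_mod_cast min_le_right _ _
  · exact le_trans (by exact_mod_cast min_le_left _ _) (devSize_le_treeSize hJ hK l)

lemma devSize_le_wUB (hJ : 3 ≤ J) (hK : 2 ≤ K) (hN : devSize J l ≤ N) :
    (devSize J l : ℝ) ≤ wUB θ l N J K := by
  have := min_devSize_le_wUB (θ := θ) (l := l) (N := N) hJ hK
  rwa [min_eq_left hN] at this

/-- Beyond the low-iteration regime the bound is large. -/
lemma le_wUB_of_not_low {X : ℝ} (hJ : 3 ≤ J) (hK : 2 ≤ K)
    (h : ¬ (l : ℝ) ≤ lowThreshold θ N J K) (hN : X ≤ N)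
    (hX : X ≤ (((J : ℝ) - 1) * ((K : ℝ) - 1)) ^ l) : X ≤ wUB θ l N J K := by
  unfold wUB
  rw [if_neg h]
  split_ifs
  · exact hN
  · exact hX.trans (pow_le_treeSize hJ hK l)

lemma wUB_pos (hJ : 3 ≤ J) (hK : 2 ≤ K) (hN : 1 ≤ N) : 1 ≤ wUB θ l N J K := by
  refine le_trans ?_ (min_devSize_le_wUB (θ := θ) (l := l) (N := N) hJ hK)
  exact_mod_cast le_min one_le_devSize hN

/-- The base of the logarithm in `lowThreshold`. -/
noncomputable def lowBase (J K : ℕ) : ℝ := ((J : ℝ) - 1) ^ 5 * ((K : ℝ) - 1) ^ 3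

lemma le_lowBase (hJ : 3 ≤ J) (hK : 2 ≤ K) : 32 ≤ lowBase J K := by
  have hJ' : (3 : ℝ) ≤ J := by exact_mod_cast hJ
  have hK' : (2 : ℝ) ≤ K := by exact_mod_cast hK
  have h1 : (2 : ℝ) ^ 5 ≤ ((J : ℝ) - 1) ^ 5 := by gcongr; linarith
  have h2 : (1 : ℝ) ≤ ((K : ℝ) - 1) ^ 3 := one_le_pow₀ (by linarith)
  unfold lowBase
  nlinarith

lemma one_le_log_lowBase (hJ : 3 ≤ J) (hK : 2 ≤ K) : 1 ≤ Real.log (lowBase J K) := by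
  rw [Real.le_log_iff_exp_le (by linarith [le_lowBase hJ hK])]
  linarith [le_lowBase hJ hK, Real.exp_one_lt_d9]

lemma le_lowThreshold_iff (hJ : 3 ≤ J) (hK : 2 ≤ K) :
    (l : ℝ) ≤ lowThreshold θ N J K ↔ l * Real.log (lowBase J K) ≤ 2 * θ * Real.log N := by
  have h1 := one_le_log_lowBase hJ hK
  unfold lowThreshold
  change (l : ℝ) ≤ θ * Real.logb (lowBase J K) _ ↔ _
  rw [Real.logb, Real.log_pow, mul_div_assoc', le_div_iff₀ (by linarith)]
  push_cast
  rw [show θ * (2 * Real.log N) = 2 * θ * Real.log N by ring]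

lemma lowThreshold_mono {θ' : ℝ} (hJ : 3 ≤ J) (hK : 2 ≤ K) (hN : 1 ≤ N) (hθ : θ ≤ θ')
    (h : (l : ℝ) ≤ lowThreshold θ N J K) : (l : ℝ) ≤ lowThreshold θ' N J K := by
  rw [le_lowThreshold_iff hJ hK] at h ⊢
  have : 0 ≤ Real.log N := Real.log_nonneg (by exact_mod_cast hN)
  nlinarith

lemma lowBase_pow_le (hJ : 3 ≤ J) (hK : 2 ≤ K) (hN : 1 ≤ N)
    (h : (l : ℝ) ≤ lowThreshold θ N J K) : lowBase J K ^ l ≤ (N : ℝ) ^ (2 * θ) := by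
  have hB := le_lowBase hJ hK
  have hN' : (0 : ℝ) < N := by exact_mod_cast hN
  rw [le_lowThreshold_iff hJ hK] at h
  rw [← Real.log_le_log_iff (by positivity) (by positivity), Real.log_pow, Real.log_rpow hN']
  exact h

lemma lt_lowBase_pow (hJ : 3 ≤ J) (hK : 2 ≤ K) (hN : 1 ≤ N)
    (h : ¬ (l : ℝ) ≤ lowThreshold θ N J K) : (N : ℝ) ^ (2 * θ) < lowBase J K ^ l := by
  have hB := le_lowBase hJ hK
  have hN' : (0 : ℝ) < N := by exact_mod_cast hN
  rw [le_lowThreshold_iff hJ hK, not_le] at h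
  rw [← Real.log_lt_log_iff (by positivity) (by positivity), Real.log_pow, Real.log_rpow hN']
  exact h

end

/-! ### Comparison of the growth rates -/

open Filter Topology

/-- `X` is a small power of `N` which still beats all logarithms; it separates the noise regimes:
`N` exceeds `X ^ 20` and the fraction of bad graphs is small compared with all powers of `X` that
occur. -/
structure Scale (J : ℕ) (θ : ℝ) (N : ℕ) (X : ℝ) : Prop where
  pow_le : X ^ 20 ≤ N
  rpow_mul_le : (N : ℝ) ^ (2 * θ) * X ^ 20 ≤ (N : ℝ) ^ 2
  pow_le_exp : (((N * J : ℕ) : ℝ) ^ 2) ^ J ≤ Real.exp (X ^ 2 / 2 - 1)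
  log_le : 2 * Real.log N + 1 ≤ X
  mul_exp_le : ∀ σ, X ≤ σ → N * Real.exp (-(σ / 32)) ≤ 1 / σ

lemma exists_scale (J : ℕ) (hJ : 1 ≤ J) {θ : ℝ} (h1 : 1 / 2 ≤ θ) (h2 : θ < 1) (X₀ : ℝ) :
    ∃ N₀ : ℕ, 1 ≤ N₀ ∧ ∀ N, N₀ ≤ N → ∃ X, X₀ ≤ X ∧ Scale J θ N X := by
  -- This exponent makes `X ^ 20 = N ^ (2 - 2 * θ)`, and `X ^ 20 ≤ N` by `1 / 2 ≤ θ`.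
  set κ := (1 - θ) / 10 with hκ
  have hκ0 : 0 < κ := by rw [hκ]; linarith
  have hκ1 : κ * 20 ≤ 1 := by rw [hκ]; linarith
  have hJ' : (1 : ℝ) ≤ J := by exact_mod_cast hJ
  have hexp : ∀ᶠ σ : ℝ in atTop, σ ^ (κ⁻¹ + 1) * Real.exp (-(1 / 32) * σ) ≤ 1 :=
    (tendsto_rpow_mul_exp_neg_mul_atTop_nhds_zero _ _ (by norm_num)).eventually_le_const
      zero_lt_one
  obtain ⟨σ₀, hσ₀⟩ := eventually_atTop.1 hexp
  have htend : Tendsto (fun N : ℕ => (N : ℝ) ^ κ) atTop atTop :=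
    (tendsto_rpow_atTop hκ0).comp tendsto_natCast_atTop_atTop
  set A := 4 * J / κ + 1 with hA
  obtain ⟨N₁, hN₁⟩ := eventually_atTop.1 (htend.eventually_ge_atTop
    (max (max X₀ σ₀) (max (max 1 (4 * J * Real.log J + 2)) (max A ((4 / κ + 1) ^ 2)))))
  refine ⟨N₁ + 1, by omega, fun N hN => ⟨(N : ℝ) ^ κ, ?_, ?_⟩⟩
  · exact (le_max_left _ _).trans ((le_max_left _ _).trans (hN₁ N (by omega)))
  have hX := hN₁ N (by omega)
  simp only [max_le_iff] at hX
  obtain ⟨⟨-, hXσ⟩, ⟨hX1, hXJ⟩, hXA, hXκ⟩ := hX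
  have hN1 : (1 : ℝ) ≤ N := by exact_mod_cast (by omega : 1 ≤ N)
  have hN0 : (0 : ℝ) < N := by linarith
  have hpow : ((N : ℝ) ^ κ) ^ 20 = (N : ℝ) ^ (κ * 20) := by
    rw [← Real.rpow_natCast, ← Real.rpow_mul hN0.le]; norm_num
  have hlog : Real.log N ≤ (N : ℝ) ^ κ / κ := Real.log_le_rpow_div hN0.le hκ0
  have hlog2 : Real.log N ≤ (N : ℝ) ^ (κ / 2) / (κ / 2) :=
    Real.log_le_rpow_div hN0.le (by positivity)
  have hsq : (N : ℝ) ^ (κ / 2) * (N : ℝ) ^ (κ / 2) = (N : ℝ) ^ κ := by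
    rw [← Real.rpow_add hN0]; ring_nf
  have hY0 : 0 < (N : ℝ) ^ (κ / 2) := by positivity
  set X := (N : ℝ) ^ κ with hXdef
  set Y := (N : ℝ) ^ (κ / 2) with hY
  refine ⟨?_, ?_, ?_, ?_, ?_⟩
  · rw [hpow]
    calc (N : ℝ) ^ (κ * 20) ≤ (N : ℝ) ^ (1 : ℝ) := Real.rpow_le_rpow_of_exponent_le hN1 hκ1
      _ = N := Real.rpow_one _
  · rw [hpow, ← Real.rpow_add hN0, ← Real.rpow_natCast]
    refine le_of_eq (congrArg _ ?_)
    rw [hκ]; push_cast; ring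
  · have hJ0 : (0 : ℝ) < J := by linarith
    rw [← pow_mul, ← Real.log_le_iff_le_exp (by push_cast; positivity), Real.log_pow]
    push_cast
    rw [Real.log_mul (by positivity) (by positivity)]
    have e1 : 2 * J * Real.log N ≤ (A - 1) / 2 * X := by
      calc 2 * J * Real.log N ≤ 2 * J * (X / κ) := by gcongr
        _ = _ := by rw [hA]; ring
    nlinarith
  · have hYκ : 4 / κ + 1 ≤ Y := by
      by_contra hlt
      have : 0 < 4 / κ + 1 := by positivity
      nlinarith [not_le.1 hlt]
    have e1 : 2 * Real.log N ≤ 4 / κ * Y := by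
      calc 2 * Real.log N ≤ 2 * (Y / (κ / 2)) := by gcongr
        _ = _ := by field_simp; norm_num
    have : 0 < 4 / κ := by positivity
    nlinarith
  · intro σ hσ
    have hσ0 : 0 < σ := by linarith
    have h3 := hσ₀ σ (hXσ.trans hσ)
    have h4 : (N : ℝ) ≤ σ ^ κ⁻¹ := by
      calc (N : ℝ) = X ^ κ⁻¹ := by
            rw [hXdef, ← Real.rpow_mul hN0.le, mul_inv_cancel₀ hκ0.ne', Real.rpow_one]
        _ ≤ σ ^ κ⁻¹ := Real.rpow_le_rpow (by linarith) hσ (by positivity)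
    rw [Real.rpow_add hσ0, Real.rpow_one] at h3
    rw [le_div_iff₀ hσ0]
    calc N * Real.exp (-(σ / 32)) * σ ≤ σ ^ κ⁻¹ * Real.exp (-(σ / 32)) * σ := by gcongr
      _ = σ ^ κ⁻¹ * σ * Real.exp (-(1 / 32) * σ) := by
          rw [show -(1 / 32) * σ = -(σ / 32) by ring]; ring
      _ ≤ 1 := h3

section
variable {J K N M l : ℕ} {θ X : ℝ}

lemma Scale.one_le (hS : Scale J θ N X) (hX : 2 ≤ X) : 1 ≤ N := by
  have : (1 : ℝ) ≤ X ^ 20 := one_le_pow₀ (by linarith)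
  exact_mod_cast this.trans hS.pow_le

lemma Scale.sq_le (hS : Scale J θ N X) (hX : 2 ≤ X) : X * X ≤ N := by
  refine le_trans ?_ hS.pow_le
  rw [← sq]
  exact pow_le_pow_right₀ (by linarith) (by norm_num)

lemma Scale.iter_le (hS : Scale J θ N X) (hJ : 3 ≤ J) (hK : 2 ≤ K) (hX : 2 ≤ X) (hθ : θ ≤ 1)
    (hl : (l : ℝ) ≤ lowThreshold θ N J K) : (l : ℝ) + 1 ≤ X := by
  have h1 := one_le_log_lowBase hJ hK
  have h2 : 0 ≤ Real.log N := Real.log_nonneg (by exact_mod_cast hS.one_le hX)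
  have h3 : (0 : ℝ) ≤ l := Nat.cast_nonneg l
  have h4 := hS.log_le
  rw [le_lowThreshold_iff hJ hK] at hl
  nlinarith

lemma Scale.devSize_le (hS : Scale J θ N X) (hJ : 3 ≤ J) (hK : 2 ≤ K) (hX : 2 ≤ X)
    (hXJ : (J : ℝ) ≤ X) (hθ : θ ≤ 1) (hl : (l : ℝ) ≤ lowThreshold θ N J K) : devSize J l ≤ N := by
  have hN := hS.one_le hX
  have hN1 : (1 : ℝ) ≤ N := by exact_mod_cast hN
  have hJ' : (3 : ℝ) ≤ J := by exact_mod_cast hJ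
  have hK' : (2 : ℝ) ≤ K := by exact_mod_cast hK
  have h1 := lowBase_pow_le hJ hK hN hl
  have h2 : (N : ℝ) ^ (2 * θ) ≤ (N : ℝ) ^ 2 := by
    rw [← Real.rpow_natCast]
    exact Real.rpow_le_rpow_of_exponent_le hN1 (by push_cast; linarith)
  have h3 : (devSize J l : ℝ) ≤ J * ((J : ℝ) - 1) ^ l := by
    have := devSize_le_mul_pow hJ l
    rw [← cast_pred_eq (by omega : 1 ≤ J)]
    exact_mod_cast this
  have h4 : (((J : ℝ) - 1) ^ l) ^ 5 ≤ lowBase J K ^ l := by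
    rw [← pow_mul, mul_comm, pow_mul]
    refine pow_le_pow_left₀ (by have : (0 : ℝ) ≤ J - 1 := by linarith
                                positivity) ?_ l
    unfold lowBase
    have h5 : (1 : ℝ) ≤ ((K : ℝ) - 1) ^ 3 := one_le_pow₀ (by linarith)
    have h6 : (0 : ℝ) ≤ ((J : ℝ) - 1) ^ 5 := pow_nonneg (by linarith) _
    nlinarith
  have h7 : (J : ℝ) ^ 6 ≤ (N : ℝ) ^ 3 := by
    calc (J : ℝ) ^ 6 ≤ X ^ 6 := by gcongr
      _ = (X * X) ^ 3 := by ring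
      _ ≤ (N : ℝ) ^ 3 := by
          have := hS.sq_le hX
          have : 0 ≤ X * X := by positivity
          gcongr
  have h8 : (devSize J l : ℝ) ^ 5 ≤ (N : ℝ) ^ 5 := by
    calc (devSize J l : ℝ) ^ 5 ≤ (J * ((J : ℝ) - 1) ^ l) ^ 5 := by gcongr
      _ = (J : ℝ) ^ 5 * (((J : ℝ) - 1) ^ l) ^ 5 := by ring
      _ ≤ (J : ℝ) ^ 6 * (N : ℝ) ^ 2 := by
          have : (J : ℝ) ^ 5 ≤ (J : ℝ) ^ 6 := pow_le_pow_right₀ (by linarith) (by norm_num)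
          have h9 := h4.trans (h1.trans h2)
          exact mul_le_mul this h9
            (pow_nonneg (pow_nonneg (by linarith) _) _) (by positivity)
      _ ≤ (N : ℝ) ^ 3 * (N : ℝ) ^ 2 := by gcongr
      _ = _ := by ring
  exact_mod_cast le_of_pow_le_pow_left₀ (by norm_num) (by positivity) h8

/-- The constant in the bound for the fraction of bad graphs. -/
noncomputable def badConst (J K : ℕ) : ℝ := 64 * (J : ℝ) ^ 3 * K * (J + K)

lemma card_badSockets_le (nx : Fin M × Fin K → Fin M × Fin K) (v : Fin N) (hJ : 3 ≤ J) (hK : 2 ≤ K)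
    (hMK : M * K = N * J) (hN : 1 ≤ N) (hlN : 4 * l + 2 * (J * K) ≤ N) :
    ((badSockets nx J v l).card : ℝ) ≤ badConst J K * ((l : ℝ) + 1) ^ 4
      * (((J : ℝ) - 1) ^ 2 * ((K : ℝ) - 1)) ^ l / N * (sockets N M J K).card := by
  have h := card_badSockets_mul_le nx v l (by omega : 2 ≤ J) hK
  have hNsub : N ≤ M * K - (4 * l + 2 * (J * K)) := by
    rw [hMK]
    have : N * 3 ≤ N * J := Nat.mul_le_mul_left _ hJ
    omega
  have h' := (Nat.mul_le_mul_left (badSockets nx J v l).card hNsub).trans h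
  have h2 : ((badSockets nx J v l).card : ℝ) * N ≤ (sockets N M J K).card *
        ((2 * l + 1) * (J * ((J : ℝ) - 1) ^ l * (J + K))
          * ((2 * l + 1) * (J * (((J : ℝ) - 1) * ((K : ℝ) - 1)) ^ l))
          * (4 * l * K * ((4 * l + 1) * J))) := by
    rw [← cast_pred_eq (by omega : 1 ≤ J), ← cast_pred_eq (by omega : 1 ≤ K)]
    exact_mod_cast h'
  have hN0 : (0 : ℝ) < N := by exact_mod_cast hN
  rw [div_mul_eq_mul_div, le_div_iff₀ hN0]
  refine h2.trans ?_
  have hJ' : (0 : ℝ) ≤ (J : ℝ) - 1 := by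
    have : (3 : ℝ) ≤ J := by exact_mod_cast hJ
    linarith
  have hK' : (0 : ℝ) ≤ (K : ℝ) - 1 := by
    have : (2 : ℝ) ≤ K := by exact_mod_cast hK
    linarith
  have hl0 : (0 : ℝ) ≤ l := Nat.cast_nonneg l
  have hpoly : (2 * (l : ℝ) + 1) * (2 * l + 1) * (4 * l * (4 * l + 1)) ≤ 64 * ((l : ℝ) + 1) ^ 4 := by
    have a1 : (2 * (l : ℝ) + 1) * (2 * l + 1) ≤ 4 * ((l : ℝ) + 1) ^ 2 := by nlinarith
    have a2 : 4 * (l : ℝ) * (4 * l + 1) ≤ 16 * ((l : ℝ) + 1) ^ 2 := by nlinarith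
    calc _ ≤ 4 * ((l : ℝ) + 1) ^ 2 * (16 * ((l : ℝ) + 1) ^ 2) := by gcongr
      _ = _ := by ring
  have hG : 0 ≤ (J : ℝ) ^ 3 * K * (J + K) * (((J : ℝ) - 1) ^ 2 * ((K : ℝ) - 1)) ^ l
      * (sockets N M J K).card := by positivity
  calc _ = (2 * (l : ℝ) + 1) * (2 * l + 1) * (4 * l * (4 * l + 1)) *
        ((J : ℝ) ^ 3 * K * (J + K) * (((J : ℝ) - 1) ^ 2 * ((K : ℝ) - 1)) ^ l
          * (sockets N M J K).card) := by
        rw [mul_pow, mul_pow, ← pow_mul, mul_comm 2 l, pow_mul]; ring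
    _ ≤ 64 * ((l : ℝ) + 1) ^ 4 * ((J : ℝ) ^ 3 * K * (J + K)
          * (((J : ℝ) - 1) ^ 2 * ((K : ℝ) - 1)) ^ l * (sockets N M J K).card) := by gcongr
    _ = _ := by unfold badConst; ring

/-- In the low-iteration regime the fraction `p` of bad graphs is small, even compared with the
size of the deviation. -/
lemma Scale.exists_bad_le (hS : Scale J θ N X) (hJ : 3 ≤ J) (hK : 2 ≤ K) (hMK : M * K = N * J)
    (hX : 2 ≤ X) (hXJK : 4 + 2 * ((J : ℝ) * K) ≤ X) (hXC : badConst J K ^ 2 * J ≤ X) (hθ : θ ≤ 1)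
    (hl : (l : ℝ) ≤ lowThreshold θ N J K) (nx : Fin M × Fin K → Fin M × Fin K) (v : Fin N) :
    ∃ p : ℝ, 0 ≤ p ∧ ((badSockets nx J v l).card : ℝ) ≤ p * (sockets N M J K).card ∧
      p * Real.sqrt (devSize J l) ≤ 1 / X ^ 3 := by
  have hN := hS.one_le hX
  have hN0 : (0 : ℝ) < N := by exact_mod_cast hN
  have hlX := hS.iter_le hJ hK hX hθ hl
  have hsq := hS.sq_le hX
  have hJ' : (3 : ℝ) ≤ J := by exact_mod_cast hJ
  have hK' : (2 : ℝ) ≤ K := by exact_mod_cast hK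
  have hJ0 : (0 : ℝ) ≤ (J : ℝ) - 1 := by linarith
  have hK0 : (0 : ℝ) ≤ (K : ℝ) - 1 := by linarith
  have hlN : 4 * l + 2 * (J * K) ≤ N := by
    have : (4 : ℝ) * l + 2 * (J * K) ≤ N := by
      have e : 0 ≤ 2 * ((J : ℝ) * K) := by positivity
      have e1 : (4 + 2 * ((J : ℝ) * K)) * X ≤ X * X := by gcongr
      nlinarith
    exact_mod_cast this
  have hC0 : 0 ≤ badConst J K := by unfold badConst; positivity
  set G := (((J : ℝ) - 1) ^ 2 * ((K : ℝ) - 1)) ^ l with hG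
  have hG0 : 0 ≤ G := by positivity
  set p := badConst J K * ((l : ℝ) + 1) ^ 4 * G / N with hp
  have hp0 : 0 ≤ p := by positivity
  refine ⟨p, hp0, card_badSockets_le nx v hJ hK hMK hN hlN, ?_⟩
  have h3 : (devSize J l : ℝ) ≤ J * ((J : ℝ) - 1) ^ l := by
    have := devSize_le_mul_pow hJ l
    rw [← cast_pred_eq (by omega : 1 ≤ J)]
    exact_mod_cast this
  have h4 : G ^ 2 * devSize J l ≤ J * lowBase J K ^ l := by
    have e : lowBase J K ^ l = G ^ 2 * ((J : ℝ) - 1) ^ l * ((K : ℝ) - 1) ^ l := by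
      rw [hG, ← pow_mul, mul_comm l 2, pow_mul, ← mul_pow, ← mul_pow, lowBase]
      ring
    have h5 : (1 : ℝ) ≤ ((K : ℝ) - 1) ^ l := one_le_pow₀ (by linarith)
    rw [e]
    have h6 : 0 ≤ (J : ℝ) * (G ^ 2 * ((J : ℝ) - 1) ^ l) := by positivity
    calc G ^ 2 * devSize J l ≤ G ^ 2 * (J * ((J : ℝ) - 1) ^ l) := by gcongr
      _ = J * (G ^ 2 * ((J : ℝ) - 1) ^ l) := by ring
      _ ≤ J * (G ^ 2 * ((J : ℝ) - 1) ^ l) * ((K : ℝ) - 1) ^ l := le_mul_of_one_le_right h6 h5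
      _ = _ := by ring
  have h7 := lowBase_pow_le hJ hK hN hl
  have hX0 : 0 < X := by linarith
  have key : (p * Real.sqrt (devSize J l)) ^ 2 ≤ (1 / X ^ 3) ^ 2 := by
    rw [mul_pow, Real.sq_sqrt (by positivity), div_pow 1, one_pow, le_div_iff₀ (by positivity)]
    have hN2 : (0 : ℝ) < (N : ℝ) ^ 2 := by positivity
    calc p ^ 2 * devSize J l * (X ^ 3) ^ 2
        = badConst J K ^ 2 * (((l : ℝ) + 1) ^ 4) ^ 2 * (G ^ 2 * devSize J l) * X ^ 6 / N ^ 2 := by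
          rw [hp]; field_simp
      _ ≤ badConst J K ^ 2 * (X ^ 4) ^ 2 * (J * (N : ℝ) ^ (2 * θ)) * X ^ 6 / N ^ 2 := by
          have h8 : G ^ 2 * devSize J l ≤ J * (N : ℝ) ^ (2 * θ) :=
            h4.trans (by gcongr)
          gcongr
      _ = badConst J K ^ 2 * J * X ^ 14 * (N : ℝ) ^ (2 * θ) / N ^ 2 := by ring
      _ ≤ X * X ^ 14 * (N : ℝ) ^ (2 * θ) / N ^ 2 := by gcongr
      _ ≤ X ^ 20 * (N : ℝ) ^ (2 * θ) / N ^ 2 := by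
          have : X * X ^ 14 ≤ X ^ 20 := by
            rw [← pow_succ']; exact pow_le_pow_right₀ (by linarith) (by norm_num)
          gcongr
      _ ≤ 1 := by
          rw [div_le_one hN2, mul_comm]
          exact hS.rpow_mul_le
  exact le_of_pow_le_pow_left₀ two_ne_zero (by positivity) key

lemma Scale.lt_lowBase_pow (hS : Scale J θ N X) (hJ : 3 ≤ J) (hK : 2 ≤ K) (hX : 2 ≤ X)
    (hθ : 1 / 2 ≤ θ) (hl : ¬ (l : ℝ) ≤ lowThreshold θ N J K) : (N : ℝ) < lowBase J K ^ l := by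
  have hN := hS.one_le hX
  refine lt_of_le_of_lt ?_ (LDPC.lt_lowBase_pow hJ hK hN hl)
  conv_lhs => rw [← Real.rpow_one (N : ℝ)]
  exact Real.rpow_le_rpow_of_exponent_le (by exact_mod_cast hN) (by linarith)

/-- Beyond the low-iteration regime the computation trees have polynomial size. -/
lemma Scale.pow_le_wUB {θ' : ℝ} (hS : Scale J θ' N X) (hJ : 3 ≤ J) (hK : 2 ≤ K) (hX : 2 ≤ X)
    (hθ : 1 / 2 ≤ θ') (hθ' : θ ≤ θ') (hl : ¬ (l : ℝ) ≤ lowThreshold θ' N J K) :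
    X ^ 4 ≤ wUB θ l N J K := by
  have hJ' : (3 : ℝ) ≤ J := by exact_mod_cast hJ
  have hK' : (2 : ℝ) ≤ K := by exact_mod_cast hK
  have hN := hS.one_le hX
  refine le_wUB_of_not_low hJ hK (fun h => hl (lowThreshold_mono hJ hK hN hθ' h)) ?_ ?_
  · exact le_trans (pow_le_pow_right₀ (by linarith) (by norm_num)) hS.pow_le
  · have hT : 0 ≤ ((J : ℝ) - 1) * ((K : ℝ) - 1) := mul_nonneg (by linarith) (by linarith)
    refine le_of_pow_le_pow_left₀ (n := 5) (by norm_num) (by positivity) ?_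
    calc (X ^ 4) ^ 5 = X ^ 20 := by ring
      _ ≤ (N : ℝ) := hS.pow_le
      _ ≤ lowBase J K ^ l := (hS.lt_lowBase_pow hJ hK hX hθ hl).le
      _ ≤ ((((J : ℝ) - 1) * ((K : ℝ) - 1)) ^ 5) ^ l := by
          have hB := le_lowBase hJ hK
          refine pow_le_pow_left₀ (by linarith) ?_ l
          rw [lowBase, mul_pow]
          have : (0 : ℝ) ≤ (J : ℝ) - 1 := by linarith
          have : ((K : ℝ) - 1) ^ 3 ≤ ((K : ℝ) - 1) ^ 5 :=
            pow_le_pow_right₀ (by linarith) (by norm_num)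
          gcongr
      _ = _ := by rw [← pow_mul, ← pow_mul, mul_comm 5]

end

/-! ### Averages over the ensemble -/

section
variable {J K N M l : ℕ} {θ θ' X : ℝ}

/-- The constant `E` such that for strong noise every bit error probability is at least
`1 / 2 - E / σ`. -/
noncomputable def noiseConst (J K : ℕ) : ℝ := (1 + J * K * (4 + 8 * (J : ℝ) ^ 2)) / 2 + 1

lemma noiseConst_pos (J K : ℕ) : 0 < noiseConst J K := by unfold noiseConst; positivity

/-- The threshold for the scale `X` beyond which all comparisons hold. -/
noncomputable def scaleMin (J K : ℕ) : ℝ :=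
  24 + 16 * (J : ℝ) ^ 2 + 1000 * noiseConst J K + (4 + 2 * ((J : ℝ) * K)) + badConst J K ^ 2 * J
    + (J * (K * (J * K)) + 1)

lemma scaleMin_le (hX : scaleMin J K ≤ X) : 24 ≤ X ∧ 16 * (J : ℝ) ^ 2 ≤ X ∧
    1000 * noiseConst J K ≤ X ∧ 4 + 2 * ((J : ℝ) * K) ≤ X ∧ badConst J K ^ 2 * J ≤ X ∧
      (J * (K * (J * K)) + 1 : ℝ) ≤ X := by
  unfold scaleMin at hX
  have h1 := noiseConst_pos J K
  have h2 : 0 ≤ 16 * (J : ℝ) ^ 2 := by positivity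
  have h3 : 0 ≤ 2 * ((J : ℝ) * K) := by positivity
  have h4 : 0 ≤ badConst J K ^ 2 * J := by positivity
  have h5 : 0 ≤ (J : ℝ) * (K * (J * K)) := by positivity
  refine ⟨?_, ?_, ?_, ?_, ?_, ?_⟩ <;> linarith

lemma Scale.const_lt (hS : Scale J θ N X) (hX : scaleMin J K ≤ X) : J * (K * (J * K)) + 1 < N := by
  obtain ⟨h24, -, -, -, -, h⟩ := scaleMin_le hX
  have h1 := hS.sq_le (by linarith)
  have : ((J * (K * (J * K)) + 1 : ℕ) : ℝ) < N := by push_cast; nlinarith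
  exact_mod_cast this

lemma Scale.noise (hS : Scale J θ N X) (hJ : 3 ≤ J) (hK : 3 ≤ K) (hX : scaleMin J K ≤ X) {σ : ℝ}
    (hσ : X ≤ σ) (l : ℕ) (v : Fin N) : ∀ g ∈ sockets N M J K,
      1 / 2 - noiseConst J K / σ ≤ nodeError ((biAWGN σ).law 0) (awgnLLR σ) g l v := by
  intro g hg
  obtain ⟨h24, h16, -⟩ := scaleMin_le hX
  have hσ0 : 0 < σ := by linarith
  have h := nodeError_ge_of_strong_noise (mem_sockets.1 hg) (by omega) hK (h16.trans hσ) l v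
  have h2 := hS.mul_exp_le σ hσ
  have e : noiseConst J K / σ = (1 + J * K * (4 + 8 * (J : ℝ) ^ 2)) / (2 * σ) + 1 / σ := by
    unfold noiseConst; field_simp
  rw [e]
  linarith

/-- The bound for one variable node in the low-iteration regime, over the Gaussian channel. -/
lemma Scale.awgn_low (hS : Scale J θ N X) (hJ : 3 ≤ J) (hK : 3 ≤ K) (hMK : M * K = N * J)
    (hX : scaleMin J K ≤ X) (hθ : θ ≤ 1) (hl1 : 1 ≤ l) (hl : (l : ℝ) ≤ lowThreshold θ N J K)
    {σ : ℝ} (hσ : 0 < σ) (v : Fin N) :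
    gaussTail σ (devSize J l) * (sockets N M J K).card
      ≤ ∑ g ∈ sockets N M J K, nodeError ((biAWGN σ).law 0) (awgnLLR σ) g l v := by
  have hc := scaleMin_le hX
  obtain ⟨h24, -, hE, hJK, hC, -⟩ := hc
  have hX0 : 0 < X := by linarith
  have hsel := isSelection_cyc (M := M) (K := K) (by omega)
  have hsel3 := cyc_cyc_ne (M := M) hK
  have hD4 : (4 : ℝ) ≤ devSize J l := by exact_mod_cast four_le_devSize hJ hl1
  obtain ⟨p, hp0, hp, hpD⟩ := hS.exists_bad_le hJ (by omega) hMK (by linarith) hJK hC hθ hl cyc v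
  have hpX : p ≤ 1 / X ^ 3 := by
    refine le_trans (le_mul_of_one_le_right hp0 ?_) hpD
    exact Real.one_le_sqrt.2 (by linarith)
  have hX3 : 1 / X ^ 3 ≤ 1 / (24 * 24 * X) := by
    apply one_div_le_one_div_of_le (by positivity)
    rw [pow_succ, sq]
    gcongr
  have hX3' : 1 / X ^ 3 ≤ 1 / (24 * X ^ 2) := by
    apply one_div_le_one_div_of_le (by positivity)
    calc 24 * X ^ 2 ≤ X * X ^ 2 := by gcongr
      _ = X ^ 3 := by ring
  have hp2 : p ≤ 1 / 2 := by
    refine hpX.trans (hX3.trans (one_div_le_one_div_of_le (by norm_num) (by linarith)))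
  -- for weak noise, the twins suffice
  rcases le_total σ (1 / X) with h1 | h1
  · refine awgn_twin_sum_ge hσ hsel hMK (hS.const_lt hX) l v (by linarith) ?_
    refine hS.pow_le_exp.trans (Real.exp_le_exp.2 ?_)
    have h2 : σ * X ≤ 1 := (le_div_iff₀ hX0).1 h1
    have h3 : X ^ 2 * σ ^ 2 ≤ 1 := by
      rw [← mul_pow, mul_comm]; exact pow_le_one₀ (by positivity) h2
    rw [le_div_iff₀ (by positivity)]
    nlinarith [sq_nonneg σ]
  have hXσ : 1 / X ≤ σ := h1
  -- moderate noise: the gain beats `2 * p ≤ 2 / X ^ 3`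
  rcases le_total σ 1 with h2 | h2
  · refine awgn_moderate_sum_ge hσ (by omega) hsel hsel3 hl1 le_rfl (by linarith) hp hp0 hp2
      (le_trans ?_ (gain_factor_ge_of_le_one hσ h2))
    have h3 : 1 / (24 * 24 * X) = 1 / X / 576 := by field_simp; norm_num
    linarith
  rcases le_total σ X with h3 | h3
  · refine awgn_moderate_sum_ge hσ (by omega) hsel hsel3 hl1 le_rfl (by linarith) hp hp0 hp2
      (le_trans ?_ (gain_factor_ge_of_one_le h2))
    have h4 : 1 / (24 * X ^ 2) ≤ 1 / (24 * σ ^ 2) :=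
      one_div_le_one_div_of_le (by positivity) (by gcongr)
    have h5 : 1 / (12 * σ ^ 2) = 2 * (1 / (24 * σ ^ 2)) := by field_simp; norm_num
    linarith
  · have hE0 := noiseConst_pos J K
    refine awgn_strong_sum_ge h2 (by omega) hsel hsel3 hl1 le_rfl (by linarith) hp hp2 hE0.le ?_ ?_
      (hS.noise hJ hK hX h3 l v)
    · rw [div_le_iff₀ hσ]; linarith
    · calc p * Real.sqrt (devSize J l) * noiseConst J K ≤ 1 / (24 * 24 * X) * (X / 1000) := by
            gcongr
            · exact hpD.trans hX3
            · linarith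
        _ ≤ 9 / 1000 := by
            rw [show 1 / (24 * 24 * X) * (X / 1000) = 1 / 576000 by field_simp; norm_num]
            norm_num

/-- The bound for one variable node beyond the low-iteration regime, over the Gaussian channel. -/
lemma Scale.awgn_high (hS : Scale J θ N X) (hJ : 3 ≤ J) (hK : 3 ≤ K) (hMK : M * K = N * J)
    (hX : scaleMin J K ≤ X) {w : ℝ} (hw : X ^ 4 ≤ w) {σ : ℝ} (hσ : 0 < σ) (l : ℕ) (v : Fin N) :
    gaussTail σ w * (sockets N M J K).card
      ≤ ∑ g ∈ sockets N M J K, nodeError ((biAWGN σ).law 0) (awgnLLR σ) g l v := by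
  obtain ⟨h24, -, hE, -⟩ := scaleMin_le hX
  have hX0 : 0 < X := by linarith
  have hsel := isSelection_cyc (M := M) (K := K) (by omega)
  have hX2 : 24 ≤ X ^ 2 := by nlinarith
  have hX4 : X ^ 4 = X ^ 2 * X ^ 2 := by ring
  rcases le_total σ X with h | h
  · refine awgn_twin_sum_ge hσ hsel hMK (hS.const_lt hX) l v (by nlinarith) ?_
    refine hS.pow_le_exp.trans (Real.exp_le_exp.2 ?_)
    have h1 : σ ^ 2 ≤ X ^ 2 := by gcongr
    rw [le_div_iff₀ (by positivity)]
    nlinarith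
  · refine awgn_strong_sum_ge_of_large (by linarith) ?_ ?_ (hS.noise hJ hK hX h l v)
    · rw [div_le_iff₀ hσ]; linarith
    · have h1 : X ^ 2 ≤ Real.sqrt w := Real.le_sqrt_of_sq_le (by nlinarith)
      nlinarith

/-- The bound for one variable node in the low-iteration regime, over the symmetric channel. -/
lemma Scale.bsc_low (hS : Scale J θ N X) (hJ : 3 ≤ J) (hK : 3 ≤ K) (hMK : M * K = N * J)
    (hX : scaleMin J K ≤ X) (hθ : θ ≤ 1) (hl1 : 1 ≤ l) (hl : (l : ℝ) ≤ lowThreshold θ N J K)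
    {q : ℝ} (hq0 : 0 < q) (hq : q ≤ 1 / 2) (v : Fin N) :
    q ^ (((devSize J l : ℝ) + 1) / 2) * (sockets N M J K).card
      ≤ ∑ g ∈ sockets N M J K, nodeError ((bsc q).law 0) (bscLLR q) g l v := by
  obtain ⟨h24, -, -, hJK, hC, -⟩ := scaleMin_le hX
  have hX0 : 0 < X := by linarith
  have hsel := isSelection_cyc (M := M) (K := K) (by omega)
  have hD4 : (4 : ℝ) ≤ devSize J l := by exact_mod_cast four_le_devSize hJ hl1
  obtain ⟨p, hp0, hp, hpD⟩ := hS.exists_bad_le hJ (by omega) hMK (by linarith) hJK hC hθ hl cyc v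
  have hp4 : p ≤ 1 / 4 := by
    refine le_trans (le_mul_of_one_le_right hp0 ?_) (hpD.trans ?_)
    · exact Real.one_le_sqrt.2 (by linarith)
    · apply one_div_le_one_div_of_le (by norm_num)
      calc (4 : ℝ) ≤ X := by linarith
        _ = X ^ 1 := (pow_one X).symm
        _ ≤ X ^ 3 := pow_le_pow_right₀ (by linarith) (by norm_num)
  have ht : 0 < q ^ (((devSize J l : ℝ) + 1) / 2) := Real.rpow_pos_of_pos hq0 _
  refine good_bad_sum_ge cyc v l (x := Real.sqrt 2 * q ^ (((devSize J l : ℝ) + 1) / 2)) (y := 0) hp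
    (by positivity) (fun g hg hG => ?_) (fun g _ => nodeError_nonneg l) ?_
  · obtain ⟨S, hv, hcard, hle⟩ := (bsc_symLLR hq0 hq).1.exists_pairError_le (mem_sockets.1 hg) hsel
      (Or.inl hG)
    exact le_trans (bsc_pairError_ge_sqrt_two hq0 hq ⟨v, hv⟩ (by linarith) (by exact_mod_cast hcard))
      hle
  · have h2 : 7 / 5 ≤ Real.sqrt 2 := Real.le_sqrt_of_sq_le (by norm_num)
    have h3 : 1 ≤ (1 - p) * Real.sqrt 2 := by nlinarith
    nlinarith

/-- The bound for one variable node beyond the low-iteration regime, over the symmetric channel. -/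
lemma Scale.bsc_high (hS : Scale J θ N X) (hK : 3 ≤ K) (hMK : M * K = N * J)
    (hX : scaleMin J K ≤ X) {w : ℝ} (hw : X ^ 4 ≤ w) {q : ℝ} (hq0 : 0 < q) (hq : q ≤ 1 / 2)
    (l : ℕ) (v : Fin N) :
    q ^ ((w + 1) / 2) * (sockets N M J K).card
      ≤ ∑ g ∈ sockets N M J K, nodeError ((bsc q).law 0) (bscLLR q) g l v := by
  obtain ⟨h24, -⟩ := scaleMin_le hX
  have hsel := isSelection_cyc (M := M) (K := K) (by omega)
  have hX2 : 24 ≤ X ^ 2 := by nlinarith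
  have hX4 : X ^ 4 = X ^ 2 * X ^ 2 := by ring
  refine (bsc_symLLR hq0 hq).1.twin_sum_ge hsel hMK (hS.const_lt hX) l v
    (Real.rpow_nonneg hq0.le _) fun u hu => ?_
  refine le_trans ?_ (bsc_pairError_even hq0 hq (k := 1) le_rfl (by rw [Finset.card_pair hu.symm]))
  have e : q ^ ((w + 1) / 2) = q * q ^ ((w - 1) / 2) := by
    conv_rhs => enter [1]; rw [← Real.rpow_one q]
    rw [← Real.rpow_add hq0]; ring_nf
  have h1 : q ^ ((w - 1) / 2) ≤ Real.exp (-(X ^ 2 / 2 - 1)) := by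
    calc q ^ ((w - 1) / 2) ≤ (1 / 2) ^ ((w - 1) / 2) :=
          Real.rpow_le_rpow hq0.le hq (by nlinarith)
      _ = Real.exp (-(Real.log 2 * ((w - 1) / 2))) := by
          rw [Real.rpow_def_of_pos (by norm_num), one_div, Real.log_inv, neg_mul]
      _ ≤ _ := by
          apply Real.exp_le_exp.2
          have h2 : 24 * X ^ 2 ≤ w := by nlinarith
          have h3 : 1 / 2 * ((w - 1) / 2) ≤ Real.log 2 * ((w - 1) / 2) :=
            mul_le_mul_of_nonneg_right (by linarith [Real.log_two_gt_d9]) (by linarith)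
          linarith
  rw [e, pow_one, mul_assoc]
  refine mul_le_of_le_one_right hq0.le ?_
  calc q ^ ((w - 1) / 2) * (((N * J : ℕ) : ℝ) ^ 2) ^ J
      ≤ Real.exp (-(X ^ 2 / 2 - 1)) * Real.exp (X ^ 2 / 2 - 1) := by
        gcongr
        exact hS.pow_le_exp
    _ = 1 := by rw [← Real.exp_add]; simp

end

section
variable {J K N M l : ℕ} {θ : ℝ}

/-- For `K = 2`, and without iterations, the bound holds for every graph. -/
lemma SymLLR.exists_pairError_le_wUB {Y : Type} [MeasurableSpace Y] {ν : MeasureTheory.Measure Y}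
    {Λ : Y → ℝ} {ι : Y → Y} (h : SymLLR ν Λ ι) (hJ : 3 ≤ J) (hK : 2 ≤ K) (hKl : K = 2 ∨ l = 0)
    {g : Fin M × Fin K → Fin N} (hg : IsSocket J g) (v : Fin N) :
    ∃ S : Finset (Fin N), S.Nonempty ∧ (S.card : ℝ) ≤ wUB θ l N J K ∧
      pairError ν Λ S ≤ nodeError ν Λ g l v := by
  obtain ⟨S, hv, hcard, hle⟩ := h.exists_pairError_le (l := l) (v := v) hg
    (isSelection_cyc (M := M) hK) (Or.inr hKl)
  refine ⟨S, ⟨v, hv⟩, ?_, hle⟩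
  refine le_trans ?_ (min_devSize_le_wUB (θ := θ) (l := l) (N := N) hJ hK)
  have h2 := Finset.card_le_univ S
  rw [Fintype.card_fin] at h2
  exact_mod_cast le_min hcard h2

/-- For large `N` the bounds hold on average over the graphs, for each variable node. -/
lemma exists_node_bounds (hJ : 3 ≤ J) (hK : 2 ≤ K) (hθ : θ < 1) :
    ∃ N₀ : ℕ, ∀ N M : ℕ, N₀ ≤ N → M * K = N * J → 1 ≤ N ∧ K ≤ N ∧ ∀ (l : ℕ) (v : Fin N),
      (∀ σ : ℝ, 0 < σ → gaussTail σ (wUB θ l N J K) * (sockets N M J K).card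
        ≤ ∑ g ∈ sockets N M J K, nodeError ((biAWGN σ).law 0) (awgnLLR σ) g l v) ∧
      (∀ q : ℝ, 0 < q → q ≤ 1 / 2 → q ^ ((wUB θ l N J K + 1) / 2) * (sockets N M J K).card
        ≤ ∑ g ∈ sockets N M J K, nodeError ((bsc q).law 0) (bscLLR q) g l v) := by
  -- Enlarging `θ` enlarges the regime in which the bound is the size of a deviation. There the bound
  -- is only larger if the given `θ` prescribes another case, by `devSize_le_wUB`.
  set θ' := max θ (1 / 2) with hθ'
  have hθ'1 : θ' < 1 := max_lt hθ (by norm_num)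
  obtain ⟨N₀, hN₀, hscale⟩ := exists_scale J (by omega) (le_max_right θ (1 / 2)) hθ'1 (scaleMin J K)
  refine ⟨N₀, fun N M hN hMK => ?_⟩
  obtain ⟨X, hX, hS⟩ := hscale N hN
  have hX2 : 2 ≤ X := by linarith [(scaleMin_le hX).1]
  have hXJ : (J : ℝ) ≤ X := by
    have hJ' : (3 : ℝ) ≤ J := by exact_mod_cast hJ
    nlinarith [(scaleMin_le hX).2.1]
  have hKN : K ≤ N := by
    have h1 := hS.const_lt hX
    have h2 : K ≤ K * (J * K) := Nat.le_mul_of_pos_right _ (by positivity)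
    have h3 : K * (J * K) ≤ J * (K * (J * K)) := Nat.le_mul_of_pos_left _ (by omega)
    omega
  refine ⟨by omega, hKN, fun l v => ?_⟩
  by_cases hKl : K = 2 ∨ l = 0
  · constructor
    · intro σ hσ
      rw [mul_comm, ← nsmul_eq_mul]
      refine Finset.card_nsmul_le_sum _ _ _ fun g hg => ?_
      obtain ⟨S, hne, hcard, hle⟩ := (awgn_symLLR hσ).1.exists_pairError_le_wUB (θ := θ) hJ hK hKl
        (mem_sockets.1 hg) v
      rw [awgn_pairError hσ hne] at hle
      exact (gaussTail_antitone hcard).trans hle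
    · intro q hq0 hq
      rw [mul_comm, ← nsmul_eq_mul]
      refine Finset.card_nsmul_le_sum _ _ _ fun g hg => ?_
      obtain ⟨S, hne, hcard, hle⟩ := (bsc_symLLR hq0 hq).1.exists_pairError_le_wUB (θ := θ) hJ hK hKl
        (mem_sockets.1 hg) v
      exact (bsc_pairError_ge hq0 hq hne hcard).trans hle
  push Not at hKl
  have hK3 : 3 ≤ K := by omega
  have hl1 : 1 ≤ l := by omega
  by_cases hl : (l : ℝ) ≤ lowThreshold θ' N J K
  · have hD := devSize_le_wUB (θ := θ) hJ hK (hS.devSize_le hJ hK hX2 hXJ hθ'1.le hl)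
    constructor
    · intro σ hσ
      exact (mul_le_mul_of_nonneg_right (gaussTail_antitone hD) (Nat.cast_nonneg _)).trans
        (hS.awgn_low hJ hK3 hMK hX hθ'1.le hl1 hl hσ v)
    · intro q hq0 hq
      exact (mul_le_mul_of_nonneg_right (rpow_le_of_le_one hq0 hq (by linarith))
        (Nat.cast_nonneg _)).trans (hS.bsc_low hJ hK3 hMK hX hθ'1.le hl1 hl hq0 hq v)
  · have hw := hS.pow_le_wUB hJ hK hX2 (le_max_right _ _) (le_max_left θ (1 / 2)) hl
    exact ⟨fun σ hσ => hS.awgn_high hJ hK3 hMK hX hw hσ l v,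
      fun q hq0 hq => hS.bsc_high hK3 hMK hX hw hq0 hq l v⟩

lemma bec_averageBER_ge (hJ : 3 ≤ J) (hK : 2 ≤ K) (hMK : M * K = N * J) (hKN : K ≤ N)
    {ε : ℝ} (h0 : 0 ≤ ε) (h1 : ε ≤ 1) :
    ε ^ wUB θ l N J K ≤ averageBER (bec ε) 1 l N M J K := by
  have hN : 1 ≤ N := by omega
  have hw := wUB_pos (θ := θ) (l := l) hJ hK hN
  rcases h0.eq_or_lt with rfl | h0
  -- the exponent is positive, so the bound for `ε = 0` is zero
  · rw [Real.zero_rpow (by linarith)]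
    exact averageBER_nonneg _ zero_le_one _ _ _ _ _
  refine le_averageBER _ hN (sockets_nonempty hMK hKN) (fun _ _ => ε ^ wUB θ l N J K)
    (fun g hg s _ v => ?_) (fun v => by rw [Finset.sum_const, nsmul_eq_mul, mul_comm])
  have hsock := mem_sockets.1 hg
  refine le_trans ?_ (bec_bitError_ge h0 h1 (card_checksOf_matOf hsock)
    (fun c => by rw [card_varsOf_matOf hsock]; exact hK) le_rfl s v)
  rw [← Real.rpow_natCast]
  exact Real.rpow_le_rpow_of_exponent_ge h0 h1 (min_devSize_le_wUB hJ hK)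

lemma chernoff_le_gaussQ {σ w : ℝ} (hσ : 0 < σ) (hw : 0 ≤ w) :
    chernoffConst * (2 : ℝ) ^ (-(1 / (σ ^ 2 * Real.log 2)) * w) ≤ gaussQ (Real.sqrt (w / σ ^ 2)) := by
  have h := chernoffConst_le (Real.sqrt_nonneg (w / σ ^ 2))
  have hlog : 0 < Real.log 2 := Real.log_pos one_lt_two
  rw [Real.sq_sqrt (by positivity)] at h
  have e : (2 : ℝ) ^ (-(1 / (σ ^ 2 * Real.log 2)) * w) = Real.exp (-(w / σ ^ 2)) := by
    rw [Real.rpow_def_of_pos two_pos]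
    congr 1
    field_simp
  rw [e]
  calc _ ≤ gaussQ (Real.sqrt (w / σ ^ 2)) * Real.exp (w / σ ^ 2) * Real.exp (-(w / σ ^ 2)) := by
        gcongr
    _ = _ := by rw [mul_assoc, ← Real.exp_add]; simp

/-! ### The double-exponential form -/

lemma two_rpow_logb_mul (hJ : 3 ≤ J) (l : ℕ) :
    (2 : ℝ) ^ (Real.logb 2 ((J : ℝ) - 1) * l) = ((J : ℝ) - 1) ^ l := by
  have hJ' : (3 : ℝ) ≤ J := by exact_mod_cast hJ
  rw [Real.rpow_mul two_pos.le, Real.rpow_logb two_pos (by norm_num) (by linarith),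
    Real.rpow_natCast]

lemma rpow_mul_two_rpow {q : ℝ} (hq0 : 0 < q) (hq1 : q ≤ 1) (s t : ℝ) :
    q ^ s * (2 : ℝ) ^ (-(|Real.logb 2 q| * t)) = q ^ (s + t) := by
  have h : |Real.logb 2 q| = -Real.logb 2 q :=
    abs_of_nonpos (Real.logb_nonpos one_lt_two hq0.le hq1)
  rw [h, neg_mul, neg_neg, Real.rpow_mul two_pos.le, Real.rpow_logb two_pos (by norm_num) hq0,
    Real.rpow_add hq0]

lemma abs_logb_pos {q : ℝ} (hq0 : 0 < q) (hq1 : q < 1) : 0 < |Real.logb 2 q| :=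
  abs_pos.2 (Real.logb_neg one_lt_two hq0 hq1).ne

lemma awgn_doubleExp (hJ : 3 ≤ J) {σ P : ℝ} (hσ : 0 < σ)
    (hP : chernoffConst * (2 : ℝ) ^ (-(1 / (σ ^ 2 * Real.log 2)) *
      (((J : ℝ) * ((J : ℝ) - 1) ^ l - 2) / ((J : ℝ) - 2))) ≤ P) :
    DoubleExpLowerBound (chernoffConst * Real.exp (2 / (σ ^ 2 * ((J : ℝ) - 2))))
      (1 / (σ ^ 2 * Real.log 2) * ((J : ℝ) / ((J : ℝ) - 2))) (Real.logb 2 ((J : ℝ) - 1)) l P := by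
  have hJ' : (3 : ℝ) ≤ J := by exact_mod_cast hJ
  have hJ2 : 0 < (J : ℝ) - 2 := by linarith
  have hlog : 0 < Real.log 2 := Real.log_pos one_lt_two
  have hc := chernoffConst_pos
  refine ⟨by positivity, by positivity, le_of_eq_of_le ?_ hP⟩
  rw [two_rpow_logb_mul hJ, mul_assoc, Real.rpow_def_of_pos two_pos, Real.rpow_def_of_pos two_pos,
    ← Real.exp_add]
  congr 2
  field_simp
  ring

lemma bsc_doubleExp (hJ : 3 ≤ J) {q P : ℝ} (hq0 : 0 < q) (hq1 : q < 1)
    (hP : q ^ ((((J : ℝ) * ((J : ℝ) - 1) ^ l - 2) / ((J : ℝ) - 2) + 1) / 2) ≤ P) :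
    DoubleExpLowerBound (q ^ (((J : ℝ) - 4) / (2 * ((J : ℝ) - 2))))
      (|Real.logb 2 q| * ((J : ℝ) / (2 * ((J : ℝ) - 2)))) (Real.logb 2 ((J : ℝ) - 1)) l P := by
  have hJ' : (3 : ℝ) ≤ J := by exact_mod_cast hJ
  have hJ2 : 0 < (J : ℝ) - 2 := by linarith
  have ha := abs_logb_pos hq0 hq1
  refine ⟨by positivity, by positivity, le_of_eq_of_le ?_ hP⟩
  rw [two_rpow_logb_mul hJ, neg_mul, mul_assoc, rpow_mul_two_rpow hq0 hq1.le]
  congr 1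
  field_simp
  ring

lemma bec_doubleExp (hJ : 3 ≤ J) {ε P : ℝ} (h0 : 0 < ε) (h1 : ε < 1)
    (hP : ε ^ (((J : ℝ) * ((J : ℝ) - 1) ^ l - 2) / ((J : ℝ) - 2)) ≤ P) :
    DoubleExpLowerBound (ε ^ (-(2 / ((J : ℝ) - 2))))
      (|Real.logb 2 ε| * ((J : ℝ) / ((J : ℝ) - 2))) (Real.logb 2 ((J : ℝ) - 1)) l P := by
  have hJ' : (3 : ℝ) ≤ J := by exact_mod_cast hJ
  have hJ2 : 0 < (J : ℝ) - 2 := by linarith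
  have ha := abs_logb_pos h0 h1
  refine ⟨by positivity, by positivity, le_of_eq_of_le ?_ hP⟩
  rw [two_rpow_logb_mul hJ, neg_mul, mul_assoc, rpow_mul_two_rpow h0 h1.le]
  congr 1
  field_simp
  ring

end

end LDPC
theorem theorem2 (J K : ℕ) (hJ : 3 ≤ J) (hK : 2 ≤ K) (θ : ℝ) (hθ : θ < 1) :
    ∃ N₀ : ℕ, ∀ N M : ℕ, N₀ ≤ N → M * K = N * J → ∀ l : ℕ,
      -- the three channel bounds
      (∀ σ τ : ℝ, 0 < σ → 1 / 2 ≤ τ → τ ≤ 1 →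
        LDPC.gaussQ (Real.sqrt (LDPC.wUB θ l N J K / σ ^ 2)) ≤
            LDPC.averageBER (LDPC.biAWGN σ) τ l N M J K ∧
          LDPC.chernoffConst * (2 : ℝ) ^ (-(1 / (σ ^ 2 * Real.log 2)) * LDPC.wUB θ l N J K) ≤
            LDPC.gaussQ (Real.sqrt (LDPC.wUB θ l N J K / σ ^ 2))) ∧
      (∀ q τ : ℝ, 0 ≤ q → q ≤ 1 / 2 → 1 / 2 ≤ τ → τ ≤ 1 →
        q ^ ((LDPC.wUB θ l N J K + 1) / 2) ≤ LDPC.averageBER (LDPC.bsc q) τ l N M J K) ∧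
      (∀ ε : ℝ, 0 ≤ ε → ε ≤ 1 →
        ε ^ LDPC.wUB θ l N J K ≤ LDPC.averageBER (LDPC.bec ε) 1 l N M J K) ∧
      -- the double-exponential form in the low-iteration regime
      ((l : ℝ) ≤ LDPC.lowThreshold θ N J K →
        (∀ σ τ : ℝ, 0 < σ → 1 / 2 ≤ τ → τ ≤ 1 →
          LDPC.DoubleExpLowerBound
            (LDPC.chernoffConst * Real.exp (2 / (σ ^ 2 * ((J : ℝ) - 2))))
            (1 / (σ ^ 2 * Real.log 2) * ((J : ℝ) / ((J : ℝ) - 2)))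
            (Real.logb 2 ((J : ℝ) - 1)) l (LDPC.averageBER (LDPC.biAWGN σ) τ l N M J K)) ∧
        (∀ q τ : ℝ, 0 < q → q ≤ 1 / 2 → 1 / 2 ≤ τ → τ ≤ 1 →
          LDPC.DoubleExpLowerBound
            (q ^ (((J : ℝ) - 4) / (2 * ((J : ℝ) - 2))))
            (|Real.logb 2 q| * ((J : ℝ) / (2 * ((J : ℝ) - 2))))
            (Real.logb 2 ((J : ℝ) - 1)) l (LDPC.averageBER (LDPC.bsc q) τ l N M J K)) ∧
        (∀ ε : ℝ, 0 < ε → ε < 1 →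
          LDPC.DoubleExpLowerBound
            (ε ^ (-(2 / ((J : ℝ) - 2))))
            (|Real.logb 2 ε| * ((J : ℝ) / ((J : ℝ) - 2)))
            (Real.logb 2 ((J : ℝ) - 1)) l (LDPC.averageBER (LDPC.bec ε) 1 l N M J K))) := by
  obtain ⟨N₀, hN₀⟩ := LDPC.exists_node_bounds (θ := θ) hJ hK hθ
  refine ⟨N₀, fun N M hN hMK l => ?_⟩
  obtain ⟨hN1, hKN, hnode⟩ := hN₀ N M hN hMK
  have hne := LDPC.sockets_nonempty hMK hKN
  have hw := LDPC.wUB_pos (θ := θ) (l := l) hJ hK hN1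
  have awgn : ∀ σ τ : ℝ, 0 < σ → 1 / 2 ≤ τ →
      LDPC.gaussQ (Real.sqrt (LDPC.wUB θ l N J K / σ ^ 2)) ≤
        LDPC.averageBER (LDPC.biAWGN σ) τ l N M J K := fun σ τ hσ hτ =>
    LDPC.le_averageBER _ hN1 hne (fun g v => LDPC.nodeError _ _ g l v)
      (fun g hg s hs v => (LDPC.awgn_symLLR hσ).1.nodeError_le_bitError rfl
        (LDPC.awgn_symLLR hσ).2 (LDPC.awgn_llr hσ) (LDPC.mem_sockets.1 hg) hK hτ l v hs)
      (fun v => (hnode l v).1 σ hσ)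
  have chernoff : ∀ σ : ℝ, 0 < σ →
      LDPC.chernoffConst * (2 : ℝ) ^ (-(1 / (σ ^ 2 * Real.log 2)) * LDPC.wUB θ l N J K) ≤
        LDPC.gaussQ (Real.sqrt (LDPC.wUB θ l N J K / σ ^ 2)) := fun σ hσ =>
    LDPC.chernoff_le_gaussQ hσ (by linarith)
  have bsc : ∀ q τ : ℝ, 0 ≤ q → q ≤ 1 / 2 → 1 / 2 ≤ τ →
      q ^ ((LDPC.wUB θ l N J K + 1) / 2) ≤ LDPC.averageBER (LDPC.bsc q) τ l N M J K := by
    intro q τ hq0 hq hτ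
    rcases hq0.eq_or_lt with rfl | hq0
    · rw [Real.zero_rpow (by linarith)]
      exact LDPC.averageBER_nonneg _ (by linarith) _ _ _ _ _
    exact LDPC.le_averageBER _ hN1 hne (fun g v => LDPC.nodeError _ _ g l v)
      (fun g hg s hs v => (LDPC.bsc_symLLR hq0 hq).1.nodeError_le_bitError rfl
        (LDPC.bsc_symLLR hq0 hq).2 (LDPC.bsc_llr hq0 hq) (LDPC.mem_sockets.1 hg) hK hτ l v hs)
      (fun v => (hnode l v).2 q hq0 hq)
  have bec : ∀ ε : ℝ, 0 ≤ ε → ε ≤ 1 →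
      ε ^ LDPC.wUB θ l N J K ≤ LDPC.averageBER (LDPC.bec ε) 1 l N M J K :=
    fun ε h0 h1 => LDPC.bec_averageBER_ge hJ hK hMK hKN h0 h1
  refine ⟨fun σ τ hσ hτ _ => ⟨awgn σ τ hσ hτ, chernoff σ hσ⟩,
    fun q τ hq0 hq hτ _ => bsc q τ hq0 hq hτ, bec, fun hl => ?_⟩
  have hwl := LDPC.wUB_of_low hl
  refine ⟨fun σ τ hσ hτ _ => LDPC.awgn_doubleExp hJ hσ ?_,
    fun q τ hq0 hq hτ _ => LDPC.bsc_doubleExp hJ hq0 (by linarith) ?_,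
    fun ε h0 h1 => LDPC.bec_doubleExp hJ h0 h1 ?_⟩
  · rw [← hwl]
    exact (chernoff σ hσ).trans (awgn σ τ hσ hτ)
  · rw [← hwl]
    exact bsc q τ hq0.le hq hτ
  · rw [← hwl]
    exact bec ε h0.le h1.le
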